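/- **Notation.** Let $N\ge 2$, $0<x<1$, and let $r\in\mathbb C$ with $\operatorname{Re} r\ne 0$, $r\ne 1$; let $s\in\mathbb C$. Fix a square root $\kappa=\sqrt{(r-1)/r}$ and put $\sqrt{r/(r-1)}=\kappa^{-1}$, $\sqrt{r(r-1)}=r\kappa$, $[a]=\frac{x^a-x^{-a}}{x-x^{-1}}$, $\tau=\frac{\pi i}{\log x}$, $z=x^{2u}$. All indices $1,\dots,N$ are read cyclically. Let $\epsilon_i$ be the standard orthonormal basis of $\mathbb R^N$, $\bar\epsilon_i=\epsilon_i-\frac1N\sum_j\epsilon_j$, $P=\sum_i\mathbb Z\bar\epsilon_i$, $\alpha_i=\bar\epsilon_i-\bar\epsilon_{i+1}$. The oscillators $\beta^j_m$ ($1\le j\le N$, $m\in\mathbb Z\setminus\{0\}$) satisfy $$[\beta^i_m,\beta^i_n]=m\tfrac{[(r-1)m]}{[rm]}\tfrac{[(s-1)m]}{[sm]}\delta_{m+n,0},\qquad [\beta^i_m,\beta^j_n]=-m\tfrac{[(r-1)m]}{[rm]}\tfrac{[m]}{[sm]}x^{sm\,\mathrm{sgn}(i-j)}\delta_{m+n,0}\quad(i\ne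 j),$$ and $[iP_\lambda,Q_\mu]=(\lambda,\mu)$ for $\lambda,\mu\in P$. They act on $\mathcal F=\bigoplus_{l,k\in P}\mathcal F_{l,k}$, $\mathcal F_{l,k}=\mathbb C[\beta^j_{-m}:m>0]\,|l,k\rangle$, where $\beta_m^j|l,k\rangle=0$ for $m>0$, $P_\lambda|l,k\rangle=(\lambda,\kappa^{-1}l-\kappa k)|l,k\rangle$ and $|l,k\rangle=e^{i\kappa^{-1}Q_l-i\kappa Q_k}|0,0\rangle$. **The automorphism.** The Dynkin-diagram automorphism $\eta$ is given by $\eta(\beta^j_m)=x^{-\frac{2s}Nm}\beta^{j+1}_m$ for $1\le j\le N-1$, $\eta(\beta^N_m)=x^{\frac{2s}N(N-1)m}\beta^1_m$ and $\eta(\epsilon_i)=\epsilon_{i+1}$. It acts on $\mathcal F$ and its completion, with $\eta|l,k\rangle=|\eta(l),\eta(k)\rangle$, and on operators by $\eta(X)=\eta X\eta^{-1}$. **Screening currents.** Let $B^j_m=(\beta^j_m-\beta^{j+1}_m)x^{-\frac{2s}Njm}$ for $1\le j\le N-1$, $B^N_m=x^{-2sm}\beta^N_m-\beta^1_m$, and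 $$F_j(z)=e^{i\kappa Q_{\alpha_j}}\bigl(x^{(\frac{2s}N-1)j}z\bigr)^{\kappa P_{\alpha_j}+\frac{r-1}r}:\exp\Bigl(\sum_{m\ne0}\tfrac1mB^j_mz^{-m}\Bigr):\qquad(1\le j\le N-1),$$ $$F_N(z)=e^{i\kappa Q_{\alpha_N}}(x^{2s-N}z)^{\kappa P_{\bar\epsilon_N}+\frac{r-1}{2r}}z^{-\kappa P_{\bar\epsilon_1}+\frac{r-1}{2r}}:\exp\Bigl(\sum_{m\ne0}\tfrac1mB^N_mz^{-m}\Bigr):.$$ A product $F_{j_1}(z_1)F_{j_2}(z_2)\cdots$ means the composition of operators for $|z_1|\gg|z_2|\gg\cdots$ and its meromorphic continuation elsewhere; it maps $\mathcal F$ to the completion of $\mathcal F$ (formal power series in the $\beta^j_{-m}$). **Theta functions.** With $(z;q)_\infty=\prod_{j\ge0}(1-zq^j)$ and $\Theta_q(z)=(z;q)_\infty(q/z;q)_\infty(q;q)_\infty$ let $[u]_r=x^{u^2/r-u}\,\Theta_{x^{2r}}(x^{2u})$ if $\operatorname{Re}r>0$, and $[u]_r=1/[u]_{-r}$ if $\operatorname{Re}r<0$.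 In both cases $[u+r]_r=-[u]_r=[-u]_r$ and $[u+\tau]_r=-e^{\frac{2\pi i}r(u+\frac\tau2)}[u]_r$. Let $\vartheta(u^{(1)}|\cdots|u^{(N)})$ be any function with values in the functions of the zero modes $P_\lambda$ that is holomorphic at all points with $\operatorname{Re}u^{(1)}=\cdots=\operatorname{Re}u^{(N)}=0$ (on each $\mathcal F_{l,k}$) and satisfies, for $1\le t\le N$ and $k\in\mathbb C$, $$\vartheta(\cdots|u^{(t)}+r|\cdots)=\vartheta(\cdots|u^{(t)}|\cdots),$$ $$\vartheta(\cdots|u^{(t)}+\tau|\cdots)=e^{\frac{2\pi i}r\left(\tau-(u^{(t-1)}-2u^{(t)}+u^{(t+1)}+\sqrt{r(r-1)}P_{\alpha_t})\right)}\vartheta(\cdots|u^{(t)}|\cdots),$$ $$\vartheta(u^{(1)}+k|\cdots|u^{(N)}+k)=\vartheta(u^{(1)}|\cdots|u^{(N)}),$$ $$\eta\bigl(\vartheta(u^{(1)}|\cdots|u^{(N)})\bigr)=\vartheta(u^{(N)}|u^{(1)}|\cdots|u^{(N-1)}).$$ **Nonlocal integrals of motion.** For $m\ge1$ and $0<\operatorname{Re}s<2$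 put $$\mathcal G_m=\prod_{t=1}^N\prod_{j=1}^m\oint_{|z^{(t)}_j|=1}\frac{dz^{(t)}_j}{2\pi i\,z^{(t)}_j}\;F_1(z^{(1)}_1)\cdots F_1(z^{(1)}_m)\cdots F_N(z^{(N)}_1)\cdots F_N(z^{(N)}_m)$$ $$\times\frac{\prod_{t=1}^N\prod_{1\le i<j\le m}[u^{(t)}_i-u^{(t)}_j]_r\,[u^{(t)}_j-u^{(t)}_i-1]_r}{\prod_{t=1}^{N-1}\prod_{i,j=1}^m[u^{(t)}_i-u^{(t+1)}_j+1-\frac sN]_r\;\prod_{i,j=1}^m[u^{(1)}_i-u^{(N)}_j+\frac sN]_r}\;\vartheta\Bigl(\sum_ju^{(1)}_j\Bigr|\cdots\Bigr|\sum_ju^{(N)}_j\Bigr),$$ where the integral is taken matrix element by matrix element. For other $s$, $\mathcal G_m$ is defined by analytic continuation in $s$ of its matrix elements. **Theorem.** Let $m\ge1$. For $0<\operatorname{Re}s<2$ the integrals defining the matrix elements of $\mathcal G_m$ converge absolutely, and $$\eta(\mathcal G_m)=\mathcal G_m .$$ More generally, let $D\subset\mathbb C$ be open and connected and meet the strip $0<\operatorname{Re}s<2$,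 and let $s\mapsto\mathcal G_m(s)$ be a family of linear operators, $s\in D$, whose matrix elements are holomorphic on $D$ and which is given by the integral above at all $s\in D$ with $0<\operatorname{Re}s<2$. Then $\eta(\mathcal G_m(s))=\mathcal G_m(s)$ for every $s\in D$. -/

import Mathlib

noncomputable section

namespace DeformedW

/-! ### Bosons -/

/-- The labels `(j, m)` of the creation operators `β_{-m}^j`; the index `j : Fin N` stands for the
index `j + 1` of the usual numbering `1, …, N`, and `Fin N` is added cyclically. -/
abbrev Osc (N : ℕ) := Fin N × ℕ+

/-- The vacuum module `ℂ[β_{-m}^j]` of the oscillators, `β_{-m}^j` being the variable `X (j, m)`. -/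
abbrev OscPoly (N : ℕ) := MvPolynomial (Osc N) ℂ

/-- The completion of the vacuum module. -/
abbrev OscSeries (N : ℕ) := MvPowerSeries (Osc N) ℂ

/-- `[a] = (x^a - x^{-a}) / (x - x⁻¹)`. -/
def qnum (x : ℝ) (a : ℂ) : ℂ := ((x : ℂ) ^ a - (x : ℂ) ^ (-a)) / ((x : ℂ) - (x : ℂ)⁻¹)

/-- The number `c` in `[β_m^i, β_n^j] = c δ_{m+n,0}`. -/
def betaComm {N : ℕ} (x : ℝ) (r s : ℂ) (m : ℤ) (i j : Fin N) : ℂ :=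
  if i = j then
    m * (qnum x ((r - 1) * m) / qnum x (r * m)) * (qnum x ((s - 1) * m) / qnum x (s * m))
  else
    -(m * (qnum x ((r - 1) * m) / qnum x (r * m)) * (qnum x m / qnum x (s * m)) *
      (x : ℂ) ^ (s * m * (Int.sign ((i : ℤ) - (j : ℤ)) : ℂ)))

/-- The oscillator `β_m^j` (`m ≠ 0`) on the vacuum module: a multiplication operator for `m < 0`,
a derivation killing the vacuum for `m > 0`. -/
def beta {N : ℕ} (x : ℝ) (r s : ℂ) (m : ℤ) (j : Fin N) : Module.End ℂ (OscPoly N) :=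
  if m < 0 then LinearMap.mulLeft ℂ (MvPolynomial.X (j, m.natAbs.toPNat'))
  else if 0 < m then
    ∑ i, betaComm x r s m j i •
      (MvPolynomial.pderiv (R := ℂ) ((i, m.natAbs.toPNat') : Osc N)).toLinearMap
  else 0

/-! ### Weights and zero modes -/

/-- `\bar ε_i = ε_i - (1/N) ∑_j ε_j`. -/
def epsBar {N : ℕ} (i : Fin N) : Fin N → ℝ := Pi.single i 1 - fun _ => 1 / (N : ℝ)

/-- The weight lattice `P = ∑_i ℤ \bar ε_i`. -/
def weightLattice (N : ℕ) : AddSubgroup (Fin N → ℝ) :=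
  AddSubgroup.closure (Set.range epsBar)

theorem epsBar_mem {N : ℕ} (i : Fin N) : epsBar i ∈ weightLattice N :=
  AddSubgroup.subset_closure ⟨i, rfl⟩

/-- `α_j = \bar ε_j - \bar ε_{j+1}`, with `j + 1` read cyclically. -/
def alpha {N : ℕ} [NeZero N] (j : Fin N) : weightLattice N :=
  ⟨epsBar j - epsBar (j + 1), sub_mem (epsBar_mem j) (epsBar_mem (j + 1))⟩

/-- The bilinear form `(a, p) = ∑_i a_i p_i`. -/
def pairing {N : ℕ} (a : Fin N → ℝ) (p : Fin N → ℂ) : ℂ := ∑ i, (a i : ℂ) * p i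

/-- The labels `(l, k)` of the Fock spaces `F_{l,k}`. -/
abbrev Sector (N : ℕ) := weightLattice N × weightLattice N

/-- With `κ = √((r-1)/r)`, the vector `κ⁻¹ l - κ k`; the operator `P_λ` acts on `F_{l,k}` as the
number `(λ, κ⁻¹ l - κ k)`. -/
def momentum {N : ℕ} (κ : ℂ) (σ : Sector N) : Fin N → ℂ :=
  fun i => κ⁻¹ * ((σ.1 : Fin N → ℝ) i : ℂ) - κ * ((σ.2 : Fin N → ℝ) i : ℂ)

/-- The Fock space `⨁_{l,k} F_{l,k}`. -/
abbrev Fock (N : ℕ) := Sector N →₀ OscPoly N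

/-- The completed Fock space, where vertex operators take their values. -/
abbrev FockHat (N : ℕ) := Sector N → OscSeries N

/-! ### Currents -/

/-- The coefficient of `β_m^i` in `B_m^j`. -/
def bCoeff {N : ℕ} [NeZero N] (x : ℝ) (s : ℂ) (m : ℤ) (j i : Fin N) : ℂ :=
  if (j : ℕ) + 1 < N then
    ((if i = j then 1 else 0) - (if i = j + 1 then 1 else 0)) *
      (x : ℂ) ^ (-(2 * s / N) * ((j : ℂ) + 1) * m)
  else
    (if i = j then (x : ℂ) ^ (-2 * s * m) else 0) - (if i = j + 1 then 1 else 0)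

/-- The coefficient of `β_{-m}^i` in the creation part `∑_{m>0} (-1/m) B_{-m}^j z^m` of
`∑_{m≠0} (1/m) B_m^j z^{-m}`, at `z = x^{2u}`. -/
def creation {N : ℕ} [NeZero N] (x : ℝ) (s : ℂ) (j : Fin N) (u : ℂ) (v : Osc N) : ℂ :=
  -(1 / (v.2 : ℂ)) * bCoeff x s (-(v.2 : ℤ)) j v.1 * (x : ℂ) ^ (2 * u * (v.2 : ℂ))

/-- The coefficient of `∂ / ∂β_{-m}^i` in the annihilation part `∑_{m>0} (1/m) B_m^j z^{-m}`, at
`z = x^{2u}`. -/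
def annihilation {N : ℕ} [NeZero N] (x : ℝ) (r s : ℂ) (j : Fin N) (u : ℂ) (v : Osc N) : ℂ :=
  (1 / (v.2 : ℂ)) * (∑ a, bCoeff x s (v.2 : ℤ) j a * betaComm x r s (v.2 : ℤ) a v.1) *
    (x : ℂ) ^ (-(2 * u * (v.2 : ℂ)))

/-- The power series `exp (∑_v A_v X_v)`. -/
def expSeries {N : ℕ} (A : Osc N → ℂ) : OscSeries N :=
  fun b => b.prod fun v n => A v ^ n / (n.factorial : ℂ)

/-- The operator `exp (∑_v D_v ∂/∂X_v)`, which is the translation `X_v ↦ X_v + D_v`. -/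
def translate {N : ℕ} (D : Osc N → ℂ) : OscPoly N →ₐ[ℂ] OscPoly N :=
  MvPolynomial.aeval fun v => MvPolynomial.X v + MvPolynomial.C (D v)

/-- The normally ordered exponential `exp (∑_v A_v X_v) exp (∑_v D_v ∂/∂X_v)`. -/
def normalExp {N : ℕ} (A D : Osc N → ℂ) : OscPoly N →ₗ[ℂ] OscSeries N :=
  LinearMap.mulLeft ℂ (expSeries A) ∘ₗ
    (MvPolynomial.coeToMvPowerSeries.algHom ℂ).toLinearMap ∘ₗ (translate D).toLinearMap

/-- The value of the factor
`(x^{(2s/N-1)j} z)^{κ P_{α_j} + (r-1)/r}` of `F_j(z)`, `1 ≤ j ≤ N-1`, respectively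
`(x^{2s-N} z)^{κ P_{\bar ε_N} + (r-1)/(2r)} z^{-κ P_{\bar ε_1} + (r-1)/(2r)}` of `F_N(z)`,
on a vector of momentum `p`, at `z = x^{2u}`. -/
def zeroMode {N : ℕ} [NeZero N] (x : ℝ) (r s κ : ℂ) (j : Fin N) (u : ℂ) (p : Fin N → ℂ) : ℂ :=
  if (j : ℕ) + 1 < N then
    (x : ℂ) ^ (((2 * s / N - 1) * ((j : ℂ) + 1) + 2 * u) *
      (κ * pairing (alpha j : Fin N → ℝ) p + (r - 1) / r))
  else
    (x : ℂ) ^ ((2 * s - N + 2 * u) * (κ * pairing (epsBar j) p + (r - 1) / (2 * r))) *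
      (x : ℂ) ^ (2 * u * (-κ * pairing (epsBar (j + 1)) p + (r - 1) / (2 * r)))

/-- The screening current `F_j(z)`, `z = x^{2u}`. The factor `e^{iκQ_{α_j}}` maps `F_{l,k}` to
`F_{l,k-α_j}`. -/
def screening {N : ℕ} [NeZero N] (x : ℝ) (r s κ : ℂ) (j : Fin N) (u : ℂ) :
    Fock N →ₗ[ℂ] FockHat N where
  toFun ψ σ := zeroMode x r s κ j u (momentum κ (σ.1, σ.2 + alpha j)) •
    normalExp (creation x s j u) (annihilation x r s j u) (ψ (σ.1, σ.2 + alpha j))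
  map_add' ψ φ := by
    funext σ
    simp only [Finsupp.add_apply, map_add, smul_add, Pi.add_apply]
  map_smul' c ψ := by
    funext σ
    simp only [Finsupp.smul_apply, map_smul, RingHom.id_apply, Pi.smul_apply]
    rw [smul_comm]

/-! ### Theta functions and products of currents -/

/-- `(z; q)_∞`, for `|q| < 1`. -/
def qPoch (z q : ℂ) : ℂ := ∏' j : ℕ, (1 - z * q ^ j)

/-- `Θ_q(z) = (z; q)_∞ (q/z; q)_∞ (q; q)_∞`. -/
def bigTheta (q z : ℂ) : ℂ := qPoch z q * qPoch (q / z) q * qPoch q q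

/-- `x^{u²/r - u} Θ_{x^{2r}}(x^{2u})`, for `Re r > 0`. -/
def thetaPos (x : ℝ) (r u : ℂ) : ℂ :=
  (x : ℂ) ^ (u ^ 2 / r - u) * bigTheta ((x : ℂ) ^ (2 * r)) ((x : ℂ) ^ (2 * u))

/-- The theta symbol `[u]_r`. For `Re r < 0`, where the infinite products in `thetaPos x r`
diverge, `1 / [u]_{-r}` is the function with the same quasi-periods
`[u+r]_r = -[u]_r = [-u]_r` and `[u+τ]_r = -e^{(2πi/r)(u+τ/2)} [u]_r`, `τ = πi / log x`. -/
def theta (x : ℝ) (r u : ℂ) : ℂ :=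
  if 0 < r.re then thetaPos x r u else (thetaPos x (-r) u)⁻¹

/-- The meromorphic continuation in `y` of `exp (∑_{m>0} (1/m) ([(r-1)m] / [rm]) y^m)`. -/
def pairFun (x : ℝ) (r y : ℂ) : ℂ :=
  if 0 < r.re then
    qPoch ((x : ℂ) ^ (2 * r - 1) * y) ((x : ℂ) ^ (2 * r)) /
      qPoch ((x : ℂ) * y) ((x : ℂ) ^ (2 * r))
  else
    qPoch ((x : ℂ) ^ (1 - 2 * r) * y) ((x : ℂ) ^ (-2 * r)) /
      qPoch ((x : ℂ)⁻¹ * y) ((x : ℂ) ^ (-2 * r))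

/-- The contraction of the oscillator parts of `F_i(z₁)` and `F_j(z₂)` as a function of
`w = z₂/z₁`: the meromorphic continuation of `exp (-∑_{m>0} (1/m²) [B_m^i, B_{-m}^j] w^m)`
(see `contraction_eq_exp`). -/
def contraction {N : ℕ} [NeZero N] (x : ℝ) (r s : ℂ) (i j : Fin N) (w : ℂ) : ℂ :=
  (if j = i + 1 then pairFun x r ((x : ℂ) ^ (2 * s / N - 1) * w) else 1) *
  (if i = j + 1 then pairFun x r ((x : ℂ) ^ (1 - 2 * s / N) * w) else 1) *
  (if i = j then (pairFun x r ((x : ℂ) * w) * pairFun x r ((x : ℂ)⁻¹ * w))⁻¹ else 1)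

/-- The product of all contractions in `F_{j₁}(z₁) F_{j₂}(z₂) ⋯`, for a list of pairs `(j, u)`,
`z = x^{2u}`. -/
def listContraction {N : ℕ} [NeZero N] (x : ℝ) (r s : ℂ) : List (Fin N × ℂ) → ℂ
  | [] => 1
  | a :: L => (L.map fun b => contraction x r s a.1 b.1 ((x : ℂ) ^ (2 * (b.2 - a.2)))).prod *
      listContraction x r s L

/-- The sum of the `α_j` over a list of currents. -/
def listAlpha {N : ℕ} [NeZero N] (L : List (Fin N × ℂ)) : weightLattice N :=
  (L.map fun a => alpha a.1).sum

/-- The product of the zero mode factors of a list of currents, on a vector of the sector `σ`. -/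
def listZeroMode {N : ℕ} [NeZero N] (x : ℝ) (r s κ : ℂ) : List (Fin N × ℂ) → Sector N → ℂ
  | [], _ => 1
  | a :: L, σ => zeroMode x r s κ a.1 a.2 (momentum κ (σ.1, σ.2 - listAlpha L)) *
      listZeroMode x r s κ L σ

/-- The product `F_{j₁}(z₁) F_{j₂}(z₂) ⋯ F_{j_n}(z_n)` for the list of the pairs `(j, u)`,
`z = x^{2u}`. It is the composition of the operators for `|z₁| ≫ |z₂| ≫ ⋯ ≫ |z_n|` (see
`currentProd_singleton` and `currentProd_cons`), and the meromorphic continuation of this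
composition elsewhere. -/
def currentProd {N : ℕ} [NeZero N] (x : ℝ) (r s κ : ℂ) (L : List (Fin N × ℂ)) :
    Fock N →ₗ[ℂ] FockHat N where
  toFun ψ σ := (listContraction x r s L * listZeroMode x r s κ L (σ.1, σ.2 + listAlpha L)) •
    normalExp (L.map fun a => creation x s a.1 a.2).sum
      (L.map fun a => annihilation x r s a.1 a.2).sum (ψ (σ.1, σ.2 + listAlpha L))
  map_add' ψ φ := by
    funext σ
    simp only [Finsupp.add_apply, map_add, smul_add, Pi.add_apply]
  map_smul' c ψ := by
    funext σ
    simp only [Finsupp.smul_apply, map_smul, RingHom.id_apply, Pi.smul_apply]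
    rw [smul_comm]

/-! ### The Dynkin diagram automorphism -/

/-- The number `c` in `η(β_{-m}^j) = c β_{-m}^{j+1}`. -/
def etaScalar {N : ℕ} (x : ℝ) (s : ℂ) (v : Osc N) : ℂ :=
  if (v.1 : ℕ) + 1 < N then (x : ℂ) ^ (2 * s / N * (v.2 : ℂ))
  else (x : ℂ) ^ (-(2 * s / N) * ((N : ℂ) - 1) * (v.2 : ℂ))

theorem etaScalar_ne_zero {N : ℕ} {x : ℝ} (hx : 0 < x) (s : ℂ) (v : Osc N) :
    etaScalar x s v ≠ 0 := by
  have h : (x : ℂ) ≠ 0 := Complex.ofReal_ne_zero.mpr hx.ne'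
  unfold etaScalar
  split_ifs <;> simp [Complex.cpow_eq_zero_iff, h]

/-- `β_{-m}^j ↦ β_{-m}^{j+1}` on labels. -/
def oscRot (N : ℕ) [NeZero N] : Osc N ≃ Osc N := (Equiv.addRight (1 : Fin N)).prodCongr (Equiv.refl _)

/-- The action of `η` on the vacuum module: the algebra automorphism with
`η(β_{-m}^j) = x^{2sm/N} β_{-m}^{j+1}` for `1 ≤ j ≤ N-1` and
`η(β_{-m}^N) = x^{-(2s/N)(N-1)m} β_{-m}^1`. -/
def etaPoly {N : ℕ} [NeZero N] (x : ℝ) (s : ℂ) (hx : 0 < x) : OscPoly N ≃ₐ[ℂ] OscPoly N :=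
  AlgEquiv.ofAlgHom
    (MvPolynomial.aeval fun v => MvPolynomial.C (etaScalar x s v) * MvPolynomial.X (oscRot N v))
    (MvPolynomial.aeval fun v => MvPolynomial.C (etaScalar x s ((oscRot N).symm v))⁻¹ *
      MvPolynomial.X ((oscRot N).symm v))
    (by
      ext1 v
      have h := etaScalar_ne_zero hx s ((oscRot N).symm v)
      simp [← mul_assoc, MvPolynomial.algebraMap_eq, ← MvPolynomial.C_mul, h])
    (by
      ext1 v
      have h := etaScalar_ne_zero hx s v
      simp [← mul_assoc, MvPolynomial.algebraMap_eq, ← MvPolynomial.C_mul, h])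

/-- The extension of `etaPoly` to the completion. -/
def etaSeries {N : ℕ} [NeZero N] (x : ℝ) (s : ℂ) : OscSeries N →ₗ[ℂ] OscSeries N where
  toFun φ b := ((b.equivMapDomain (oscRot N).symm).prod fun v n => etaScalar x s v ^ n) *
    MvPowerSeries.coeff (b.equivMapDomain (oscRot N).symm) φ
  map_add' φ χ := by
    funext b
    simp only [map_add, mul_add]
    rfl
  map_smul' c φ := by
    funext b
    simp only [map_smul, smul_eq_mul, RingHom.id_apply]
    rw [mul_left_comm]
    rfl

/-- The linear extension of `ε_i ↦ ε_{i+1}`. -/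
def etaVec (N : ℕ) [NeZero N] (R : Type*) [AddCommGroup R] : (Fin N → R) ≃+ (Fin N → R) where
  toFun p i := p (i - 1)
  invFun p i := p (i + 1)
  left_inv p := by funext i; simp
  right_inv p := by funext i; simp
  map_add' p q := rfl

theorem etaVec_epsBar {N : ℕ} [NeZero N] (i : Fin N) :
    etaVec N ℝ (epsBar i) = epsBar (i + 1) := by
  funext a
  simp [etaVec, epsBar, Pi.single_apply, sub_eq_iff_eq_add]

theorem etaVec_mem {N : ℕ} [NeZero N] (v : Fin N → ℝ) :
    v ∈ weightLattice N ↔ etaVec N ℝ v ∈ weightLattice N := by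
  have h : (weightLattice N).map (etaVec N ℝ).toAddMonoidHom = weightLattice N := by
    rw [weightLattice, AddMonoidHom.map_closure, ← Set.range_comp]
    congr 1
    ext w
    constructor
    · rintro ⟨i, rfl⟩
      exact ⟨i + 1, (etaVec_epsBar i).symm⟩
    · rintro ⟨i, rfl⟩
      exact ⟨i - 1, by simp [etaVec_epsBar]⟩
  constructor
  · intro hv
    rw [← h]
    exact ⟨v, hv, rfl⟩
  · intro hv
    rw [← h] at hv
    obtain ⟨w, hw, e⟩ := hv
    rwa [← (etaVec N ℝ).injective e]

/-- The action `(l, k) ↦ (η(l), η(k))` of `η` on the labels of the Fock spaces. -/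
def etaSector (N : ℕ) [NeZero N] : Sector N ≃ Sector N :=
  ((etaVec N ℝ).toEquiv.subtypeEquiv etaVec_mem).prodCongr
    ((etaVec N ℝ).toEquiv.subtypeEquiv etaVec_mem)

/-- The operator of the automorphism `η` on the Fock space: `|l,k⟩ ↦ |η(l),η(k)⟩`, and
`etaPoly` on the oscillators. -/
def eta {N : ℕ} [NeZero N] (x : ℝ) (s : ℂ) (hx : 0 < x) : Fock N ≃ₗ[ℂ] Fock N :=
  (Finsupp.mapRange.linearEquiv (etaPoly x s hx).toLinearEquiv).trans
    (Finsupp.domLCongr (etaSector N))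

/-- The extension of `eta` to the completion. -/
def etaHat {N : ℕ} [NeZero N] (x : ℝ) (s : ℂ) : FockHat N →ₗ[ℂ] FockHat N where
  toFun φ σ := etaSeries x s (φ ((etaSector N).symm σ))
  map_add' φ χ := by funext σ; simp
  map_smul' c φ := by funext σ; simp

/-- The automorphism `X ↦ η(X) = η ∘ X ∘ η⁻¹` of operators. -/
def etaOp {N : ℕ} [NeZero N] (x : ℝ) (s : ℂ) (hx : 0 < x) (X : Fock N → FockHat N) :
    Fock N → FockHat N :=
  fun ψ => etaHat x s (X ((eta x s hx).symm ψ))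

/-! ### Nonlocal integrals of motion -/

/-- `τ = πi / log x`; a shift of `u` by `τ` is a turn of `z = x^{2u}` around the origin. -/
def tau (x : ℝ) : ℂ := Real.pi * Complex.I / Real.log x

/-- The conditions on the theta function `ϑ(u^{(1)}|…|u^{(N)})`. It is an operator that acts on a
vector of momentum `p` as the number `ϑ u p`, where `P_λ` acts as `(λ, p)`. With
`κ = √((r-1)/r)` one has `r κ = √(r(r-1))`. -/
structure IsTheta {N : ℕ} [NeZero N] (x : ℝ) (r κ : ℂ)
    (ϑ : (Fin N → ℂ) → (Fin N → ℂ) → ℂ) : Prop where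
  /-- On the Fock spaces `ϑ` is holomorphic along the contour. (For `Re r > 0` one takes `ϑ`
  entire; for `Re r < 0` only meromorphic functions have the quasi-periods below.) -/
  analyticAt : ∀ (σ : Sector N) (u : Fin N → ℂ), (∀ t, (u t).re = 0) →
    AnalyticAt ℂ (fun v => ϑ v (momentum κ σ)) u
  add_r : ∀ t u p, ϑ (Function.update u t (u t + r)) p = ϑ u p
  add_tau : ∀ t u p, ϑ (Function.update u t (u t + tau x)) p =
    Complex.exp (2 * Real.pi * Complex.I / r *
      (tau x - (u (t - 1) - 2 * u t + u (t + 1) + r * κ * pairing (alpha t : Fin N → ℝ) p))) *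
      ϑ u p
  add_const : ∀ (k : ℂ) u p, ϑ (fun t => u t + k) p = ϑ u p
  /-- `η(ϑ(u^{(1)}|…|u^{(N)})) = ϑ(u^{(N)}|u^{(1)}|…|u^{(N-1)})`. -/
  eta_eq : ∀ u p, ϑ u p = ϑ (fun t => u (t - 1)) (etaVec N ℂ p)

/-- `ϑ(u^{(1)}|…|u^{(N)})` as an operator on the Fock space. -/
def thetaOp {N : ℕ} (κ : ℂ) (ϑ : (Fin N → ℂ) → (Fin N → ℂ) → ℂ) (u : Fin N → ℂ) :
    Fock N →ₗ[ℂ] Fock N :=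
  Finsupp.lsum ℂ fun σ => ϑ u (momentum κ σ) • Finsupp.lsingle σ

/-- The list of currents in
`F_1(z_1^{(1)}) ⋯ F_1(z_m^{(1)}) F_2(z_1^{(2)}) ⋯ F_2(z_m^{(2)}) ⋯ F_N(z_1^{(N)}) ⋯ F_N(z_m^{(N)})`. -/
def currentList {N m : ℕ} (u : Fin N × Fin m → ℂ) : List (Fin N × ℂ) :=
  (List.finRange N).flatMap fun t => (List.finRange m).map fun j => (t, u (t, j))

/-- The scalar kernel of `G_m`. In the denominator, `t = N` contributes
`∏_{i,j} [u_i^{(1)} - u_j^{(N)} + s/N]_r`. -/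
def kernel {N m : ℕ} [NeZero N] (x : ℝ) (r s : ℂ) (u : Fin N × Fin m → ℂ) : ℂ :=
  (∏ t : Fin N, ∏ i : Fin m, ∏ j ∈ Finset.Ioi i,
    theta x r (u (t, i) - u (t, j)) * theta x r (u (t, j) - u (t, i) - 1)) /
  ∏ t : Fin N, ∏ i : Fin m, ∏ j : Fin m,
    if (t : ℕ) + 1 < N then theta x r (u (t, i) - u (t + 1, j) + 1 - s / N)
    else theta x r (u (t + 1, i) - u (t, j) + s / N)

/-- The integrand of `G_m`, as an operator. -/
def integrand {N m : ℕ} [NeZero N] (x : ℝ) (r s κ : ℂ) (ϑ : (Fin N → ℂ) → (Fin N → ℂ) → ℂ)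
    (u : Fin N × Fin m → ℂ) : Fock N →ₗ[ℂ] FockHat N :=
  kernel x r s u • (currentProd x r s κ (currentList u) ∘ₗ
    thetaOp κ ϑ fun t => ∑ j, u (t, j))

/-- The point `u_j^{(t)} = θ_j^{(t)} τ`, i.e. `z_j^{(t)} = e^{2πi θ_j^{(t)}}`. -/
def contourPoint {N m : ℕ} (x : ℝ) (θ : Fin N × Fin m → ℝ) : Fin N × Fin m → ℂ :=
  fun a => θ a * tau x

/-- The nonlocal integral of motion `G_m`, for `Re r ≠ 0` and `0 < Re s < 2`, computed coefficient
by coefficient. The contour consists of the unit circles `|z_j^{(t)}| = 1`, on which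
`dz / (2πi z) = dθ` for `z = e^{2πiθ}`. They satisfy
`|x^{2s/N} z_j^{(t+1)}| < |z_i^{(t)}| < |x^{-2+2s/N} z_j^{(t+1)}|` for all cyclic `t`, since
`0 < Re s < 2 ≤ N`. -/
def nonlocalIM {N : ℕ} [NeZero N] (x : ℝ) (r s κ : ℂ) (ϑ : (Fin N → ℂ) → (Fin N → ℂ) → ℂ)
    (m : ℕ) : Fock N → FockHat N :=
  fun ψ σ b => ∫ θ in Set.Icc (0 : Fin N × Fin m → ℝ) 1,
    MvPowerSeries.coeff b (integrand x r s κ ϑ (contourPoint x θ) ψ σ)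

/-! ### Consistency: the continued products of currents against the composition of operators -/

theorem expSeries_zero_coeff {N : ℕ} (A : Osc N → ℂ) :
    MvPowerSeries.constantCoeff (expSeries A) = 1 := by
  rw [← MvPowerSeries.coeff_zero_eq_constantCoeff_apply]
  simp [expSeries, MvPowerSeries.coeff_apply]

theorem expSeries_coeff {N : ℕ} (A : Osc N → ℂ) (b : Osc N →₀ ℕ) :
    MvPowerSeries.coeff b (expSeries A) = b.prod fun v n => A v ^ n / (n.factorial : ℂ) := rfl

theorem expSeries_pderiv {N : ℕ} (A : Osc N → ℂ) (v : Osc N) :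
    MvPowerSeries.pderiv ℂ v (expSeries A) = A v • expSeries A := by
  ext b
  rw [MvPowerSeries.coeff_pderiv, MvPowerSeries.coeff_smul, expSeries_coeff, expSeries_coeff]
  have h0 : ∀ w : Osc N, A w ^ 0 / ((0 : ℕ).factorial : ℂ) = 1 := by simp
  have e1 : (b + Finsupp.single v 1) = b.erase v + Finsupp.single v (b v + 1) := by
    ext w
    by_cases h : w = v
    · subst h; simp
    · simp [h]
  have e2 : b = b.erase v + Finsupp.single v (b v) := (Finsupp.erase_add_single v b).symm
  have hd : ∀ n : ℕ, Disjoint (b.erase v).support (Finsupp.single v n).support := by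
    intro n
    refine Finset.disjoint_left.mpr fun w hw hw' => ?_
    have e : w = v := by simpa using Finsupp.support_single_subset hw'
    subst e
    exact absurd hw (by simp)
  rw [e1, Finsupp.prod_add_index_of_disjoint (hd _)]
  conv_rhs => rw [e2, Finsupp.prod_add_index_of_disjoint (hd _)]
  rw [Finsupp.prod_single_index (h0 v), Finsupp.prod_single_index (h0 v)]
  rw [Nat.factorial_succ]
  have : ((b v : ℂ) + 1) ≠ 0 := by exact_mod_cast Nat.succ_ne_zero (b v)
  have h2 : ((b v).factorial : ℂ) ≠ 0 := by exact_mod_cast Nat.factorial_ne_zero _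
  push_cast
  field_simp
  ring

theorem expSeries_unique {N : ℕ} (A : Osc N → ℂ) (φ χ : OscSeries N)
    (h0 : MvPowerSeries.constantCoeff φ = MvPowerSeries.constantCoeff χ)
    (hφ : ∀ v, MvPowerSeries.pderiv ℂ v φ = A v • φ)
    (hχ : ∀ v, MvPowerSeries.pderiv ℂ v χ = A v • χ) : φ = χ := by
  have key : ∀ (k : ℕ) (b : Osc N →₀ ℕ), b.degree = k →
      MvPowerSeries.coeff b φ = MvPowerSeries.coeff b χ := by
    intro k
    induction k with
    | zero =>
      intro b hb
      have : b = 0 := (Finsupp.degree_eq_zero_iff b).mp hb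
      subst this
      simpa using h0
    | succ k ih =>
      intro b hb
      obtain ⟨v, hv⟩ : ∃ v, b v ≠ 0 := by
        by_contra! hcon
        have : b = 0 := Finsupp.ext hcon
        simp [this] at hb
      have hle : Finsupp.single v 1 ≤ b := by
        rw [Finsupp.single_le_iff]
        omega
      obtain ⟨c, rfl⟩ := exists_add_of_le hle
      rw [add_comm] at hb hv ⊢
      have hc : c.degree = k := by
        rw [map_add, Finsupp.degree_single] at hb
        omega
      have e := ih c hc
      have e1 := congrArg (MvPowerSeries.coeff c) (hφ v)
      have e2 := congrArg (MvPowerSeries.coeff c) (hχ v)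
      rw [MvPowerSeries.coeff_pderiv, MvPowerSeries.coeff_smul] at e1 e2
      rw [e, ← e2] at e1
      have hne : ((c v : ℂ) + 1) ≠ 0 := by exact_mod_cast Nat.succ_ne_zero (c v)
      exact mul_right_cancel₀ hne e1
  ext b
  exact key _ b rfl

theorem expSeries_add {N : ℕ} (A B : Osc N → ℂ) :
    expSeries (A + B) = expSeries A * expSeries B := by
  refine expSeries_unique (A + B) _ _ ?_ (expSeries_pderiv _) fun v => ?_
  · simp [expSeries_zero_coeff]
  · rw [Derivation.leibniz, expSeries_pderiv, expSeries_pderiv, smul_eq_mul, smul_eq_mul,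
      mul_smul_comm, mul_smul_comm, mul_comm (expSeries B), add_comm, Pi.add_apply, add_smul]

theorem expSeries_norm {N : ℕ} (y : Osc N → ℂ) (d : Osc N →₀ ℕ) :
    ((‖MvPowerSeries.coeff d (expSeries y)‖ : ℝ) : ℂ) =
      MvPowerSeries.coeff d (expSeries fun v => ((‖y v‖ : ℝ) : ℂ)) := by
  simp only [expSeries_coeff, Finsupp.prod, norm_prod, norm_div, norm_pow, Complex.norm_natCast]
  push_cast
  rfl

theorem hasSum_expSeries_single {N : ℕ} (v : Osc N) (c : ℂ) :
    Summable (fun d => MvPowerSeries.coeff d (expSeries (Pi.single v c : Osc N → ℂ))) ∧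
    ∑' d, MvPowerSeries.coeff d (expSeries (Pi.single v c : Osc N → ℂ)) = Complex.exp c := by
  have hinj : Function.Injective (fun n : ℕ => (Finsupp.single v n : Osc N →₀ ℕ)) :=
    Finsupp.single_injective v
  have h : HasSum (fun d => MvPowerSeries.coeff d (expSeries (Pi.single v c : Osc N → ℂ)))
      (Complex.exp c) := by
    rw [← hinj.hasSum_iff]
    · have := NormedSpace.expSeries_div_hasSum_exp (𝔸 := ℂ) c
      rw [← Complex.exp_eq_exp_ℂ] at this
      have e : ((fun d => MvPowerSeries.coeff d (expSeries (Pi.single v c : Osc N → ℂ))) ∘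
          fun n : ℕ => (Finsupp.single v n : Osc N →₀ ℕ)) =
          fun n : ℕ => c ^ n / (n.factorial : ℂ) := by
        funext n
        rw [Function.comp_apply, expSeries_coeff, Finsupp.prod_single_index] <;> simp
      rw [e]
      exact this
    · intro d hd
      have : ∃ w ∈ d.support, w ≠ v := by
        by_contra! hcon
        refine hd ⟨d v, ?_⟩
        ext w
        by_cases hw : w = v
        · subst hw; simp
        · have : d w = 0 := by
            by_contra h0
            exact hw (hcon w (by simpa using h0))
          simp [this, Ne.symm hw]
      obtain ⟨w, hw, hwv⟩ := this
      rw [expSeries_coeff]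
      refine Finset.prod_eq_zero hw ?_
      have : d w ≠ 0 := by simpa using hw
      simp [hwv, this]
  exact ⟨h.summable, h.tsum_eq⟩

theorem summable_antidiagonal {N : ℕ} (f g : (Osc N →₀ ℕ) → ℂ)
    (hf : Summable fun d => ‖f d‖) (hg : Summable fun d => ‖g d‖) :
    (Summable fun d => ‖∑ p ∈ Finset.HasAntidiagonal.antidiagonal d, f p.1 * g p.2‖) ∧
    ∑' d, ∑ p ∈ Finset.HasAntidiagonal.antidiagonal d, f p.1 * g p.2 = (∑' d, f d) * ∑' d, g d := by
  have h5 := summable_mul_of_summable_norm hf hg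
  have h6 : Summable fun p : (Osc N →₀ ℕ) × (Osc N →₀ ℕ) => ‖f p.1‖ * ‖g p.2‖ :=
    hf.mul_of_nonneg hg (fun _ => norm_nonneg _) fun _ => norm_nonneg _
  constructor
  · refine Summable.of_nonneg_of_le (fun _ => norm_nonneg _) (fun d => ?_)
      (summable_sum_mul_antidiagonal_of_summable_mul (f := fun d => ‖f d‖)
        (g := fun d => ‖g d‖) h6)
    refine (norm_sum_le _ _).trans (le_of_eq ?_)
    exact Finset.sum_congr rfl fun p _ => by rw [norm_mul]
  · rw [hf.of_norm.tsum_mul_tsum_eq_tsum_sum_antidiagonal hg.of_norm h5]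

theorem hasSum_expSeries_finset {N : ℕ} (y : Osc N → ℂ) (S : Finset (Osc N)) :
    Summable (fun d => ‖MvPowerSeries.coeff d (expSeries (∑ v ∈ S, Pi.single v (y v)))‖) ∧
    ∑' d, MvPowerSeries.coeff d (expSeries (∑ v ∈ S, Pi.single v (y v))) =
      Complex.exp (∑ v ∈ S, y v) := by
  classical
  induction S using Finset.induction_on with
  | empty =>
    have e : ∀ d : Osc N →₀ ℕ, d ≠ 0 →
        MvPowerSeries.coeff d (expSeries (0 : Osc N → ℂ)) = 0 := by
      intro d hd
      obtain ⟨v, hv⟩ := Finsupp.support_nonempty_iff.mpr hd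
      rw [expSeries_coeff]
      refine Finset.prod_eq_zero hv ?_
      have : d v ≠ 0 := by simpa using hv
      simp [this]
    have e0 : MvPowerSeries.coeff (0 : Osc N →₀ ℕ) (expSeries (0 : Osc N → ℂ)) = 1 := by
      rw [MvPowerSeries.coeff_zero_eq_constantCoeff_apply, expSeries_zero_coeff]
    simp only [Finset.sum_empty, Complex.exp_zero]
    constructor
    · exact summable_of_ne_finset_zero (s := {0}) fun d hd => by
        rw [e d (by simpa using hd), norm_zero]
    · rw [tsum_eq_single 0 e, e0]
  | insert v S hv ih =>
    rw [Finset.sum_insert hv, Finset.sum_insert hv, expSeries_add, Complex.exp_add]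
    obtain ⟨h1, h2⟩ := hasSum_expSeries_single v (y v)
    obtain ⟨h3, h4⟩ := ih
    obtain ⟨h5, h6⟩ := summable_antidiagonal _ _ h1.norm h3
    simp only [MvPowerSeries.coeff_mul]
    exact ⟨h5, by rw [h6, h2, h4]⟩

theorem expSeries_eq_of_subset {N : ℕ} (y : Osc N → ℂ) (S : Finset (Osc N)) (d : Osc N →₀ ℕ)
    (h : d.support ⊆ S) : MvPowerSeries.coeff d (expSeries (∑ v ∈ S, Pi.single v (y v))) =
      MvPowerSeries.coeff d (expSeries y) := by
  classical
  rw [expSeries_coeff, expSeries_coeff]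
  refine Finset.prod_congr rfl fun v hv => ?_
  dsimp only
  rw [Finset.sum_apply, Finset.sum_pi_single, if_pos (h hv)]

theorem expSeries_norm_le {N : ℕ} (y : Osc N → ℂ) (S : Finset (Osc N)) (d : Osc N →₀ ℕ) :
    ‖MvPowerSeries.coeff d (expSeries (∑ v ∈ S, Pi.single v (y v)))‖ ≤
      ‖MvPowerSeries.coeff d (expSeries y)‖ := by
  classical
  rw [expSeries_coeff, expSeries_coeff, Finsupp.prod, Finsupp.prod, norm_prod, norm_prod]
  refine Finset.prod_le_prod (fun _ _ => norm_nonneg _) fun v _ => ?_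
  rw [norm_div, norm_div, norm_pow, norm_pow, Finset.sum_apply, Finset.sum_pi_single]
  gcongr
  split_ifs <;> simp

theorem hasSum_expSeries {N : ℕ} (y : Osc N → ℂ) (hy : Summable fun v => ‖y v‖) :
    HasSum (fun d => MvPowerSeries.coeff d (expSeries y)) (Complex.exp (∑' v, y v)) := by
  classical
  have hs : Summable (fun d => ‖MvPowerSeries.coeff d (expSeries y)‖) := by
    refine summable_of_sum_le (c := Real.exp (∑' v, ‖y v‖)) (fun _ => norm_nonneg _) fun T => ?_
    let S : Finset (Osc N) := T.biUnion fun d => d.support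
    obtain ⟨h1, h2⟩ := hasSum_expSeries_finset (fun v => ((‖y v‖ : ℝ) : ℂ)) S
    have h3 : ∀ d, ((‖MvPowerSeries.coeff d (expSeries (∑ v ∈ S, Pi.single v (y v)))‖ : ℝ) : ℂ) =
        MvPowerSeries.coeff d (expSeries (∑ v ∈ S, Pi.single v ((‖y v‖ : ℝ) : ℂ))) := by
      intro d
      rw [expSeries_norm]
      congr 2
      funext w
      rw [Finset.sum_apply, Finset.sum_apply, Finset.sum_pi_single, Finset.sum_pi_single]
      split_ifs <;> simp
    have h4 : ∑' d, ‖MvPowerSeries.coeff d (expSeries (∑ v ∈ S, Pi.single v (y v)))‖ =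
        Real.exp (∑ v ∈ S, ‖y v‖) := by
      apply Complex.ofReal_injective
      rw [Complex.ofReal_tsum]
      simp only [h3, h2]
      push_cast
      rfl
    calc ∑ d ∈ T, ‖MvPowerSeries.coeff d (expSeries y)‖
        = ∑ d ∈ T, ‖MvPowerSeries.coeff d (expSeries (∑ v ∈ S, Pi.single v (y v)))‖ := by
          refine Finset.sum_congr rfl fun d hd => ?_
          rw [expSeries_eq_of_subset y S d (Finset.subset_biUnion_of_mem (fun d => d.support) hd)]
      _ ≤ ∑' d, ‖MvPowerSeries.coeff d (expSeries (∑ v ∈ S, Pi.single v (y v)))‖ :=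
          (hasSum_expSeries_finset y S).1.sum_le_tsum _ fun _ _ => norm_nonneg _
      _ = Real.exp (∑ v ∈ S, ‖y v‖) := h4
      _ ≤ Real.exp (∑' v, ‖y v‖) :=
          Real.exp_le_exp.mpr (hy.sum_le_tsum _ fun _ _ => norm_nonneg _)
  have ht : Filter.Tendsto (fun S : Finset (Osc N) =>
      ∑' d, MvPowerSeries.coeff d (expSeries (∑ v ∈ S, Pi.single v (y v)))) Filter.atTop
      (nhds (∑' d, MvPowerSeries.coeff d (expSeries y))) := by
    refine tendsto_tsum_of_dominated_convergence hs (fun d => ?_) ?_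
    · refine tendsto_const_nhds.congr' ?_
      filter_upwards [Filter.eventually_ge_atTop d.support] with S hS
      exact (expSeries_eq_of_subset y S d hS).symm
    · exact Filter.Eventually.of_forall fun S d => expSeries_norm_le y S d
  have ht2 : Filter.Tendsto (fun S : Finset (Osc N) =>
      ∑' d, MvPowerSeries.coeff d (expSeries (∑ v ∈ S, Pi.single v (y v)))) Filter.atTop
      (nhds (Complex.exp (∑' v, y v))) := by
    simp only [(hasSum_expSeries_finset y _).2]
    exact (Complex.continuous_exp.tendsto _).comp hy.of_norm.hasSum
  rw [← tendsto_nhds_unique ht ht2]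
  exact hs.of_norm.hasSum

theorem hasSum_of_eq {ι : Type*} {f g : ι → ℂ} {a b : ℂ} (h : HasSum f a) (hf : ∀ i, g i = f i)
    (e : b = a) : HasSum g b := by
  rw [e, funext hf]
  exact h

theorem translate_monomial_add {N : ℕ} (D : Osc N → ℂ) (c : Osc N →₀ ℕ) (v : Osc N) :
    translate D (MvPolynomial.monomial (c + Finsupp.single v 1) 1) =
      translate D (MvPolynomial.monomial c 1) * (MvPolynomial.X v + MvPolynomial.C (D v)) := by
  have : (MvPolynomial.monomial (c + Finsupp.single v 1) (1 : ℂ)) =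
      MvPolynomial.monomial c 1 * MvPolynomial.X v := by
    rw [MvPolynomial.X, MvPolynomial.monomial_mul, one_mul]
  rw [this, map_mul]
  simp [translate]

theorem pderiv_translate {N : ℕ} (D : Osc N → ℂ) (v : Osc N) (f : OscPoly N) :
    MvPolynomial.pderiv v (translate D f) = translate D (MvPolynomial.pderiv v f) := by
  classical
  induction f using MvPolynomial.induction_on with
  | C a => simp [translate]
  | add p q hp hq => simp [hp, hq]
  | mul_X p w hp =>
    have hX : translate D (MvPolynomial.X w) = MvPolynomial.X w + MvPolynomial.C (D w) := by
      simp [translate]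
    rw [map_mul, Derivation.leibniz, Derivation.leibniz, hp, hX]
    by_cases h : v = w
    · subst h
      simp [hX]
    · simp [MvPolynomial.pderiv_X_of_ne (Ne.symm h), hX]

theorem hasSum_translate_exp {N : ℕ} (A D : Osc N → ℂ) (h : Summable fun v => ‖A v * D v‖)
    (b : Osc N →₀ ℕ) :
    HasSum (fun c => MvPowerSeries.coeff c (expSeries A) *
        MvPolynomial.coeff b (translate D (MvPolynomial.monomial c 1)))
      (Complex.exp (∑' v, A v * D v) * MvPowerSeries.coeff b (expSeries A)) := by
  have key : ∀ (k : ℕ) (b : Osc N →₀ ℕ), b.degree = k →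
      HasSum (fun c => MvPowerSeries.coeff c (expSeries A) *
        MvPolynomial.coeff b (translate D (MvPolynomial.monomial c 1)))
      (Complex.exp (∑' v, A v * D v) * MvPowerSeries.coeff b (expSeries A)) := by
    intro k
    induction k with
    | zero =>
      intro b hb
      have : b = 0 := (Finsupp.degree_eq_zero_iff b).mp hb
      subst this
      have h1 := hasSum_expSeries (fun v => A v * D v) h
      rw [MvPowerSeries.coeff_zero_eq_constantCoeff_apply, expSeries_zero_coeff, mul_one]
      refine hasSum_of_eq h1 (fun c => ?_) rfl
      rw [expSeries_coeff, expSeries_coeff, ← MvPolynomial.constantCoeff_eq, translate,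
        MvPolynomial.aeval_monomial]
      simp only [map_one, one_mul, Finsupp.prod, map_prod, map_pow, map_add,
        MvPolynomial.constantCoeff_X, MvPolynomial.constantCoeff_C, zero_add]
      rw [← Finset.prod_mul_distrib]
      refine Finset.prod_congr rfl fun v _ => ?_
      rw [mul_pow]
      ring
    | succ k ih =>
      intro b hb
      obtain ⟨v, hv⟩ : ∃ v, b v ≠ 0 := by
        by_contra! hcon
        have : b = 0 := Finsupp.ext hcon
        simp [this] at hb
      have hle : Finsupp.single v 1 ≤ b := by
        rw [Finsupp.single_le_iff]
        omega
      obtain ⟨e, rfl⟩ := exists_add_of_le hle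
      rw [add_comm] at hb hv ⊢
      have he : e.degree = k := by
        rw [map_add, Finsupp.degree_single] at hb
        omega
      have hne : ((e v : ℂ) + 1) ≠ 0 := by exact_mod_cast Nat.succ_ne_zero (e v)
      have hE : ∀ c : Osc N →₀ ℕ, MvPowerSeries.coeff (c + Finsupp.single v 1) (expSeries A) *
          ((c v : ℂ) + 1) = A v * MvPowerSeries.coeff c (expSeries A) := by
        intro c
        have := congrArg (MvPowerSeries.coeff c) (expSeries_pderiv A v)
        rwa [MvPowerSeries.coeff_pderiv, MvPowerSeries.coeff_smul] at this
      have hT : ∀ c : Osc N →₀ ℕ, MvPolynomial.coeff (e + Finsupp.single v 1)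
          (translate D (MvPolynomial.monomial c 1)) * ((e v : ℂ) + 1) =
          (c v : ℂ) * MvPolynomial.coeff e
            (translate D (MvPolynomial.monomial (c - Finsupp.single v 1) 1)) := by
        intro c
        have h1 := congrArg (MvPolynomial.coeff e)
          (pderiv_translate D v (MvPolynomial.monomial c 1))
        rw [MvPolynomial.coeff_pderiv, MvPolynomial.pderiv_monomial, one_mul] at h1
        rw [h1]
        have : MvPolynomial.monomial (c - Finsupp.single v 1) ((c v : ℕ) : ℂ) =
            MvPolynomial.C ((c v : ℕ) : ℂ) * MvPolynomial.monomial (c - Finsupp.single v 1) 1 := by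
          rw [MvPolynomial.C_mul_monomial, mul_one]
        rw [this, map_mul]
        have hC : translate D (MvPolynomial.C ((c v : ℕ) : ℂ)) = MvPolynomial.C ((c v : ℕ) : ℂ) := by
          simp [translate]
        rw [hC, MvPolynomial.coeff_C_mul]
      have h1 := (ih e he).mul_left (A v / ((e v : ℂ) + 1))
      have hinj : Function.Injective (fun c : Osc N →₀ ℕ => c + Finsupp.single v 1) :=
        add_left_injective _
      rw [← hinj.hasSum_iff]
      · have e1 : Complex.exp (∑' v, A v * D v) *
            MvPowerSeries.coeff (e + Finsupp.single v 1) (expSeries A) =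
            A v / ((e v : ℂ) + 1) * (Complex.exp (∑' v, A v * D v) *
              MvPowerSeries.coeff e (expSeries A)) := by
          have := hE e
          rw [div_mul_eq_mul_div, eq_div_iff hne]
          linear_combination Complex.exp (∑' v, A v * D v) * this
        refine hasSum_of_eq h1 (fun c => ?_) e1
        have h2 := hT (c + Finsupp.single v 1)
        have h3 := hE c
        simp only [Finsupp.add_apply, Finsupp.single_eq_same, add_tsub_cancel_right] at h2
        push_cast at h2
        simp only [Function.comp_apply]
        rw [div_mul_eq_mul_div, eq_div_iff hne]
        linear_combination MvPowerSeries.coeff (c + Finsupp.single v 1) (expSeries A) * h2 +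
          MvPolynomial.coeff e (translate D (MvPolynomial.monomial c 1)) * h3
      · intro c hc
        have hcv : c v = 0 := by
          by_contra hcon
          refine hc ⟨c - Finsupp.single v 1, ?_⟩
          have : Finsupp.single v 1 ≤ c := by
            rw [Finsupp.single_le_iff]
            omega
          exact tsub_add_cancel_of_le this
        have h2 := hT c
        rw [hcv, Nat.cast_zero, zero_mul] at h2
        rw [(mul_eq_zero.mp h2).resolve_right hne, mul_zero]
  exact key _ b rfl

theorem hasSum_translate {N : ℕ} (A D : Osc N → ℂ) (h : Summable fun v => ‖A v * D v‖)
    (g : OscPoly N) (b : Osc N →₀ ℕ) :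
    HasSum (fun c => MvPowerSeries.coeff c (expSeries A * (g : OscSeries N)) *
        MvPolynomial.coeff b (translate D (MvPolynomial.monomial c 1)))
      (Complex.exp (∑' v, A v * D v) *
        MvPowerSeries.coeff b (expSeries A * (translate D g : OscSeries N))) := by
  classical
  induction g using MvPolynomial.induction_on generalizing b with
  | C a =>
    have h1 := (hasSum_translate_exp A D h b).mul_left a
    have hC : translate D (MvPolynomial.C a) = MvPolynomial.C a := by simp [translate]
    rw [hC]
    simp only [MvPolynomial.coe_C, mul_comm _ (MvPowerSeries.C a), MvPowerSeries.coeff_C_mul]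
    refine hasSum_of_eq h1 (fun c => ?_) ?_ <;> ring
  | add p q hp hq =>
    have h1 := (hp b).add (hq b)
    simp only [map_add, MvPolynomial.coe_add, mul_add]
    refine hasSum_of_eq h1 (fun c => ?_) ?_ <;> ring
  | mul_X p v hp =>
    have hX : translate D (MvPolynomial.X v) = MvPolynomial.X v + MvPolynomial.C (D v) := by
      simp [translate]
    have hinj : Function.Injective (fun c : Osc N →₀ ℕ => c + Finsupp.single v 1) :=
      add_left_injective _
    have hz : ∀ (φ : OscSeries N) (c : Osc N →₀ ℕ), c v = 0 →
        MvPowerSeries.coeff c (φ * MvPowerSeries.X v) = 0 := by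
      intro φ c hc
      rw [MvPowerSeries.X, MvPowerSeries.coeff_mul_monomial, if_neg]
      rw [Finsupp.single_le_iff]
      omega
    have hs : ∀ (φ : OscSeries N) (c : Osc N →₀ ℕ),
        MvPowerSeries.coeff (c + Finsupp.single v 1) (φ * MvPowerSeries.X v) =
        MvPowerSeries.coeff c φ := by
      intro φ c
      rw [MvPowerSeries.X, MvPowerSeries.coeff_add_mul_monomial, mul_one]
    have hp' : ∀ b, HasSum (fun c => MvPowerSeries.coeff c (expSeries A * (p : OscSeries N)) *
        MvPolynomial.coeff b (translate D (MvPolynomial.monomial c 1) * MvPolynomial.X v))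
      (Complex.exp (∑' v, A v * D v) * MvPowerSeries.coeff b
        (expSeries A * (translate D p : OscSeries N) * MvPowerSeries.X v)) := by
      intro b
      by_cases hb : b v = 0
      · rw [hz _ _ hb, mul_zero]
        refine hasSum_of_eq hasSum_zero (fun c => ?_) rfl
        rw [← MvPolynomial.coeff_coe, MvPolynomial.coe_mul, MvPolynomial.coe_X, hz _ _ hb, mul_zero]
      · have : Finsupp.single v 1 ≤ b := by
          rw [Finsupp.single_le_iff]
          omega
        obtain ⟨e, rfl⟩ := exists_add_of_le this
        rw [add_comm, hs]
        refine hasSum_of_eq (hp e) (fun c => ?_) rfl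
        rw [MvPolynomial.coeff_mul_X]
    rw [← hinj.hasSum_iff]
    · rw [map_mul (translate D), hX]
      simp only [MvPolynomial.coe_mul, MvPolynomial.coe_add, MvPolynomial.coe_X,
        MvPolynomial.coe_C]
      have h1 := (hp' b).add ((hp b).mul_left (D v))
      simp only [Function.comp_def, ← mul_assoc, hs, translate_monomial_add, mul_add,
        MvPolynomial.coeff_add, map_add]
      refine hasSum_of_eq h1 (fun c => ?_) ?_
      · rw [mul_comm _ (MvPolynomial.C (D v)), MvPolynomial.coeff_C_mul]
        ring
      · rw [mul_comm _ (MvPowerSeries.C (D v)), MvPowerSeries.coeff_C_mul]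
        ring
    · intro c hc
      have hcv : c v = 0 := by
        by_contra hcon
        refine hc ⟨c - Finsupp.single v 1, ?_⟩
        have : Finsupp.single v 1 ≤ c := by
          rw [Finsupp.single_le_iff]
          omega
        exact tsub_add_cancel_of_le this
      rw [MvPolynomial.coe_mul, MvPolynomial.coe_X, ← mul_assoc, hz _ _ hcv, zero_mul]

theorem translate_translate {N : ℕ} (D E : Osc N → ℂ) (f : OscPoly N) :
    translate D (translate E f) = translate (D + E) f := by
  have : (translate D).comp (translate E) = translate (D + E) := by
    ext1 v
    simp [translate, add_assoc]
  exact DFunLike.congr_fun this f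

theorem normalExp_apply {N : ℕ} (A D : Osc N → ℂ) (f : OscPoly N) :
    normalExp A D f = expSeries A * (translate D f : OscSeries N) := rfl

/-- The composition of two normally ordered exponentials. -/
theorem hasSum_normalExp {N : ℕ} (A D A' D' : Osc N → ℂ) (h : Summable fun v => A' v * D v)
    (f : OscPoly N) (b : Osc N →₀ ℕ) :
    HasSum (fun c => MvPowerSeries.coeff c (normalExp A' D' f) *
        MvPowerSeries.coeff b (normalExp A D (MvPolynomial.monomial c 1)))
      (Complex.exp (∑' v, A' v * D v) *
        MvPowerSeries.coeff b (normalExp (A + A') (D + D') f)) := by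
  classical
  simp only [normalExp_apply, expSeries_add, ← translate_translate D D', mul_assoc]
  simp only [MvPowerSeries.coeff_mul b, Finset.mul_sum, MvPolynomial.coeff_coe]
  refine hasSum_sum fun p _ => ?_
  have h1 := (hasSum_translate A' D h.norm (translate D' f) p.2).mul_left
    (MvPowerSeries.coeff p.1 (expSeries A))
  refine hasSum_of_eq h1 (fun c => ?_) ?_ <;> ring

theorem one_sub_pow_ne {Q : ℂ} (hQ : ‖Q‖ < 1) (m : ℕ+) : 1 - Q ^ (m : ℕ) ≠ 0 := by
  intro h
  have h1 : ‖Q ^ (m : ℕ)‖ < 1 := by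
    rw [norm_pow]
    exact pow_lt_one₀ (norm_nonneg _) hQ m.ne_zero
  rw [← sub_eq_zero.mp h, norm_one] at h1
  exact lt_irrefl _ h1

theorem qPoch_eq_exp {a Q : ℂ} (ha : ‖a‖ < 1) (hQ : ‖Q‖ < 1) :
    ∃ S, HasSum (fun m : ℕ+ => a ^ (m : ℕ) / (m * (1 - Q ^ (m : ℕ)))) S ∧
      Complex.exp S = (qPoch a Q)⁻¹ := by
  have hterm : ∀ k : ℕ, ‖a * Q ^ k‖ < 1 := by
    intro k
    rw [norm_mul, norm_pow]
    exact mul_lt_one_of_nonneg_of_lt_one_left (norm_nonneg _) ha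
      (pow_le_one₀ (norm_nonneg _) hQ.le)
  have hlog : ∀ k : ℕ, HasSum (fun m : ℕ+ => (a * Q ^ k) ^ (m : ℕ) / (m : ℂ))
      (-Complex.log (1 - a * Q ^ k)) := by
    intro k
    have := Complex.hasSum_taylorSeries_neg_log' (hterm k)
    rw [← Equiv.pnatEquivNat.symm.hasSum_iff]
    refine hasSum_of_eq this (fun n => ?_) rfl
    simp
  have hgeo : ∀ m : ℕ+, HasSum (fun k : ℕ => (a * Q ^ k) ^ (m : ℕ) / (m : ℂ))
      (a ^ (m : ℕ) / (m * (1 - Q ^ (m : ℕ)))) := by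
    intro m
    have h1 : ‖Q ^ (m : ℕ)‖ < 1 := by
      rw [norm_pow]
      exact pow_lt_one₀ (norm_nonneg _) hQ m.ne_zero
    refine hasSum_of_eq ((hasSum_geometric_of_norm_lt_one h1).mul_left (a ^ (m : ℕ) / (m : ℂ)))
      (fun k => ?_) ?_
    · rw [mul_pow, ← pow_mul, ← pow_mul, mul_comm k]
      ring
    · rw [← div_div, div_eq_mul_inv _ (1 - _)]
  have hsum : Summable fun p : ℕ × ℕ+ => (a * Q ^ p.1) ^ (p.2 : ℕ) / (p.2 : ℂ) := by
    have hb : Summable fun p : ℕ × ℕ+ => ‖Q‖ ^ p.1 * ‖a‖ ^ (p.2 : ℕ) := by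
      have s1 : Summable fun k : ℕ => ‖Q‖ ^ k := summable_geometric_of_lt_one (norm_nonneg _) hQ
      have s2 : Summable fun m : ℕ+ => ‖a‖ ^ (m : ℕ) :=
        (summable_geometric_of_lt_one (norm_nonneg _) ha).comp_injective PNat.coe_injective
      exact Summable.mul_of_nonneg (f := fun k : ℕ => ‖Q‖ ^ k) (g := fun m : ℕ+ => ‖a‖ ^ (m : ℕ))
        s1 s2 (fun k => pow_nonneg (norm_nonneg _) k) (fun m => pow_nonneg (norm_nonneg _) _)
    refine Summable.of_norm_bounded hb fun p => ?_
    have hm : (1 : ℝ) ≤ (p.2 : ℕ) := by exact_mod_cast p.2.pos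
    rw [norm_div, norm_pow, norm_mul, norm_pow, mul_pow, Complex.norm_natCast, mul_comm]
    refine (div_le_self (by positivity) hm).trans ?_
    gcongr
    rw [← pow_mul]
    exact pow_le_pow_of_le_one (norm_nonneg _) hQ.le (Nat.le_mul_of_pos_right _ p.2.pos)
  have h1 := hsum.hasSum.prod_fiberwise hlog
  have h2 : HasSum (fun m : ℕ+ => a ^ (m : ℕ) / (m * (1 - Q ^ (m : ℕ))))
      (∑' p : ℕ × ℕ+, (a * Q ^ p.1) ^ (p.2 : ℕ) / (p.2 : ℂ)) := by
    have h3 := ((Equiv.prodComm ℕ+ ℕ).hasSum_iff (f := fun p : ℕ × ℕ+ =>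
      (a * Q ^ p.1) ^ (p.2 : ℕ) / (p.2 : ℂ))).mpr hsum.hasSum
    exact h3.prod_fiberwise hgeo
  refine ⟨_, h2, ?_⟩
  have h4 : ∀ k : ℕ, 1 - a * Q ^ k ≠ 0 := by
    intro k h
    have := hterm k
    rw [← sub_eq_zero.mp h, norm_one] at this
    exact lt_irrefl _ this
  have h5 := Complex.hasProd_of_hasSum_log h4 (by simpa using h1.neg)
  rw [qPoch, h5.tprod_eq, Complex.exp_neg, inv_inv]

theorem qnum_mul {x : ℝ} (a : ℂ) (m : ℤ) :
    qnum x (a * m) = (((x : ℂ) ^ a) ^ m - ((x : ℂ) ^ a) ^ (-m)) / ((x : ℂ) - (x : ℂ)⁻¹) := by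
  rw [qnum, Complex.cpow_mul_int, ← mul_neg, ← Int.cast_neg, Complex.cpow_mul_int]

theorem x_sub_ne {x : ℝ} (h0 : 0 < x) (h1 : x < 1) : (x : ℂ) - (x : ℂ)⁻¹ ≠ 0 := by
  have : x - x⁻¹ < 0 := by
    have := (one_lt_inv₀ h0).mpr h1
    linarith
  exact_mod_cast this.ne

theorem norm_cpow_lt_one {x : ℝ} (h0 : 0 < x) (h1 : x < 1) {a : ℂ} (ha : 0 < a.re) :
    ‖(x : ℂ) ^ a‖ < 1 := by
  rw [Complex.norm_cpow_eq_rpow_re_of_pos h0]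
  exact Real.rpow_lt_one h0.le h1 ha

/-- `pairFun` is the continuation of the exponential of its defining series. -/
theorem pairFun_eq_exp {x : ℝ} (h0 : 0 < x) (h1 : x < 1) {r : ℂ} (hr : r.re ≠ 0) :
    ∃ δ > 0, ∀ y : ℂ, ‖y‖ < δ →
      ∃ S, HasSum (fun m : ℕ+ => 1 / (m : ℂ) *
        (qnum x ((r - 1) * (m : ℤ)) / qnum x (r * (m : ℤ))) * y ^ (m : ℕ)) S ∧
        Complex.exp S = pairFun x r y := by
  have hx : (x : ℂ) ≠ 0 := Complex.ofReal_ne_zero.mpr h0.ne'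
  have hx2 := x_sub_ne h0 h1
  have hR : (x : ℂ) ^ r ≠ 0 := by simp [Complex.cpow_eq_zero_iff, hx]
  have e1 : (x : ℂ) ^ (r - 1) = (x : ℂ) ^ r / x := by rw [Complex.cpow_sub _ _ hx, Complex.cpow_one]
  have main : ∀ A B Q : ℂ, ‖Q‖ < 1 →
      (∀ m : ℕ+, qnum x ((r - 1) * (m : ℤ)) / qnum x (r * (m : ℤ)) =
        (A ^ (m : ℕ) - B ^ (m : ℕ)) / (1 - Q ^ (m : ℕ))) →
      ∃ δ > 0, ∀ y : ℂ, ‖y‖ < δ →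
      ∃ S, HasSum (fun m : ℕ+ => 1 / (m : ℂ) *
        (qnum x ((r - 1) * (m : ℤ)) / qnum x (r * (m : ℤ))) * y ^ (m : ℕ)) S ∧
        Complex.exp S = qPoch (B * y) Q / qPoch (A * y) Q := by
    intro A B Q hQ hq
    refine ⟨1 / (‖A‖ + ‖B‖ + 1), by positivity, fun y hy => ?_⟩
    have hy' : (‖A‖ + ‖B‖ + 1) * ‖y‖ < 1 := by
      rw [lt_div_iff₀ (by positivity)] at hy
      linarith
    have hA : ‖A * y‖ < 1 := by
      rw [norm_mul]
      nlinarith [norm_nonneg A, norm_nonneg B, norm_nonneg y, mul_nonneg (norm_nonneg B) (norm_nonneg y)]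
    have hB : ‖B * y‖ < 1 := by
      rw [norm_mul]
      nlinarith [norm_nonneg A, norm_nonneg B, norm_nonneg y, mul_nonneg (norm_nonneg A) (norm_nonneg y)]
    obtain ⟨S, hS, eS⟩ := qPoch_eq_exp hA hQ
    obtain ⟨T, hT, eT⟩ := qPoch_eq_exp hB hQ
    refine ⟨S - T, hasSum_of_eq (hS.sub hT) (fun m => ?_) rfl, ?_⟩
    · have hm : (m : ℂ) ≠ 0 := by exact_mod_cast m.ne_zero
      have := one_sub_pow_ne hQ m
      rw [hq, mul_pow, mul_pow]
      field_simp
    · rw [Complex.exp_sub, eS, eT]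
      simp [div_eq_mul_inv, mul_comm]
  rcases lt_or_gt_of_ne hr with hneg | hpos
  · have e2 : (x : ℂ) ^ (-2 * r) = (((x : ℂ) ^ r) ^ 2)⁻¹ := by
      rw [neg_mul, Complex.cpow_neg, mul_comm, ← Complex.cpow_mul_nat]
      norm_num
    have e3 : (x : ℂ) ^ (1 - 2 * r) = x * (((x : ℂ) ^ r) ^ 2)⁻¹ := by
      rw [sub_eq_add_neg, Complex.cpow_add _ _ hx, Complex.cpow_one, ← neg_mul, e2]
    have hQ : ‖(((x : ℂ) ^ r) ^ 2)⁻¹‖ < 1 := by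
      rw [← e2]
      exact norm_cpow_lt_one h0 h1 (by simp; linarith)
    simp only [pairFun, if_neg (not_lt.mpr hneg.le), e2, e3]
    refine main _ _ _ hQ fun m => ?_
    have hne := one_sub_pow_ne hQ m
    rw [qnum_mul, qnum_mul, e1]
    simp only [zpow_neg, zpow_natCast, div_pow, mul_pow, inv_pow] at hne ⊢
    have h2 : ((x : ℂ) ^ r) ^ (m : ℕ) - (((x : ℂ) ^ r) ^ (m : ℕ))⁻¹ ≠ 0 := by
      intro h
      apply hne
      rw [pow_right_comm]
      have h3 : ((x : ℂ) ^ r) ^ (m : ℕ) ≠ 0 := pow_ne_zero _ hR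
      field_simp at h ⊢
      linear_combination h
    rw [pow_right_comm] at hne ⊢
    rw [div_div_div_cancel_right₀ hx2, div_eq_div_iff h2 hne]
    have h3 : ((x : ℂ) ^ r) ^ (m : ℕ) ≠ 0 := pow_ne_zero _ hR
    have h4 : (x : ℂ) ^ (m : ℕ) ≠ 0 := pow_ne_zero _ hx
    field_simp
  · have e2 : (x : ℂ) ^ (2 * r) = ((x : ℂ) ^ r) ^ 2 := by
      rw [mul_comm, ← Complex.cpow_mul_nat]
      norm_num
    have e3 : (x : ℂ) ^ (2 * r - 1) = ((x : ℂ) ^ r) ^ 2 * (x : ℂ)⁻¹ := by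
      rw [sub_eq_add_neg, Complex.cpow_add _ _ hx, Complex.cpow_neg_one, e2]
    have hQ : ‖((x : ℂ) ^ r) ^ 2‖ < 1 := by
      rw [← e2]
      exact norm_cpow_lt_one h0 h1 (by simp; linarith)
    simp only [pairFun, if_pos hpos, e2, e3]
    refine main _ _ _ hQ fun m => ?_
    have hne := one_sub_pow_ne hQ m
    rw [qnum_mul, qnum_mul, e1]
    simp only [zpow_neg, zpow_natCast, div_pow, mul_pow, inv_pow] at hne ⊢
    have h3 : ((x : ℂ) ^ r) ^ (m : ℕ) ≠ 0 := pow_ne_zero _ hR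
    have h2 : ((x : ℂ) ^ r) ^ (m : ℕ) - (((x : ℂ) ^ r) ^ (m : ℕ))⁻¹ ≠ 0 := by
      intro h
      apply hne
      rw [pow_right_comm]
      field_simp at h ⊢
      linear_combination -h
    rw [pow_right_comm] at hne ⊢
    rw [div_div_div_cancel_right₀ hx2, div_eq_div_iff h2 hne]
    have h4 : (x : ℂ) ^ (m : ℕ) ≠ 0 := pow_ne_zero _ hx
    field_simp
    ring

/-- The base of the coefficient of `β_m^j` in `B_m^j`. -/
def bBase {N : ℕ} (x : ℝ) (s : ℂ) (j : Fin N) : ℂ := (x : ℂ) ^ (-(2 * s / N) * ((j : ℂ) + 1))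

/-- The base of the coefficient of `-β_m^{j+1}` in `B_m^j`. -/
def bBase' {N : ℕ} (x : ℝ) (s : ℂ) (j : Fin N) : ℂ :=
  if (j : ℕ) + 1 < N then (x : ℂ) ^ (-(2 * s / N) * ((j : ℂ) + 1)) else 1

theorem val_add_one {N : ℕ} [NeZero N] (j : Fin N) :
    ((j + 1 : Fin N) : ℕ) = if (j : ℕ) + 1 < N then (j : ℕ) + 1 else 0 := by
  have hj := j.isLt
  rw [Fin.val_add, Fin.val_one', Nat.add_mod_mod]
  split_ifs with h
  · exact Nat.mod_eq_of_lt h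
  · have : (j : ℕ) + 1 = N := by omega
    rw [this, Nat.mod_self]

theorem bBase_last {N : ℕ} [NeZero N] (x : ℝ) (s : ℂ) (j : Fin N) (h : ¬ (j : ℕ) + 1 < N) :
    bBase x s j = (x : ℂ) ^ (-2 * s) := by
  have hN : (N : ℂ) ≠ 0 := by exact_mod_cast NeZero.ne N
  have : ((j : ℂ) + 1) = N := by
    have hj := j.isLt
    have : (j : ℕ) + 1 = N := by omega
    exact_mod_cast this
  rw [bBase, this]
  congr 1
  field_simp

theorem bCoeff_eq {N : ℕ} [NeZero N] (x : ℝ) (s : ℂ) (m : ℤ) (j i : Fin N) :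
    bCoeff x s m j i = (if i = j then bBase x s j ^ m else 0) -
      (if i = j + 1 then bBase' x s j ^ m else 0) := by
  unfold bCoeff bBase'
  by_cases h1 : (j : ℕ) + 1 < N
  · rw [if_pos h1, if_pos h1, Complex.cpow_mul_int, bBase]
    split_ifs <;> ring
  · rw [if_neg h1, if_neg h1, Complex.cpow_mul_int, bBase_last x s j h1, one_zpow]

theorem bBase_succ {N : ℕ} [NeZero N] {x : ℝ} (hx : 0 < x) (s : ℂ) (j : Fin N) :
    bBase x s (j + 1) = bBase' x s j * (x : ℂ) ^ (-(2 * s / N)) := by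
  have h0 : (x : ℂ) ≠ 0 := Complex.ofReal_ne_zero.mpr hx.ne'
  rw [bBase, bBase', val_add_one]
  split_ifs with h
  · rw [← Complex.cpow_add _ _ h0]
    congr 1
    push_cast
    ring
  · simp

theorem bBase_ne {N : ℕ} [NeZero N] {x : ℝ} (hx : 0 < x) (s : ℂ) (j : Fin N) :
    bBase x s j ≠ 0 ∧ bBase' x s j ≠ 0 := by
  have h0 : (x : ℂ) ≠ 0 := Complex.ofReal_ne_zero.mpr hx.ne'
  constructor
  · simp [bBase, Complex.cpow_eq_zero_iff, h0]
  · unfold bBase'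
    split_ifs <;> simp [Complex.cpow_eq_zero_iff, h0]

theorem betaComm_lt {N : ℕ} (x : ℝ) (r s : ℂ) (m : ℤ) {i j : Fin N} (h : (i : ℕ) < j) :
    betaComm x r s m i j = -(m * (qnum x ((r - 1) * m) / qnum x (r * m)) *
      (qnum x m / qnum x (s * m)) * (((x : ℂ) ^ s) ^ m)⁻¹) := by
  have h1 : i ≠ j := fun e => by subst e; exact lt_irrefl _ h
  have h2 : Int.sign ((i : ℤ) - (j : ℤ)) = -1 := Int.sign_eq_neg_one_of_neg (by omega)
  rw [betaComm, if_neg h1, h2, ← zpow_neg, ← Complex.cpow_mul_int]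
  simp

theorem betaComm_gt {N : ℕ} (x : ℝ) (r s : ℂ) (m : ℤ) {i j : Fin N} (h : (j : ℕ) < i) :
    betaComm x r s m i j = -(m * (qnum x ((r - 1) * m) / qnum x (r * m)) *
      (qnum x m / qnum x (s * m)) * ((x : ℂ) ^ s) ^ m) := by
  have h1 : i ≠ j := fun e => by subst e; exact lt_irrefl _ h
  have h2 : Int.sign ((i : ℤ) - (j : ℤ)) = 1 := Int.sign_eq_one_of_pos (by omega)
  rw [betaComm, if_neg h1, h2, ← Complex.cpow_mul_int]
  simp

theorem betaComm_self {N : ℕ} (x : ℝ) (r s : ℂ) (m : ℤ) (i : Fin N) :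
    betaComm x r s m i i = m * (qnum x ((r - 1) * m) / qnum x (r * m)) *
      (qnum x ((s - 1) * m) / qnum x (s * m)) := if_pos rfl

/-- `[B_m^j, β_{-m}^b]`. -/
theorem sum_bCoeff_betaComm {N : ℕ} [NeZero N] (hN : 2 ≤ N) {x : ℝ} (hx0 : 0 < x) (hx1 : x < 1)
    (r s : ℂ) (m : ℤ) (hs : qnum x (s * m) ≠ 0) (j b : Fin N) :
    ∑ a, bCoeff x s m j a * betaComm x r s m a b =
      m * (qnum x ((r - 1) * m) / qnum x (r * m)) *
      ((if b = j then (x : ℂ) ^ m * bBase x s j ^ m else 0) -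
        (if b = j + 1 then ((x : ℂ) ^ m)⁻¹ * bBase' x s j ^ m else 0)) := by
  have hx : (x : ℂ) ≠ 0 := Complex.ofReal_ne_zero.mpr hx0.ne'
  have hS : ((x : ℂ) ^ s) ^ m ≠ 0 := zpow_ne_zero _ (by simp [Complex.cpow_eq_zero_iff, hx])
  have hX : (x : ℂ) ^ m ≠ 0 := zpow_ne_zero _ hx
  have h1 : ∑ a, bCoeff x s m j a * betaComm x r s m a b =
      bBase x s j ^ m * betaComm x r s m j b - bBase' x s j ^ m * betaComm x r s m (j + 1) b := by
    simp [bCoeff_eq, sub_mul, Finset.sum_sub_distrib, ite_mul]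
  have hq : qnum x (m : ℂ) = ((x : ℂ) ^ m - ((x : ℂ) ^ m)⁻¹) / ((x : ℂ) - (x : ℂ)⁻¹) := by
    have := qnum_mul (x := x) 1 m
    rwa [one_mul, Complex.cpow_one, zpow_neg] at this
  have e1 : (x : ℂ) ^ (s - 1) = (x : ℂ) ^ s / x := by rw [Complex.cpow_sub _ _ hx, Complex.cpow_one]
  have hd := x_sub_ne hx0 hx1
  have k1 : qnum x ((s - 1) * m) / qnum x (s * m) +
      qnum x m / qnum x (s * m) * ((x : ℂ) ^ s) ^ m = (x : ℂ) ^ m := by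
    rw [div_mul_eq_mul_div, ← add_div, div_eq_iff hs, qnum_mul, qnum_mul, hq, e1]
    simp only [zpow_neg, div_zpow]
    field_simp
    ring
  have k2 : qnum x ((s - 1) * m) / qnum x (s * m) +
      qnum x m / qnum x (s * m) * (((x : ℂ) ^ s) ^ m)⁻¹ = ((x : ℂ) ^ m)⁻¹ := by
    rw [div_mul_eq_mul_div, ← add_div, div_eq_iff hs, qnum_mul, qnum_mul, hq, e1]
    simp only [zpow_neg, div_zpow]
    field_simp
    ring
  have hv := val_add_one j
  have hj := j.isLt
  have hb := b.isLt
  have hne : j + 1 ≠ j := by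
    intro e
    rw [e] at hv
    split_ifs at hv <;> omega
  rw [h1]
  by_cases hlast : (j : ℕ) + 1 < N
  · rw [if_pos hlast] at hv
    have hB : bBase' x s j = bBase x s j := by rw [bBase', if_pos hlast, bBase]
    rw [hB]
    by_cases b1 : b = j
    · subst b1
      rw [if_pos rfl, if_neg (Ne.symm hne), betaComm_self, betaComm_gt x r s m (i := b + 1) (by omega)]
      linear_combination (m * (qnum x ((r - 1) * m) / qnum x (r * m)) * bBase x s b ^ m) * k1
    · by_cases b2 : b = j + 1
      · subst b2
        rw [if_pos rfl, if_neg hne, betaComm_self, betaComm_lt x r s m (i := j) (by omega)]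
        linear_combination -(m * (qnum x ((r - 1) * m) / qnum x (r * m)) * bBase x s j ^ m) * k2
      · rw [if_neg b1, if_neg b2]
        have b1' : (b : ℕ) ≠ j := fun e => b1 (Fin.ext e)
        have b2' : (b : ℕ) ≠ (j + 1 : Fin N) := fun e => b2 (Fin.ext e)
        rcases lt_or_gt_of_ne b1' with h | h
        · rw [betaComm_gt x r s m h, betaComm_gt x r s m (i := j + 1) (by omega)]
          ring
        · rw [betaComm_lt x r s m h, betaComm_lt x r s m (i := j + 1) (by omega)]
          ring
  · rw [if_neg hlast] at hv
    have hB : bBase' x s j = 1 := by rw [bBase', if_neg hlast]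
    have hB2 : bBase x s j ^ m = ((((x : ℂ) ^ s) ^ m) ^ 2)⁻¹ := by
      rw [bBase_last x s j hlast, ← Complex.cpow_mul_int, ← Complex.cpow_mul_int,
        ← Complex.cpow_mul_nat, ← Complex.cpow_neg]
      congr 1
      push_cast
      ring
    rw [hB, hB2, one_zpow]
    by_cases b1 : b = j
    · subst b1
      rw [if_pos rfl, if_neg (Ne.symm hne), betaComm_self, betaComm_lt x r s m (i := b + 1) (by omega)]
      have : (((x : ℂ) ^ s) ^ m)⁻¹ = ((((x : ℂ) ^ s) ^ m) ^ 2)⁻¹ * ((x : ℂ) ^ s) ^ m := by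
        field_simp
      rw [this]
      linear_combination (m * (qnum x ((r - 1) * m) / qnum x (r * m)) *
        ((((x : ℂ) ^ s) ^ m) ^ 2)⁻¹) * k1
    · by_cases b2 : b = j + 1
      · subst b2
        rw [if_pos rfl, if_neg hne, betaComm_self, betaComm_gt x r s m (i := j) (by omega)]
        have : ((((x : ℂ) ^ s) ^ m) ^ 2)⁻¹ * ((x : ℂ) ^ s) ^ m = (((x : ℂ) ^ s) ^ m)⁻¹ := by
          field_simp
        linear_combination -(m * (qnum x ((r - 1) * m) / qnum x (r * m))) * k2 -
          (m * (qnum x ((r - 1) * m) / qnum x (r * m))) * (qnum x m / qnum x (s * m)) * this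
      · rw [if_neg b1, if_neg b2]
        have b1' : (b : ℕ) ≠ j := fun e => b1 (Fin.ext e)
        have b2' : (b : ℕ) ≠ (j + 1 : Fin N) := fun e => b2 (Fin.ext e)
        rw [betaComm_gt x r s m (by omega : (b : ℕ) < j),
          betaComm_lt x r s m (i := j + 1) (by omega)]
        have : ((((x : ℂ) ^ s) ^ m) ^ 2)⁻¹ * ((x : ℂ) ^ s) ^ m = (((x : ℂ) ^ s) ^ m)⁻¹ := by
          field_simp
        linear_combination -(m * (qnum x ((r - 1) * m) / qnum x (r * m))) *
          (qnum x m / qnum x (s * m)) * this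

theorem qnum_ne_zero {x : ℝ} (h0 : 0 < x) (h1 : x < 1) {s : ℂ} (hs : 0 < s.re) (m : ℕ+) :
    qnum x (s * (m : ℤ)) ≠ 0 := by
  have hx : (x : ℂ) ≠ 0 := Complex.ofReal_ne_zero.mpr h0.ne'
  have hQ := norm_cpow_lt_one h0 h1 (a := 2 * s) (by simp; linarith)
  have h2 := one_sub_pow_ne hQ m
  have hS : ((x : ℂ) ^ s) ^ (m : ℕ) ≠ 0 := pow_ne_zero _ (by simp [Complex.cpow_eq_zero_iff, hx])
  have e2 : (x : ℂ) ^ (2 * s) = ((x : ℂ) ^ s) ^ 2 := by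
    rw [mul_comm, ← Complex.cpow_mul_nat]
    norm_num
  rw [qnum_mul]
  refine div_ne_zero ?_ (x_sub_ne h0 h1)
  rw [zpow_neg, zpow_natCast]
  intro h
  apply h2
  rw [e2, pow_right_comm]
  field_simp at h
  linear_combination -h

/-- The contraction is the continuation of the exponential of the commutator of the annihilation
part of `F_i(z₁)` and the creation part of `F_j(z₂)`. -/
theorem contraction_eq_exp {N : ℕ} [NeZero N] (hN : 2 ≤ N) {x : ℝ} (hx0 : 0 < x) (hx1 : x < 1)
    {r s : ℂ} (hr : r.re ≠ 0) (hs : 0 < s.re) :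
    ∃ δ > 0, ∀ (i j : Fin N) (u₁ u₂ : ℂ), ‖(x : ℂ) ^ (2 * (u₂ - u₁))‖ < δ →
      Summable (fun v => creation x s j u₂ v * annihilation x r s i u₁ v) ∧
      Complex.exp (∑' v, creation x s j u₂ v * annihilation x r s i u₁ v) =
        contraction x r s i j ((x : ℂ) ^ (2 * (u₂ - u₁))) := by
  have hx : (x : ℂ) ≠ 0 := Complex.ofReal_ne_zero.mpr hx0.ne'
  obtain ⟨δ, hδ, hP⟩ := pairFun_eq_exp hx0 hx1 hr
  let K : Fin N → Fin N → ℝ := fun i j =>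
    ‖(x : ℂ) * bBase x s i / bBase x s j‖ + ‖(x : ℂ) * bBase x s i / bBase' x s j‖ +
    ‖(x : ℂ)⁻¹ * bBase' x s i / bBase x s j‖ + ‖(x : ℂ)⁻¹ * bBase' x s i / bBase' x s j‖
  let M : ℝ := 1 + ∑ i, ∑ j, K i j
  have hK0 : ∀ i j, 0 ≤ K i j := fun i j => by positivity
  have hM : 0 < M := by
    have : 0 ≤ ∑ i, ∑ j, K i j := Finset.sum_nonneg fun i _ => Finset.sum_nonneg fun j _ => hK0 i j
    linarith
  have hKM : ∀ i j, K i j ≤ M := by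
    intro i j
    have h1 : K i j ≤ ∑ j, K i j :=
      Finset.single_le_sum (f := fun j => K i j) (fun j _ => hK0 i j) (Finset.mem_univ j)
    have h2 : ∑ j, K i j ≤ ∑ i, ∑ j, K i j :=
      Finset.single_le_sum (f := fun i => ∑ j, K i j)
        (fun i _ => Finset.sum_nonneg fun j _ => hK0 i j) (Finset.mem_univ i)
    linarith
  refine ⟨δ / M, by positivity, fun i j u₁ u₂ hw => ?_⟩
  set w := (x : ℂ) ^ (2 * (u₂ - u₁)) with hwdef
  obtain ⟨ci0, di0⟩ := bBase_ne hx0 s i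
  obtain ⟨cj0, dj0⟩ := bBase_ne hx0 s j
  have hsmall : ∀ A : ℂ, ‖A‖ ≤ K i j → ‖A * w‖ < δ := by
    intro A hA
    rw [lt_div_iff₀ hM] at hw
    rw [norm_mul]
    have := mul_le_mul_of_nonneg_right (hA.trans (hKM i j)) (norm_nonneg w)
    linarith
  let q : ℂ → ℕ+ → ℂ := fun y m => 1 / (m : ℂ) *
    (qnum x ((r - 1) * (m : ℤ)) / qnum x (r * (m : ℤ))) * y ^ (m : ℕ)
  have hfour : ∀ (A : ℂ) (β : Fin N) (P : Prop) [Decidable P], ‖A‖ ≤ K i j →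
      ∃ S, HasSum (fun v : Osc N => if v.1 = β ∧ P then q (A * w) v.2 else 0) S ∧
        Complex.exp S = if P then pairFun x r (A * w) else 1 := by
    intro A β P _ hA
    by_cases hPc : P
    · obtain ⟨S, hS, eS⟩ := hP _ (hsmall A hA)
      refine ⟨S, ?_, by rw [if_pos hPc, eS]⟩
      have hinj : Function.Injective (fun m : ℕ+ => ((β, m) : Osc N)) :=
        fun a b h => (Prod.ext_iff.mp h).2
      rw [← hinj.hasSum_iff]
      · refine hasSum_of_eq hS (fun m => ?_) rfl
        simp [hPc, q]
      · rintro ⟨b, m⟩ hb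
        rw [if_neg]
        rintro ⟨h, -⟩
        exact hb ⟨m, by simp only at h; rw [h]⟩
    · refine ⟨0, ?_, by rw [if_neg hPc, Complex.exp_zero]⟩
      refine hasSum_of_eq hasSum_zero (fun v => ?_) rfl
      simp [hPc]
  obtain ⟨S1, h1, e1⟩ := hfour ((x : ℂ) * bBase x s i / bBase x s j) j (i = j) (by
    simp only [K]; linarith [norm_nonneg ((x : ℂ) * bBase x s i / bBase' x s j),
      norm_nonneg ((x : ℂ)⁻¹ * bBase' x s i / bBase x s j),
      norm_nonneg ((x : ℂ)⁻¹ * bBase' x s i / bBase' x s j)])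
  obtain ⟨S2, h2, e2⟩ := hfour ((x : ℂ)⁻¹ * bBase' x s i / bBase x s j) j (j = i + 1) (by
    simp only [K]; linarith [norm_nonneg ((x : ℂ) * bBase x s i / bBase' x s j),
      norm_nonneg ((x : ℂ) * bBase x s i / bBase x s j),
      norm_nonneg ((x : ℂ)⁻¹ * bBase' x s i / bBase' x s j)])
  obtain ⟨S3, h3, e3⟩ := hfour ((x : ℂ) * bBase x s i / bBase' x s j) (j + 1) (i = j + 1) (by
    simp only [K]; linarith [norm_nonneg ((x : ℂ) * bBase x s i / bBase x s j),
      norm_nonneg ((x : ℂ)⁻¹ * bBase' x s i / bBase x s j),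
      norm_nonneg ((x : ℂ)⁻¹ * bBase' x s i / bBase' x s j)])
  obtain ⟨S4, h4, e4⟩ := hfour ((x : ℂ)⁻¹ * bBase' x s i / bBase' x s j) (j + 1) (i = j) (by
    simp only [K]; linarith [norm_nonneg ((x : ℂ) * bBase x s i / bBase' x s j),
      norm_nonneg ((x : ℂ)⁻¹ * bBase' x s i / bBase x s j),
      norm_nonneg ((x : ℂ) * bBase x s i / bBase x s j)])
  have htot : HasSum (fun v => creation x s j u₂ v * annihilation x r s i u₁ v)
      (-S1 + S2 + S3 - S4) := by
    refine hasSum_of_eq (((h1.neg.add h2).add h3).sub h4) (fun v => ?_) rfl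
    obtain ⟨b, m⟩ := v
    have hm : (m : ℂ) ≠ 0 := by exact_mod_cast m.ne_zero
    have hwm : (x : ℂ) ^ (2 * u₂ * (m : ℂ)) * (x : ℂ) ^ (-(2 * u₁ * (m : ℂ))) = w ^ (m : ℕ) := by
      rw [← Complex.cpow_add _ _ hx, hwdef, ← Complex.cpow_mul_nat]
      congr 1
      ring
    simp only [creation, annihilation]
    rw [sum_bCoeff_betaComm hN hx0 hx1 r s _ (by exact_mod_cast qnum_ne_zero hx0 hx1 hs m),
      bCoeff_eq]
    have key : ∀ (B T : ℂ), -(1 / (m : ℂ)) * B * (x : ℂ) ^ (2 * u₂ * (m : ℂ)) *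
        (1 / (m : ℂ) * (((m : ℤ) : ℂ) *
          (qnum x ((r - 1) * ((m : ℤ) : ℂ)) / qnum x (r * ((m : ℤ) : ℂ))) * T) *
          (x : ℂ) ^ (-(2 * u₁ * (m : ℂ)))) =
        -(1 / (m : ℂ) * (qnum x ((r - 1) * (m : ℤ)) / qnum x (r * (m : ℤ))) * w ^ (m : ℕ)) *
          (B * T) := by
      intro B T
      rw [← hwm]
      push_cast
      field_simp
    rw [key]
    simp only [q, mul_pow, div_pow, zpow_neg, zpow_natCast, inv_pow]
    have c1 : (b = i ∧ b = j) ↔ (b = j ∧ i = j) := by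
      constructor
      · rintro ⟨rfl, rfl⟩; exact ⟨rfl, rfl⟩
      · rintro ⟨rfl, rfl⟩; exact ⟨rfl, rfl⟩
    have c2 : (b = i + 1 ∧ b = j) ↔ (b = j ∧ j = i + 1) := by
      constructor
      · rintro ⟨h, rfl⟩; exact ⟨rfl, h⟩
      · rintro ⟨rfl, h⟩; exact ⟨h, rfl⟩
    have c3 : (b = i ∧ b = j + 1) ↔ (b = j + 1 ∧ i = j + 1) := by
      constructor
      · rintro ⟨rfl, h⟩; exact ⟨h, h⟩
      · rintro ⟨h, h'⟩; exact ⟨h.trans h'.symm, h⟩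
    have c4 : (b = i + 1 ∧ b = j + 1) ↔ (b = j + 1 ∧ i = j) := by
      constructor
      · rintro ⟨h, h'⟩; exact ⟨h', add_right_cancel (h.symm.trans h')⟩
      · rintro ⟨h, rfl⟩; exact ⟨h, h⟩
    simp only [← c1, ← c2, ← c3, ← c4]
    have hi : ∀ (P Q : Prop) [Decidable P] [Decidable Q] (a c : ℂ),
        (if P then a else 0) * (if Q then c else 0) = if Q ∧ P then a * c else 0 := by
      intro P Q _ _ a c
      by_cases hp : P <;> by_cases hq : Q <;> simp [hp, hq]
    have hii : ∀ (P : Prop) [Decidable P] (k a c : ℂ), k * a = c →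
        k * (if P then a else 0) = if P then c else 0 := by
      intro P _ k a c h
      split_ifs
      · exact h
      · exact mul_zero k
    have hp1 : bBase x s j ^ (m : ℕ) ≠ 0 := pow_ne_zero _ cj0
    have hp2 : bBase' x s j ^ (m : ℕ) ≠ 0 := pow_ne_zero _ dj0
    have hp3 : (x : ℂ) ^ (m : ℕ) ≠ 0 := pow_ne_zero _ hx
    generalize 1 / (m : ℂ) * (qnum x ((r - 1) * (m : ℤ)) / qnum x (r * (m : ℤ))) = k
    simp only [sub_mul, mul_sub, hi, neg_mul]
    rw [hii _ _ _ (k * ((x : ℂ) ^ (m : ℕ) * bBase x s i ^ (m : ℕ) / bBase x s j ^ (m : ℕ) *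
        w ^ (m : ℕ))) (by field_simp),
      hii _ _ _ (k * ((x : ℂ) ^ (m : ℕ) * bBase x s i ^ (m : ℕ) / bBase' x s j ^ (m : ℕ) *
        w ^ (m : ℕ))) (by field_simp),
      hii _ _ _ (k * (((x : ℂ) ^ (m : ℕ))⁻¹ * bBase' x s i ^ (m : ℕ) / bBase x s j ^ (m : ℕ) *
        w ^ (m : ℕ))) (by field_simp),
      hii _ _ _ (k * (((x : ℂ) ^ (m : ℕ))⁻¹ * bBase' x s i ^ (m : ℕ) / bBase' x s j ^ (m : ℕ) *
        w ^ (m : ℕ))) (by field_simp)]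
    ring
  refine ⟨htot.summable, ?_⟩
  have hz : (x : ℂ) ^ (-(2 * s / N)) ≠ 0 := by simp [Complex.cpow_eq_zero_iff, hx]
  rw [htot.tsum_eq, show -S1 + S2 + S3 - S4 = S2 + S3 - (S1 + S4) by ring, Complex.exp_sub,
    Complex.exp_add, Complex.exp_add, e1, e2, e3, e4, contraction]
  have f2 : (if j = i + 1 then pairFun x r ((x : ℂ)⁻¹ * bBase' x s i / bBase x s j * w) else 1) =
      if j = i + 1 then pairFun x r ((x : ℂ) ^ (2 * s / N - 1) * w) else 1 := by
    split_ifs with h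
    · subst h
      rw [bBase_succ hx0, sub_eq_add_neg, Complex.cpow_add _ _ hx, Complex.cpow_neg_one]
      rw [Complex.cpow_neg] at hz ⊢
      congr 2
      field_simp
    · rfl
  have f3 : (if i = j + 1 then pairFun x r ((x : ℂ) * bBase x s i / bBase' x s j * w) else 1) =
      if i = j + 1 then pairFun x r ((x : ℂ) ^ (1 - 2 * s / N) * w) else 1 := by
    split_ifs with h
    · subst h
      rw [bBase_succ hx0, sub_eq_add_neg, Complex.cpow_add _ _ hx, Complex.cpow_one]
      congr 2
      field_simp
    · rfl
  rw [f2, f3, div_eq_mul_inv]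
  congr 1
  split_ifs with h
  · subst h
    rw [mul_div_assoc, mul_div_assoc, div_self ci0, div_self di0, mul_one, mul_one]
  · simp

theorem exp_listContraction {N : ℕ} [NeZero N] (hN : 2 ≤ N) {x : ℝ} (hx0 : 0 < x) (hx1 : x < 1)
    {r s : ℂ} (hr : r.re ≠ 0) (hs : 0 < s.re) :
    ∃ δ > 0, ∀ (a : Fin N × ℂ) (L : List (Fin N × ℂ)),
      (∀ b ∈ L, ‖(x : ℂ) ^ (2 * (b.2 - a.2))‖ < δ) →
      Summable (fun v => (L.map fun b => creation x s b.1 b.2).sum v *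
        annihilation x r s a.1 a.2 v) ∧
      Complex.exp (∑' v, (L.map fun b => creation x s b.1 b.2).sum v *
        annihilation x r s a.1 a.2 v) =
        (L.map fun b => contraction x r s a.1 b.1 ((x : ℂ) ^ (2 * (b.2 - a.2)))).prod := by
  obtain ⟨δ, hδ, h⟩ := contraction_eq_exp hN hx0 hx1 hr hs
  refine ⟨δ, hδ, fun a L => ?_⟩
  induction L with
  | nil => simp
  | cons b L ih =>
    intro hL
    obtain ⟨h1, h2⟩ := ih fun c hc => hL c (List.mem_cons_of_mem _ hc)
    obtain ⟨h3, h4⟩ := h a.1 b.1 a.2 b.2 (hL b List.mem_cons_self)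
    simp only [List.map_cons, List.sum_cons, List.prod_cons, Pi.add_apply, add_mul]
    exact ⟨h3.add h1, by rw [h3.tsum_add h1, Complex.exp_add, h2, h4]⟩

/-- The product of one current is the current. -/
theorem currentProd_singleton {N : ℕ} [NeZero N] (x : ℝ) (r s κ : ℂ) (j : Fin N) (u : ℂ) :
    currentProd x r s κ [(j, u)] = screening x r s κ j u := by
  refine LinearMap.ext fun ψ => funext fun σ => ?_
  simp [currentProd, screening, listContraction, listZeroMode, listAlpha]

/-- For `|z_b| ≪ |z_a|`, `b ∈ L`, the product `F_a ∏_{b ∈ L} F_b` is the composition of `F_a` and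
`∏_{b ∈ L} F_b`: each matrix element is the (absolutely convergent) sum over the intermediate
monomials. -/
theorem currentProd_cons {N : ℕ} [NeZero N] (hN : 2 ≤ N) {x : ℝ} (hx0 : 0 < x) (hx1 : x < 1)
    {r s : ℂ} (κ : ℂ) (hr : r.re ≠ 0) (hs : 0 < s.re) :
    ∃ δ > 0, ∀ (a : Fin N × ℂ) (L : List (Fin N × ℂ)),
      (∀ b ∈ L, ‖(x : ℂ) ^ (2 * (b.2 - a.2))‖ < δ) →
      ∀ (ψ : Fock N) (σ : Sector N) (b : Osc N →₀ ℕ),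
        HasSum (fun c => MvPowerSeries.coeff c
            (currentProd x r s κ L ψ (σ.1, σ.2 + alpha a.1)) *
          MvPowerSeries.coeff b (screening x r s κ a.1 a.2
            (Finsupp.single (σ.1, σ.2 + alpha a.1) (MvPolynomial.monomial c 1)) σ))
        (MvPowerSeries.coeff b (currentProd x r s κ (a :: L) ψ σ)) := by
  obtain ⟨δ, hδ, h⟩ := exp_listContraction hN hx0 hx1 hr hs
  refine ⟨δ, hδ, fun a L hL ψ σ b => ?_⟩
  obtain ⟨h1, h2⟩ := h a L hL
  have hα : σ.2 + listAlpha (a :: L) = σ.2 + alpha a.1 + listAlpha L := by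
    simp [listAlpha, add_assoc]
  have h3 := (hasSum_normalExp (creation x s a.1 a.2) (annihilation x r s a.1 a.2) _
    (L.map fun b => annihilation x r s b.1 b.2).sum h1
    (ψ (σ.1, σ.2 + alpha a.1 + listAlpha L)) b).mul_left
    (listContraction x r s L *
      listZeroMode x r s κ L (σ.1, σ.2 + alpha a.1 + listAlpha L) *
      zeroMode x r s κ a.1 a.2 (momentum κ (σ.1, σ.2 + alpha a.1)))
  refine hasSum_of_eq h3 (fun c => ?_) ?_
  · simp only [currentProd, screening, LinearMap.coe_mk, AddHom.coe_mk, Finsupp.single_eq_same,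
      MvPowerSeries.coeff_smul]
    ring
  · simp only [currentProd, LinearMap.coe_mk, AddHom.coe_mk, hα, listContraction, listZeroMode,
      List.map_cons, List.sum_cons, MvPowerSeries.coeff_smul, add_sub_cancel_right, h2]
    ring

/-! ### Consistency of the oscillators and of `η` -/

theorem betaComm_antisymm {N : ℕ} (x : ℝ) (r s : ℂ) (m : ℤ) (i j : Fin N) :
    betaComm x r s (-m) j i = -betaComm x r s m i j := by
  have hq : ∀ a : ℂ, qnum x (-a) = -qnum x a := by
    intro a
    simp only [qnum, neg_neg]
    ring
  have h1 : ∀ a : ℂ, qnum x (a * ((-m : ℤ) : ℂ)) = -qnum x (a * m) := by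
    intro a
    rw [← hq]
    push_cast
    rw [mul_neg]
  have h2 : qnum x ((-m : ℤ) : ℂ) = -qnum x m := by
    rw [← hq]
    push_cast
    rfl
  have h3 : s * ((-m : ℤ) : ℂ) * (Int.sign ((j : ℤ) - (i : ℤ)) : ℂ) =
      s * m * (Int.sign ((i : ℤ) - (j : ℤ)) : ℂ) := by
    rw [← neg_sub (i : ℤ) (j : ℤ), Int.sign_neg]
    push_cast
    ring
  unfold betaComm
  by_cases h : i = j
  · subst h
    rw [if_pos rfl, if_pos rfl, h1, h1, h1, h1, neg_div_neg_eq, neg_div_neg_eq]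
    push_cast
    ring
  · rw [if_neg (Ne.symm h), if_neg h, h1, h1, h1, h2, h3, neg_div_neg_eq, neg_div_neg_eq]
    push_cast
    ring

theorem beta_neg {N : ℕ} (x : ℝ) (r s : ℂ) (m : ℕ+) (j : Fin N) (f : OscPoly N) :
    beta x r s (-(m : ℤ)) j f = MvPolynomial.X (j, m) * f := by
  have h2 : -(m : ℤ) < 0 := by have := m.pos; omega
  have h3 : (-(m : ℤ)).natAbs.toPNat' = m := by
    rw [Int.natAbs_neg, Int.natAbs_natCast, PNat.coe_toPNat']
  rw [beta, if_pos h2, h3]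
  rfl

theorem beta_pos {N : ℕ} (x : ℝ) (r s : ℂ) (m : ℕ+) (j : Fin N) (f : OscPoly N) :
    beta x r s (m : ℤ) j f =
      ∑ i, betaComm x r s m j i • MvPolynomial.pderiv ((i, m) : Osc N) f := by
  have h1 : 0 < (m : ℤ) := by have := m.pos; omega
  have h3 : (m : ℤ).natAbs.toPNat' = m := by
    rw [Int.natAbs_natCast, PNat.coe_toPNat']
  rw [beta, if_neg (not_lt.mpr h1.le), if_pos h1, h3]
  simp

theorem exists_pnat {k : ℤ} (hk : k ≠ 0) : (∃ p : ℕ+, k = p) ∨ ∃ p : ℕ+, k = -(p : ℤ) := by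
  rcases lt_or_gt_of_ne hk with h | h
  · refine Or.inr ⟨⟨(-k).toNat, by omega⟩, ?_⟩
    rw [PNat.mk_coe]
    omega
  · refine Or.inl ⟨⟨k.toNat, by omega⟩, ?_⟩
    rw [PNat.mk_coe]
    omega

theorem beta_pos_neg {N : ℕ} (x : ℝ) (r s : ℂ) (m n : ℕ+) (i j : Fin N) (f : OscPoly N) :
    beta x r s (m : ℤ) i (beta x r s (-(n : ℤ)) j f) -
      beta x r s (-(n : ℤ)) j (beta x r s (m : ℤ) i f) =
      (if m = n then betaComm x r s m i j else 0) • f := by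
  classical
  simp only [beta_pos, beta_neg, Derivation.leibniz, smul_add, Finset.sum_add_distrib,
    Finset.mul_sum, smul_eq_mul, mul_smul_comm, add_sub_cancel_left, MvPolynomial.pderiv_X]
  by_cases h : m = n
  · subst h
    rw [if_pos rfl, Finset.sum_eq_single j]
    · simp
    · intro a _ ha
      have : ((j, m) : Osc N) ≠ (a, m) := fun e => ha (Prod.ext_iff.mp e).1.symm
      simp [this]
    · simp
  · rw [if_neg h, zero_smul]
    refine Finset.sum_eq_zero fun a _ => ?_
    have : ((j, n) : Osc N) ≠ (a, m) := fun e => h (Prod.ext_iff.mp e).2.symm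
    simp [this]

theorem pderiv_comm {N : ℕ} (a b : Osc N) (f : OscPoly N) :
    MvPolynomial.pderiv a (MvPolynomial.pderiv b f) =
      MvPolynomial.pderiv b (MvPolynomial.pderiv a f) := by
  classical
  induction f using MvPolynomial.induction_on with
  | C c => simp
  | add p q hp hq => simp [hp, hq]
  | mul_X p w hp =>
    simp only [Derivation.leibniz, map_add, smul_eq_mul, hp, MvPolynomial.pderiv_X, Pi.single_apply]
    split_ifs <;> simp <;> ring

/-- The commutation relations of the oscillators. -/
theorem beta_comm {N : ℕ} (x : ℝ) (r s : ℂ) {m n : ℤ} (hm : m ≠ 0) (hn : n ≠ 0) (i j : Fin N)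
    (f : OscPoly N) :
    beta x r s m i (beta x r s n j f) - beta x r s n j (beta x r s m i f) =
      (if n + m = 0 then betaComm x r s m i j else 0) • f := by
  rcases exists_pnat hm with ⟨p, rfl⟩ | ⟨p, rfl⟩ <;> rcases exists_pnat hn with ⟨q, rfl⟩ | ⟨q, rfl⟩
  · have h0 : ¬ ((q : ℤ) + (p : ℤ) = 0) := by have := p.pos; omega
    rw [if_neg h0, zero_smul, sub_eq_zero]
    have hc : ∀ a b : Osc N, MvPolynomial.pderiv a (MvPolynomial.pderiv b f) =
        MvPolynomial.pderiv b (MvPolynomial.pderiv a f) := fun a b => pderiv_comm a b f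
    rw [beta_pos, beta_pos, beta_pos, beta_pos]
    simp only [map_sum, Derivation.map_smul, Finset.smul_sum]
    rw [Finset.sum_comm]
    refine Finset.sum_congr rfl fun a _ => Finset.sum_congr rfl fun b _ => ?_
    rw [smul_comm, hc]
  · rw [beta_pos_neg]
    by_cases h : p = q
    · subst h
      simp
    · have : ¬ (-(q : ℤ) + (p : ℤ) = 0) := fun e => h (PNat.coe_injective (by omega))
      rw [if_neg h, if_neg this]
  · rw [← neg_sub, beta_pos_neg, ← neg_smul]
    by_cases h : q = p
    · subst h
      simp [betaComm_antisymm x r s (q : ℤ) j i]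
    · have : ¬ ((q : ℤ) + -(p : ℤ) = 0) := fun e => h (PNat.coe_injective (by omega))
      rw [if_neg h, if_neg this, neg_zero]
  · have h0 : ¬ (-(q : ℤ) + -(p : ℤ) = 0) := by have := p.pos; omega
    rw [if_neg h0, zero_smul, sub_eq_zero]
    simp only [beta_neg]
    ring

theorem etaPoly_X {N : ℕ} [NeZero N] (x : ℝ) (s : ℂ) (hx : 0 < x) (v : Osc N) :
    etaPoly x s hx (MvPolynomial.X v) =
      MvPolynomial.C (etaScalar x s v) * MvPolynomial.X (oscRot N v) :=
  MvPolynomial.aeval_X _ _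

theorem etaPoly_C {N : ℕ} [NeZero N] (x : ℝ) (s : ℂ) (hx : 0 < x) (a : ℂ) :
    etaPoly x s hx (MvPolynomial.C a) = (MvPolynomial.C a : OscPoly N) :=
  MvPolynomial.aeval_C _ _

theorem pderiv_etaPoly {N : ℕ} [NeZero N] (x : ℝ) (s : ℂ) (hx : 0 < x) (v : Osc N)
    (f : OscPoly N) :
    MvPolynomial.pderiv (oscRot N v) (etaPoly x s hx f) =
      etaScalar x s v • etaPoly x s hx (MvPolynomial.pderiv v f) := by
  classical
  have hX := etaPoly_X (N := N) x s hx
  have hC := etaPoly_C (N := N) x s hx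
  induction f using MvPolynomial.induction_on with
  | C a => simp [hC]
  | add p q hp hq => simp [hp, hq]
  | mul_X p w hp =>
    rw [map_mul, Derivation.leibniz, Derivation.leibniz, hp, hX]
    by_cases h : w = v
    · subst h
      simp [hX, MvPolynomial.smul_eq_C_mul]
      ring
    · have h' : oscRot N w ≠ oscRot N v := fun e => h ((oscRot N).injective e)
      simp [MvPolynomial.pderiv_X_of_ne h, MvPolynomial.pderiv_X_of_ne h', hX,
        MvPolynomial.smul_eq_C_mul]
      ring

/-- `η(β_m^j) = x^{-(2s/N)m} β_m^{j+1}` for `1 ≤ j ≤ N-1`, and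
`η(β_m^N) = x^{(2s/N)(N-1)m} β_m^1`. -/
theorem etaPoly_beta {N : ℕ} [NeZero N] {x : ℝ} (hx : 0 < x) (r s : ℂ) (m : ℤ) (j : Fin N)
    (f : OscPoly N) :
    etaPoly x s hx (beta x r s m j f) =
      (if (j : ℕ) + 1 < N then (x : ℂ) ^ (-(2 * s / N) * m)
        else (x : ℂ) ^ (2 * s / N * ((N : ℂ) - 1) * m)) •
      beta x r s m (j + 1) (etaPoly x s hx f) := by
  have h0 : (x : ℂ) ≠ 0 := Complex.ofReal_ne_zero.mpr hx.ne'
  have hN : (N : ℂ) ≠ 0 := by exact_mod_cast NeZero.ne N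
  rcases eq_or_ne m 0 with rfl | hm
  · simp [beta]
  rcases exists_pnat hm with ⟨p, rfl⟩ | ⟨p, rfl⟩
  · have hS : (x : ℂ) ^ (s * (p : ℂ)) ≠ 0 := by simp [Complex.cpow_eq_zero_iff, h0]
    have hT : (x : ℂ) ^ (2 * s / N * (p : ℂ)) ≠ 0 := by simp [Complex.cpow_eq_zero_iff, h0]
    have t1 : (x : ℂ) ^ (-(2 * s / N) * (((p : ℕ) : ℤ) : ℂ)) =
        ((x : ℂ) ^ (2 * s / N * (p : ℂ)))⁻¹ := by
      rw [← Complex.cpow_neg]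
      congr 1
      push_cast
      ring
    have t2 : (x : ℂ) ^ (2 * s / N * ((N : ℂ) - 1) * (((p : ℕ) : ℤ) : ℂ)) =
        ((x : ℂ) ^ (s * (p : ℂ))) ^ 2 * ((x : ℂ) ^ (2 * s / N * (p : ℂ)))⁻¹ := by
      rw [← Complex.cpow_neg, ← Complex.cpow_mul_nat, ← Complex.cpow_add _ _ h0]
      congr 1
      push_cast
      field_simp
      ring
    have t3 : (x : ℂ) ^ (-(2 * s / N) * ((N : ℂ) - 1) * (p : ℂ)) =
        (((x : ℂ) ^ (s * (p : ℂ))) ^ 2)⁻¹ * (x : ℂ) ^ (2 * s / N * (p : ℂ)) := by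
      rw [← Complex.cpow_mul_nat, ← Complex.cpow_neg, ← Complex.cpow_add _ _ h0]
      congr 1
      push_cast
      field_simp
      ring
    have t4 : ((x : ℂ) ^ s) ^ ((p : ℕ) : ℤ) = (x : ℂ) ^ (s * (p : ℂ)) := by
      rw [← Complex.cpow_mul_int]
      push_cast
      rfl
    rw [beta_pos, beta_pos, map_sum, ← Equiv.sum_comp (Equiv.addRight (1 : Fin N)) fun i =>
      betaComm x r s ((p : ℕ) : ℤ) (j + 1) i •
        MvPolynomial.pderiv ((i, p) : Osc N) (etaPoly x s hx f), Finset.smul_sum]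
    refine Finset.sum_congr rfl fun i _ => ?_
    have h1 := pderiv_etaPoly x s hx (i, p) f
    have h2 : oscRot N (i, p) = ((Equiv.addRight (1 : Fin N)) i, p) := rfl
    rw [h2] at h1
    rw [h1, map_smul, smul_smul, smul_smul]
    congr 1
    have hi := i.isLt
    have hj := j.isLt
    have hvi := val_add_one i
    have hvj := val_add_one j
    simp only [Equiv.coe_addRight, etaScalar]
    rw [t1, t2, t3]
    clear t1 t2 t3
    generalize (x : ℂ) ^ (2 * s / N * (p : ℂ)) = T at *
    rcases lt_trichotomy (j : ℕ) (i : ℕ) with hlt | heq | hgt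
    · have hjl : (j : ℕ) + 1 < N := by omega
      rw [if_pos hjl] at hvj ⊢
      by_cases hil : (i : ℕ) + 1 < N
      · rw [if_pos hil] at hvi ⊢
        rw [betaComm_lt x r s _ hlt, betaComm_lt x r s _ (i := j + 1) (j := i + 1) (by omega), t4]
        generalize (x : ℂ) ^ (s * (p : ℂ)) = S at *
        field_simp
      · rw [if_neg hil] at hvi ⊢
        rw [betaComm_lt x r s _ hlt, betaComm_gt x r s _ (i := j + 1) (j := i + 1) (by omega), t4]
        generalize (x : ℂ) ^ (s * (p : ℂ)) = S at *
        field_simp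
    · have : j = i := Fin.ext heq
      subst this
      rw [betaComm_self, betaComm_self]
      split_ifs <;> field_simp
    · have hil : (i : ℕ) + 1 < N := by omega
      rw [if_pos hil] at hvi ⊢
      by_cases hjl : (j : ℕ) + 1 < N
      · rw [if_pos hjl] at hvj ⊢
        rw [betaComm_gt x r s _ hgt, betaComm_gt x r s _ (i := j + 1) (j := i + 1) (by omega), t4]
        generalize (x : ℂ) ^ (s * (p : ℂ)) = S at *
        field_simp
      · rw [if_neg hjl] at hvj ⊢
        rw [betaComm_gt x r s _ hgt, betaComm_lt x r s _ (i := j + 1) (j := i + 1) (by omega), t4]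
        generalize (x : ℂ) ^ (s * (p : ℂ)) = S at *
        field_simp
  · rw [beta_neg, beta_neg, map_mul, etaPoly_X, mul_assoc, ← MvPolynomial.smul_eq_C_mul]
    have e : etaScalar x s (j, p) = if (j : ℕ) + 1 < N then
        (x : ℂ) ^ (-(2 * s / N) * ((-(p : ℤ) : ℤ) : ℂ))
        else (x : ℂ) ^ (2 * s / N * ((N : ℂ) - 1) * ((-(p : ℤ) : ℤ) : ℂ)) := by
      unfold etaScalar
      split_ifs <;> congr 1 <;> push_cast <;> ring
    rw [e]
    rfl

theorem momentum_etaSector {N : ℕ} [NeZero N] (κ : ℂ) (σ : Sector N) :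
    momentum κ (etaSector N σ) = etaVec N ℂ (momentum κ σ) := rfl

/-- `etaSeries` extends `etaPoly`. -/
theorem etaSeries_coe {N : ℕ} [NeZero N] (x : ℝ) (s : ℂ) (hx : 0 < x) (f : OscPoly N) :
    etaSeries x s (f : OscSeries N) = (etaPoly x s hx f : OscSeries N) := by
  classical
  induction f using MvPolynomial.induction_on' with
  | add p q hp hq => rw [MvPolynomial.coe_add, map_add, hp, hq, map_add, MvPolynomial.coe_add]
  | monomial c a =>
    have h1 : etaPoly x s hx (MvPolynomial.monomial c a) =
        MvPolynomial.monomial (c.equivMapDomain (oscRot N))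
          (a * c.prod fun v n => etaScalar x s v ^ n) := by
      have h2 : etaPoly x s hx (MvPolynomial.monomial c a) = MvPolynomial.C a *
          c.prod fun v n => (MvPolynomial.C (etaScalar x s v) *
            MvPolynomial.X (oscRot N v) : OscPoly N) ^ n :=
        MvPolynomial.aeval_monomial _ _ _
      rw [h2, MvPolynomial.monomial_eq, MvPolynomial.C_mul, mul_assoc]
      congr 1
      rw [Finsupp.equivMapDomain_eq_mapDomain, Finsupp.prod_mapDomain_index_inj
        (oscRot N).injective]
      simp only [Finsupp.prod, mul_pow, Finset.prod_mul_distrib, map_prod, map_pow]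
    rw [h1]
    ext b
    rw [MvPolynomial.coeff_coe, MvPolynomial.coeff_monomial]
    change ((b.equivMapDomain (oscRot N).symm).prod fun v n => etaScalar x s v ^ n) *
      MvPowerSeries.coeff (b.equivMapDomain (oscRot N).symm)
        ((MvPolynomial.monomial c a : OscPoly N) : OscSeries N) = _
    rw [MvPolynomial.coeff_coe, MvPolynomial.coeff_monomial]
    by_cases h : c.equivMapDomain (oscRot N) = b
    · subst h
      have h3 : (c.equivMapDomain (oscRot N)).equivMapDomain (oscRot N).symm = c := by
        ext v
        simp [Finsupp.equivMapDomain_apply]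
      rw [h3, if_pos rfl, if_pos rfl, mul_comm]
    · have h3 : c ≠ b.equivMapDomain (oscRot N).symm := by
        rintro rfl
        apply h
        ext v
        simp [Finsupp.equivMapDomain_apply]
      rw [if_neg h, if_neg h3, mul_zero]

end DeformedW

end

noncomputable section

namespace DeformedW

/-! ### Infinite products -/

theorem summable_norm_mul_pow {q : ℂ} (hq : ‖q‖ < 1) (z : ℂ) :
    Summable fun k : ℕ => ‖-(z * q ^ k)‖ := by
  have h : (fun k : ℕ => ‖-(z * q ^ k)‖) = fun k : ℕ => ‖z‖ * ‖q‖ ^ k := by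
    funext k
    rw [norm_neg, norm_mul, norm_pow]
  rw [h]
  exact (summable_geometric_of_lt_one (norm_nonneg q) hq).mul_left ‖z‖

theorem qPoch_eq {q : ℂ} (hq : ‖q‖ < 1) (z : ℂ) : qPoch z q = (1 - z) * qPoch (z * q) q := by
  have h1 : Multipliable fun k : ℕ => 1 + -(z * q * q ^ k) :=
    multipliable_one_add_of_summable (summable_norm_mul_pow hq (z * q))
  have e : ∀ k : ℕ, 1 - z * q ^ (k + 1) = 1 + -(z * q * q ^ k) := fun k => by ring
  have e' : ∀ k : ℕ, 1 - z * q * q ^ k = 1 + -(z * q * q ^ k) := fun k => by ring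
  have h2 : Multipliable fun k : ℕ => 1 - z * q ^ (k + 1) := by
    rw [funext e]
    exact h1
  rw [qPoch, tprod_eq_zero_mul' (f := fun k : ℕ => 1 - z * q ^ k) h2, pow_zero, mul_one, qPoch,
    funext e, funext e']

theorem qPoch_ne_zero {q : ℂ} (hq : ‖q‖ < 1) {z : ℂ} (hz : ∀ k : ℕ, z * q ^ k ≠ 1) :
    qPoch z q ≠ 0 := by
  have := tprod_one_add_ne_zero_of_summable (f := fun k : ℕ => -(z * q ^ k))
    (fun k h => hz k (by linear_combination -h)) (summable_norm_mul_pow hq z)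
  simpa [qPoch, sub_eq_add_neg] using this

theorem qPoch_ne_zero_of_norm_lt {q : ℂ} (hq : ‖q‖ < 1) {z : ℂ} (hz : ‖z‖ < 1) :
    qPoch z q ≠ 0 := by
  refine qPoch_ne_zero hq fun k h => ?_
  have : ‖z * q ^ k‖ < 1 := by
    rw [norm_mul, norm_pow]
    exact mul_lt_one_of_nonneg_of_lt_one_left (norm_nonneg _) hz
      (pow_le_one₀ (norm_nonneg _) hq.le)
  rw [h, norm_one] at this
  exact lt_irrefl _ this

theorem continuous_qPoch {q : ℂ} (hq : ‖q‖ < 1) : Continuous fun z => qPoch z q := by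
  rw [continuous_iff_continuousAt]
  intro z
  have h := Summable.hasProdLocallyUniformlyOn_nat_one_add (f := fun (k : ℕ) (y : ℂ) => -(y * q ^ k))
    (K := Metric.ball 0 (‖z‖ + 1)) Metric.isOpen_ball
    ((summable_geometric_of_lt_one (norm_nonneg _) hq).mul_left (‖z‖ + 1))
    (Filter.Eventually.of_forall fun k y hy => by
      rw [norm_neg, norm_mul, norm_pow]
      have : ‖y‖ < ‖z‖ + 1 := by simpa using hy
      gcongr) (fun k => by fun_prop)
  rw [hasProdLocallyUniformlyOn_iff_tendstoLocallyUniformlyOn] at h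
  have h2 := h.continuousOn (Filter.Frequently.of_forall fun S => by fun_prop)
  have h3 := h2.continuousAt (Metric.isOpen_ball.mem_nhds (x := z) (by simp))
  simpa [qPoch, sub_eq_add_neg] using h3

theorem countable_qPoch_zeros {q : ℂ} (hq : ‖q‖ < 1) {c : ℂ} :
    {w : ℂ | qPoch (c * w) q = 0}.Countable := by
  refine (Set.countable_range fun k : ℕ => (c * q ^ k)⁻¹).mono fun w hw => ?_
  by_contra h
  refine qPoch_ne_zero hq (fun k hk => h ⟨k, ?_⟩) hw
  have : c * q ^ k * w = 1 := by linear_combination hk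
  exact (eq_inv_of_mul_eq_one_right this).symm

/-- The contour `|z| = |z'| = 1` in the coordinates `z = x^{2u}`, `z' = x^{2u'}`. -/
def imagPairs : Set (ℂ × ℂ) := {v | v.1.re = 0 ∧ v.2.re = 0}

/-- Two functions of `u, u'` agree outside countably many values of `z'/z`. -/
def AgreeGenerically (x : ℝ) (f g : ℂ → ℂ → ℂ) : Prop :=
  ∃ Z : Set ℂ, Z.Countable ∧ ∀ u u' : ℂ, (x : ℂ) ^ (2 * (u' - u)) ∉ Z → f u u' = g u u'

theorem continuous_qPoch_cpow {x : ℝ} (hx0 : 0 < x) {q : ℂ} (hq : ‖q‖ < 1) (a b : ℂ) :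
    Continuous fun v : ℂ × ℂ => qPoch ((x : ℂ) ^ (a + b * (v.2 - v.1))) q := by
  have : (x : ℂ) ≠ 0 := Complex.ofReal_ne_zero.mpr hx0.ne'
  refine (continuous_qPoch hq).comp (Continuous.const_cpow (by fun_prop) (Or.inl this))

theorem qPoch_cpow_ne_zero {x : ℝ} (hx0 : 0 < x) (hx1 : x < 1) {q : ℂ} (hq : ‖q‖ < 1) {a : ℂ}
    (ha : 0 < a.re) (b : ℝ) {v : ℂ × ℂ} (hv : v ∈ imagPairs) :
    qPoch ((x : ℂ) ^ (a + b * (v.2 - v.1))) q ≠ 0 := by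
  refine qPoch_ne_zero_of_norm_lt hq (norm_cpow_lt_one hx0 hx1 ?_)
  simp [hv.1, hv.2, ha]

/-- The factor of the integrand for the pair of currents `F_t(x^{2u})`, `F_{t+1}(x^{2u'})`,
up to a constant; `a = s/N`. -/
def crossFactor (x : ℝ) (r a u u' : ℂ) : ℂ :=
  (x : ℂ) ^ (-(u' - u) ^ 2 / r + 2 * (u' - u) * (1 - a) / r - (u' - u) - 2 * u * ((r - 1) / r)) *
  if 0 < r.re then
    (qPoch ((x : ℂ) ^ ((2 - 2 * a) + ((-2 : ℝ) : ℂ) * (u' - u))) ((x : ℂ) ^ (2 * r)) *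
      qPoch ((x : ℂ) ^ (2 * a + ((2 : ℝ) : ℂ) * (u' - u))) ((x : ℂ) ^ (2 * r)))⁻¹
  else
    qPoch ((x : ℂ) ^ ((2 - 2 * a - 2 * r) + ((-2 : ℝ) : ℂ) * (u' - u))) ((x : ℂ) ^ (-2 * r)) *
      qPoch ((x : ℂ) ^ ((2 * a - 2 * r) + ((2 : ℝ) : ℂ) * (u' - u))) ((x : ℂ) ^ (-2 * r))

theorem norm_cpow_two_mul_lt {x : ℝ} (hx0 : 0 < x) (hx1 : x < 1) {r : ℂ} (hr : 0 < r.re) :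
    ‖(x : ℂ) ^ (2 * r)‖ < 1 := norm_cpow_lt_one hx0 hx1 (by simpa using hr)

theorem norm_cpow_neg_two_mul_lt {x : ℝ} (hx0 : 0 < x) (hx1 : x < 1) {r : ℂ} (hr : r.re < 0) :
    ‖(x : ℂ) ^ (-2 * r)‖ < 1 := norm_cpow_lt_one hx0 hx1 (by simp; linarith)

theorem continuousOn_crossFactor {x : ℝ} (hx0 : 0 < x) (hx1 : x < 1) {r a : ℂ} (hr : r.re ≠ 0)
    (ha0 : 0 < a.re) (ha1 : a.re < 1) :
    ContinuousOn (fun v : ℂ × ℂ => crossFactor x r a v.1 v.2) imagPairs := by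
  have h0 : (x : ℂ) ≠ 0 := Complex.ofReal_ne_zero.mpr hx0.ne'
  unfold crossFactor
  refine ContinuousOn.mul (Continuous.continuousOn
    (Continuous.const_cpow (by fun_prop) (Or.inl h0))) ?_
  rcases lt_or_gt_of_ne hr with hneg | hpos
  · simp only [if_neg (not_lt.mpr hneg.le)]
    have hq := norm_cpow_neg_two_mul_lt hx0 hx1 hneg
    exact ((continuous_qPoch_cpow hx0 hq _ _).mul
      (continuous_qPoch_cpow hx0 hq _ _)).continuousOn
  · simp only [if_pos hpos]
    have hq := norm_cpow_two_mul_lt hx0 hx1 hpos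
    refine ContinuousOn.inv₀ ((continuous_qPoch_cpow hx0 hq _ _).mul
      (continuous_qPoch_cpow hx0 hq _ _)).continuousOn fun v hv => ?_
    exact mul_ne_zero (qPoch_cpow_ne_zero hx0 hx1 hq (by simp; linarith) _ hv)
      (qPoch_cpow_ne_zero hx0 hx1 hq (by simpa using ha0) _ hv)

theorem crossFactor_swap (x : ℝ) {r : ℂ} (hr : r ≠ 0) (a u u' : ℂ) :
    crossFactor x r (1 - a) u' u = crossFactor x r a u u' := by
  unfold crossFactor
  congr 1
  · congr 1
    field_simp
    ring
  · split_ifs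
    · rw [mul_comm]
      congr 4 <;> push_cast <;> ring
    · rw [mul_comm]
      congr 3 <;> push_cast <;> ring

theorem pairFun_div_theta {x : ℝ} (hx0 : 0 < x) (hx1 : x < 1) {r : ℂ} (hr : r.re ≠ 0) (a : ℂ) :
    ∃ c : ℂ, AgreeGenerically x
      (fun u u' => (x : ℂ) ^ (-2 * u * ((r - 1) / r)) *
        pairFun x r ((x : ℂ) ^ (2 * a - 1) * (x : ℂ) ^ (2 * (u' - u))) /
          theta x r (u - u' + 1 - a))
      (fun u u' => c * crossFactor x r a u u') := by
  have h0 : (x : ℂ) ≠ 0 := Complex.ofReal_ne_zero.mpr hx0.ne'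
  have hr0 : r ≠ 0 := fun h => hr (by simp [h])
  have hne : ∀ b : ℂ, (x : ℂ) ^ b ≠ 0 := fun b => by simp [Complex.cpow_eq_zero_iff, h0]
  rcases lt_or_gt_of_ne hr with hneg | hpos
  · have hq := norm_cpow_neg_two_mul_lt hx0 hx1 hneg
    refine ⟨-((x : ℂ) ^ (-(1 - a) ^ 2 / r + (1 - a)) * qPoch ((x : ℂ) ^ (-2 * r)) ((x : ℂ) ^ (-2 * r))),
      _, countable_qPoch_zeros hq (c := (x : ℂ) ^ (2 * a - 2)), fun u u' hu => ?_⟩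
    have n1 : ¬ 0 < r.re := not_lt.mpr hneg.le
    rw [Set.mem_ofPred_eq, ← Complex.cpow_add _ _ h0] at hu
    have hnr : (-r) ≠ 0 := neg_ne_zero.mpr hr0
    simp only [pairFun, crossFactor, theta, thetaPos, bigTheta, if_neg n1]
    have e1 : (x : ℂ) ^ (1 - 2 * r) * ((x : ℂ) ^ (2 * a - 1) * (x : ℂ) ^ (2 * (u' - u))) =
        (x : ℂ) ^ ((2 * a - 2 * r) + ((2 : ℝ) : ℂ) * (u' - u)) := by
      rw [← Complex.cpow_add _ _ h0, ← Complex.cpow_add _ _ h0]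
      congr 1; push_cast; ring
    have e2 : (x : ℂ)⁻¹ * ((x : ℂ) ^ (2 * a - 1) * (x : ℂ) ^ (2 * (u' - u))) =
        (x : ℂ) ^ (2 * a - 2 + 2 * (u' - u)) := by
      rw [← Complex.cpow_neg_one, ← Complex.cpow_add _ _ h0, ← Complex.cpow_add _ _ h0]
      congr 1; ring
    have e3 : (x : ℂ) ^ (2 * -r) = (x : ℂ) ^ (-2 * r) := by congr 1; ring
    have e4 : (x : ℂ) ^ (-2 * r) / (x : ℂ) ^ (2 * (u - u' + 1 - a)) =
        (x : ℂ) ^ (2 * a - 2 + 2 * (u' - u)) * (x : ℂ) ^ (-2 * r) := by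
      rw [← Complex.cpow_sub _ _ h0, ← Complex.cpow_add _ _ h0]
      congr 1; ring
    have e5 : (x : ℂ) ^ (2 * (u - u' + 1 - a)) * (x : ℂ) ^ (-2 * r) =
        (x : ℂ) ^ ((2 - 2 * a - 2 * r) + ((-2 : ℝ) : ℂ) * (u' - u)) := by
      rw [← Complex.cpow_add _ _ h0]
      congr 1; push_cast; ring
    have e6 : (x : ℂ) ^ (2 * (u - u' + 1 - a)) * (x : ℂ) ^ (2 * a - 2 + 2 * (u' - u)) = 1 := by
      rw [← Complex.cpow_add _ _ h0, show 2 * (u - u' + 1 - a) + (2 * a - 2 + 2 * (u' - u)) = 0 by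
        ring, Complex.cpow_zero]
    have e7 : (x : ℂ) ^ (-2 * u * ((r - 1) / r)) *
        (x : ℂ) ^ ((u - u' + 1 - a) ^ 2 / -r - (u - u' + 1 - a)) * (x : ℂ) ^ (2 * (u - u' + 1 - a)) =
        (x : ℂ) ^ (-(1 - a) ^ 2 / r + (1 - a)) * (x : ℂ) ^ (-(u' - u) ^ 2 / r +
          2 * (u' - u) * (1 - a) / r - (u' - u) - 2 * u * ((r - 1) / r)) := by
      simp only [← Complex.cpow_add _ _ h0]
      congr 1; field_simp; ring
    rw [e1, e2, e3, e4, qPoch_eq hq ((x : ℂ) ^ (2 * (u - u' + 1 - a))), e5]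
    rw [qPoch_eq hq ((x : ℂ) ^ (2 * a - 2 + 2 * (u' - u)))] at hu ⊢
    obtain ⟨hu1, hu2⟩ := ne_eq _ _ ▸ mul_ne_zero_iff.mp hu
    rw [div_inv_eq_mul, mul_div_assoc', div_mul_eq_mul_div, div_eq_iff (mul_ne_zero hu1 hu2)]
    generalize qPoch ((x : ℂ) ^ (2 * a - 2 + 2 * (u' - u)) * (x : ℂ) ^ (-2 * r)) _ = A at *
    generalize qPoch ((x : ℂ) ^ ((2 * a - 2 * r) + ((2 : ℝ) : ℂ) * (u' - u))) _ = B at *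
    generalize qPoch ((x : ℂ) ^ ((2 - 2 * a - 2 * r) + ((-2 : ℝ) : ℂ) * (u' - u))) _ = C at *
    generalize qPoch _ _ = D at *
    generalize (x : ℂ) ^ (-(1 - a) ^ 2 / r + (1 - a)) = k1 at *
    generalize (x : ℂ) ^ (-(u' - u) ^ 2 / r + 2 * (u' - u) * (1 - a) / r - (u' - u) -
      2 * u * ((r - 1) / r)) = k2 at *
    generalize (x : ℂ) ^ (2 * (u - u' + 1 - a)) = y at *
    generalize (x : ℂ) ^ (2 * a - 2 + 2 * (u' - u)) = y' at *
    generalize (x : ℂ) ^ (-2 * u * ((r - 1) / r)) = k3 at *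
    generalize (x : ℂ) ^ ((u - u' + 1 - a) ^ 2 / -r - (u - u' + 1 - a)) = k4 at *
    linear_combination (A * B * C * D * (y' - 1)) * e7 - (A * B * C * D * k3 * k4) * e6
  · have hq := norm_cpow_two_mul_lt hx0 hx1 hpos
    refine ⟨(x : ℂ) ^ (-(1 - a) ^ 2 / r + (1 - a)) / qPoch ((x : ℂ) ^ (2 * r)) ((x : ℂ) ^ (2 * r)),
      _, countable_qPoch_zeros hq (c := (x : ℂ) ^ (2 * r - 2 + 2 * a)), fun u u' hu => ?_⟩
    rw [Set.mem_ofPred_eq, ← Complex.cpow_add _ _ h0] at hu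
    simp only [pairFun, crossFactor, theta, thetaPos, bigTheta, if_pos hpos]
    have e1 : (x : ℂ) ^ (2 * r - 1) * ((x : ℂ) ^ (2 * a - 1) * (x : ℂ) ^ (2 * (u' - u))) =
        (x : ℂ) ^ (2 * r - 2 + 2 * a + 2 * (u' - u)) := by
      rw [← Complex.cpow_add _ _ h0, ← Complex.cpow_add _ _ h0]
      congr 1; ring
    have e2 : (x : ℂ) * ((x : ℂ) ^ (2 * a - 1) * (x : ℂ) ^ (2 * (u' - u))) =
        (x : ℂ) ^ (2 * a + ((2 : ℝ) : ℂ) * (u' - u)) := by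
      nth_rewrite 1 [← Complex.cpow_one (x : ℂ)]
      rw [← Complex.cpow_add _ _ h0, ← Complex.cpow_add _ _ h0]
      congr 1; push_cast; ring
    have e4 : (x : ℂ) ^ (2 * r) / (x : ℂ) ^ (2 * (u - u' + 1 - a)) =
        (x : ℂ) ^ (2 * r - 2 + 2 * a + 2 * (u' - u)) := by
      rw [← Complex.cpow_sub _ _ h0]
      congr 1; ring
    have e5 : (x : ℂ) ^ (2 * (u - u' + 1 - a)) =
        (x : ℂ) ^ ((2 - 2 * a) + ((-2 : ℝ) : ℂ) * (u' - u)) := by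
      congr 1; push_cast; ring
    have e7 : (x : ℂ) ^ (-2 * u * ((r - 1) / r)) =
        (x : ℂ) ^ (-(1 - a) ^ 2 / r + (1 - a)) * (x : ℂ) ^ (-(u' - u) ^ 2 / r +
          2 * (u' - u) * (1 - a) / r - (u' - u) - 2 * u * ((r - 1) / r)) *
        (x : ℂ) ^ ((u - u' + 1 - a) ^ 2 / r - (u - u' + 1 - a)) := by
      simp only [← Complex.cpow_add _ _ h0]
      congr 1; field_simp; ring
    rw [e1, e2, e4, e5, e7]
    have h3 := hne ((u - u' + 1 - a) ^ 2 / r - (u - u' + 1 - a))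
    have hqq := qPoch_ne_zero_of_norm_lt hq hq
    generalize qPoch ((x : ℂ) ^ (2 * r - 2 + 2 * a + 2 * (u' - u))) _ = A at *
    generalize qPoch ((x : ℂ) ^ (2 * a + ((2 : ℝ) : ℂ) * (u' - u))) _ = B at *
    generalize qPoch ((x : ℂ) ^ ((2 - 2 * a) + ((-2 : ℝ) : ℂ) * (u' - u))) _ = C at *
    generalize qPoch _ _ = D at *
    generalize (x : ℂ) ^ ((u - u' + 1 - a) ^ 2 / r - (u - u' + 1 - a)) = k4 at *
    generalize (x : ℂ) ^ (-(1 - a) ^ 2 / r + (1 - a)) = k1 at *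
    generalize (x : ℂ) ^ (-(u' - u) ^ 2 / r + 2 * (u' - u) * (1 - a) / r - (u' - u) -
      2 * u * ((r - 1) / r)) = k2 at *
    field_simp

theorem exists_sameFactor {x : ℝ} (hx0 : 0 < x) (hx1 : x < 1) {r : ℂ} (hr : r.re ≠ 0) :
    ∃ g : ℂ → ℂ → ℂ, ContinuousOn (fun v : ℂ × ℂ => g v.1 v.2) imagPairs ∧
      AgreeGenerically x
      (fun u u' => (x : ℂ) ^ (4 * u * ((r - 1) / r)) *
        (pairFun x r ((x : ℂ) * (x : ℂ) ^ (2 * (u' - u))) *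
          pairFun x r ((x : ℂ)⁻¹ * (x : ℂ) ^ (2 * (u' - u))))⁻¹ *
          (theta x r (u - u') * theta x r (u' - u - 1))) g := by
  have h0 : (x : ℂ) ≠ 0 := Complex.ofReal_ne_zero.mpr hx0.ne'
  have hr0 : r ≠ 0 := fun h => hr (by simp [h])
  have hne : ∀ b : ℂ, (x : ℂ) ^ b ≠ 0 := fun b => by simp [Complex.cpow_eq_zero_iff, h0]
  have hexp : ∀ f : ℂ × ℂ → ℂ, Continuous f → Continuous fun v => (x : ℂ) ^ f v :=
    fun f hf => Continuous.const_cpow hf (Or.inl h0)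
  have hxa : ∀ a : ℂ, (x : ℂ) * (x : ℂ) ^ a = (x : ℂ) ^ (1 + a) := fun a => by
    rw [Complex.cpow_add _ _ h0, Complex.cpow_one]
  have hxa' : ∀ a : ℂ, (x : ℂ)⁻¹ * (x : ℂ) ^ a = (x : ℂ) ^ (-1 + a) := fun a => by
    rw [Complex.cpow_add _ _ h0, Complex.cpow_neg_one]
  rcases lt_or_gt_of_ne hr with hneg | hpos
  · have hq := norm_cpow_neg_two_mul_lt hx0 hx1 hneg
    have n1 : ¬ 0 < r.re := not_lt.mpr hneg.le
    have hP := fun a b => continuous_qPoch_cpow hx0 hq a b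
    refine ⟨fun u u' => (x : ℂ) ^ (4 * u * ((r - 1) / r) + (u' - u) ^ 2 / r - (u' - u) +
        (u' - u - 1) ^ 2 / r + (u' - u - 1)) * (-(x : ℂ) ^ (2 * (u' - u))) /
      (qPoch ((x : ℂ) ^ (-2 * r + ((-2 : ℝ) : ℂ) * (u' - u))) ((x : ℂ) ^ (-2 * r)) *
       qPoch ((x : ℂ) ^ (-2 * r + ((2 : ℝ) : ℂ) * (u' - u))) ((x : ℂ) ^ (-2 * r)) *
       qPoch ((x : ℂ) ^ (2 - 2 * r + ((-2 : ℝ) : ℂ) * (u' - u))) ((x : ℂ) ^ (-2 * r)) *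
       qPoch ((x : ℂ) ^ (2 - 2 * r + ((2 : ℝ) : ℂ) * (u' - u))) ((x : ℂ) ^ (-2 * r)) *
       qPoch ((x : ℂ) ^ (-2 * r)) ((x : ℂ) ^ (-2 * r)) ^ 2), ?_,
      {w | qPoch ((x : ℂ) ^ (-2 : ℂ) * w) ((x : ℂ) ^ (-2 * r)) = 0} ∪
      (fun w : ℂ => w⁻¹) ⁻¹' {w | qPoch (1 * w) ((x : ℂ) ^ (-2 * r)) = 0},
      (countable_qPoch_zeros hq).union
        ((countable_qPoch_zeros hq).preimage inv_injective), fun u u' hu => ?_⟩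
    · refine ContinuousOn.div ?_ ?_ fun v hv => ?_
      · exact ((hexp _ (by fun_prop)).mul (hexp _ (by fun_prop)).neg).continuousOn
      · exact (((((hP _ _).mul (hP _ _)).mul (hP _ _)).mul (hP _ _)).mul
          continuous_const).continuousOn
      · have h := fun (a : ℂ) (ha : 0 < a.re) b => qPoch_cpow_ne_zero hx0 hx1 hq ha b hv
        refine mul_ne_zero (mul_ne_zero (mul_ne_zero (mul_ne_zero (h _ ?_ _) (h _ ?_ _))
          (h _ ?_ _)) (h _ ?_ _)) (pow_ne_zero _ (qPoch_ne_zero_of_norm_lt hq hq)) <;>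
        simp <;> linarith
    · simp only [Set.mem_union, Set.mem_preimage, Set.mem_ofPred_eq, not_or, one_mul,
        ← Complex.cpow_neg, ← Complex.cpow_add _ _ h0] at hu
      simp only [pairFun, theta, thetaPos, bigTheta, if_neg n1, hxa, hxa',
        ← Complex.cpow_add _ _ h0, ← Complex.cpow_sub _ _ h0]
      have k1 : 1 - 2 * r + (1 + 2 * (u' - u)) = 2 - 2 * r + ((2 : ℝ) : ℂ) * (u' - u) := by
        push_cast; ring
      have k2 : (-1 : ℂ) + (1 + 2 * (u' - u)) = 2 * (u' - u) := by ring
      have k3 : 1 - 2 * r + (-1 + 2 * (u' - u)) = -2 * r + ((2 : ℝ) : ℂ) * (u' - u) := by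
        push_cast; ring
      have k4 : (-1 : ℂ) + (-1 + 2 * (u' - u)) = -2 + 2 * (u' - u) := by ring
      have k5 : 2 * (u - u') = -(2 * (u' - u)) := by ring
      have k6 : 2 * -r - -(2 * (u' - u)) = -2 * r + ((2 : ℝ) : ℂ) * (u' - u) := by
        push_cast; ring
      have k7 : 2 * (u' - u - 1) = -2 + 2 * (u' - u) := by ring
      have k8 : 2 * -r - (-2 + 2 * (u' - u)) = 2 - 2 * r + ((-2 : ℝ) : ℂ) * (u' - u) := by
        push_cast; ring
      have k9 : 2 * -r = -2 * r := by ring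
      rw [k1, k2, k3, k4, k5, k6, k7, k8, k9]
      have m1 := qPoch_eq hq ((x : ℂ) ^ (2 * (u' - u)))
      rw [← Complex.cpow_add _ _ h0, show 2 * (u' - u) + -2 * r =
        -2 * r + ((2 : ℝ) : ℂ) * (u' - u) by push_cast; ring] at m1
      have m2 := qPoch_eq hq ((x : ℂ) ^ (-(2 * (u' - u))))
      rw [← Complex.cpow_add _ _ h0, show -(2 * (u' - u)) + -2 * r =
        -2 * r + ((-2 : ℝ) : ℂ) * (u' - u) by push_cast; ring, Complex.cpow_neg] at m2
      rw [Complex.cpow_neg] at hu ⊢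
      have hu2 := hu.2
      rw [m1, m2]
      rw [m2] at hu2
      obtain ⟨hu3, hu4⟩ := ne_eq _ _ ▸ mul_ne_zero_iff.mp hu2
      have hw := hne (2 * (u' - u))
      have ex : (x : ℂ) ^ (4 * u * ((r - 1) / r) + (u' - u) ^ 2 / r - (u' - u) +
          (u' - u - 1) ^ 2 / r + (u' - u - 1)) *
          (x : ℂ) ^ ((u - u') ^ 2 / -r - (u - u')) *
          (x : ℂ) ^ ((u' - u - 1) ^ 2 / -r - (u' - u - 1)) = (x : ℂ) ^ (4 * u * ((r - 1) / r)) := by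
        simp only [← Complex.cpow_add _ _ h0]
        congr 1; field_simp; ring
      rw [← ex]
      have hz1 := hne ((u - u') ^ 2 / -r - (u - u'))
      have hz2 := hne ((u' - u - 1) ^ 2 / -r - (u' - u - 1))
      have hw' : (x : ℂ) ^ (2 * (u' - u)) - 1 ≠ 0 := by
        intro h
        rw [sub_eq_zero.mp h] at hu3
        simp at hu3
      have hu1 := hu.1
      generalize qPoch ((x : ℂ) ^ (-2 * r + ((-2 : ℝ) : ℂ) * (u' - u))) _ = A1 at *
      generalize qPoch ((x : ℂ) ^ (-2 * r + ((2 : ℝ) : ℂ) * (u' - u))) _ = A2 at *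
      generalize qPoch ((x : ℂ) ^ (2 - 2 * r + ((-2 : ℝ) : ℂ) * (u' - u))) _ = A3 at *
      generalize qPoch ((x : ℂ) ^ (2 - 2 * r + ((2 : ℝ) : ℂ) * (u' - u))) _ = A4 at *
      generalize qPoch ((x : ℂ) ^ (-2 + 2 * (u' - u))) _ = A5 at *
      generalize qPoch _ _ = A6 at *
      generalize (x : ℂ) ^ ((u - u') ^ 2 / -r - (u - u')) = z1 at *
      generalize (x : ℂ) ^ ((u' - u - 1) ^ 2 / -r - (u' - u - 1)) = z2 at *
      generalize (x : ℂ) ^ (4 * u * ((r - 1) / r) + (u' - u) ^ 2 / r - (u' - u) +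
          (u' - u - 1) ^ 2 / r + (u' - u - 1)) = z3 at *
      generalize (x : ℂ) ^ (2 * (u' - u)) = w at *
      have hw3 : 1 - w⁻¹ = (w - 1) / w := by field_simp
      rw [hw3]
      clear m1 m2 hu hu2 ex
      by_cases hA2 : A2 = 0
      · simp [hA2]
      field_simp
      ring
  · have hq := norm_cpow_two_mul_lt hx0 hx1 hpos
    have hP := fun a b => continuous_qPoch_cpow hx0 hq a b
    refine ⟨fun u u' => (x : ℂ) ^ (4 * u * ((r - 1) / r) + (u' - u) ^ 2 / r + (u' - u) +
        (u' - u - 1) ^ 2 / r - (u' - u - 1)) * (1 - (x : ℂ) ^ (-2 + ((2 : ℝ) : ℂ) * (u' - u))) *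
      qPoch ((x : ℂ) ^ (0 + ((-2 : ℝ) : ℂ) * (u' - u))) ((x : ℂ) ^ (2 * r)) *
      qPoch ((x : ℂ) ^ (0 + ((2 : ℝ) : ℂ) * (u' - u))) ((x : ℂ) ^ (2 * r)) *
      qPoch ((x : ℂ) ^ (2 * r + 2 + ((-2 : ℝ) : ℂ) * (u' - u))) ((x : ℂ) ^ (2 * r)) *
      qPoch ((x : ℂ) ^ (2 + ((2 : ℝ) : ℂ) * (u' - u))) ((x : ℂ) ^ (2 * r)) *
      qPoch ((x : ℂ) ^ (2 * r)) ((x : ℂ) ^ (2 * r)) ^ 2, ?_,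
      {w | qPoch ((x : ℂ) ^ (2 * r) * w) ((x : ℂ) ^ (2 * r)) = 0} ∪
      {w | qPoch ((x : ℂ) ^ (2 * r - 2) * w) ((x : ℂ) ^ (2 * r)) = 0},
      (countable_qPoch_zeros hq).union (countable_qPoch_zeros hq), fun u u' hu => ?_⟩
    · exact (((((((hexp _ (by fun_prop)).mul (continuous_const.sub (hexp _ (by fun_prop)))).mul
        (hP _ _)).mul (hP _ _)).mul (hP _ _)).mul (hP _ _)).mul continuous_const).continuousOn
    · simp only [Set.mem_union, Set.mem_ofPred_eq, not_or, ← Complex.cpow_add _ _ h0] at hu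
      simp only [pairFun, theta, thetaPos, bigTheta, if_pos hpos, hxa, hxa',
        ← Complex.cpow_add _ _ h0, ← Complex.cpow_sub _ _ h0]
      have k1 : 2 * r - 1 + (1 + 2 * (u' - u)) = 2 * r + 2 * (u' - u) := by ring
      have k2 : 1 + (1 + 2 * (u' - u)) = 2 + ((2 : ℝ) : ℂ) * (u' - u) := by push_cast; ring
      have k3 : 2 * r - 1 + (-1 + 2 * (u' - u)) = 2 * r - 2 + 2 * (u' - u) := by ring
      have k4 : 1 + (-1 + 2 * (u' - u)) = 0 + ((2 : ℝ) : ℂ) * (u' - u) := by push_cast; ring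
      have k5 : 2 * (u - u') = 0 + ((-2 : ℝ) : ℂ) * (u' - u) := by push_cast; ring
      have k6 : 2 * r - (0 + ((-2 : ℝ) : ℂ) * (u' - u)) = 2 * r + 2 * (u' - u) := by
        push_cast; ring
      have k7 : 2 * (u' - u - 1) = -2 + ((2 : ℝ) : ℂ) * (u' - u) := by push_cast; ring
      have k8 : 2 * r - (-2 + ((2 : ℝ) : ℂ) * (u' - u)) =
        2 * r + 2 + ((-2 : ℝ) : ℂ) * (u' - u) := by push_cast; ring
      rw [k1, k2, k3, k4, k5, k6, k7, k8]
      have m1 := qPoch_eq hq ((x : ℂ) ^ (-2 + ((2 : ℝ) : ℂ) * (u' - u)))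
      rw [← Complex.cpow_add _ _ h0, show -2 + ((2 : ℝ) : ℂ) * (u' - u) + 2 * r =
        2 * r - 2 + 2 * (u' - u) by push_cast; ring] at m1
      rw [m1]
      obtain ⟨hu1, hu2⟩ := hu
      have ex : (x : ℂ) ^ (4 * u * ((r - 1) / r) + (u' - u) ^ 2 / r + (u' - u) +
        (u' - u - 1) ^ 2 / r - (u' - u - 1)) = (x : ℂ) ^ (4 * u * ((r - 1) / r)) *
          (x : ℂ) ^ ((u - u') ^ 2 / r - (u - u')) *
          (x : ℂ) ^ ((u' - u - 1) ^ 2 / r - (u' - u - 1)) := by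
        simp only [← Complex.cpow_add _ _ h0]
        congr 1; field_simp; ring
      rw [ex]
      clear m1 ex
      generalize qPoch ((x : ℂ) ^ (2 * r + 2 * (u' - u))) _ = A1 at *
      generalize qPoch ((x : ℂ) ^ (2 * r - 2 + 2 * (u' - u))) _ = A2 at *
      generalize qPoch ((x : ℂ) ^ (2 + ((2 : ℝ) : ℂ) * (u' - u))) _ = A3 at *
      generalize qPoch ((x : ℂ) ^ (0 + ((2 : ℝ) : ℂ) * (u' - u))) _ = A4 at *
      generalize qPoch ((x : ℂ) ^ (0 + ((-2 : ℝ) : ℂ) * (u' - u))) _ = A5 at *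
      generalize qPoch ((x : ℂ) ^ (2 * r + 2 + ((-2 : ℝ) : ℂ) * (u' - u))) _ = A6 at *
      generalize qPoch _ _ = A7 at *
      generalize (x : ℂ) ^ ((u - u') ^ 2 / r - (u - u')) = z1 at *
      generalize (x : ℂ) ^ ((u' - u - 1) ^ 2 / r - (u' - u - 1)) = z2 at *
      generalize (x : ℂ) ^ (4 * u * ((r - 1) / r)) = z3 at *
      generalize (x : ℂ) ^ (-2 + ((2 : ℝ) : ℂ) * (u' - u)) = w at *
      rw [div_mul_div_comm, inv_div]
      field_simp

/-! ### Products over ordered pairs -/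

/-- The product of `c a b` over all pairs of entries of a list, `a` to the left of `b`. -/
def pairProd {ι : Type*} (c : ι → ι → ℂ) : List ι → ℂ
  | [] => 1
  | a :: L => (L.map (c a)).prod * pairProd c L

theorem pairProd_append {ι : Type*} (c : ι → ι → ℂ) (L M : List ι) :
    pairProd c (L ++ M) = pairProd c L * pairProd c M *
      (L.map fun a => (M.map (c a)).prod).prod := by
  induction L with
  | nil => simp [pairProd]
  | cons a L ih =>
    simp only [List.cons_append, pairProd, List.map_append, List.prod_append, List.map_cons,
      List.prod_cons, ih]
    ring

theorem prod_map_flatMap {ι ι' : Type*} (f : ι' → List ι) (g : ι → ℂ) (L : List ι') :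
    ((L.flatMap f).map g).prod = (L.map fun t => ((f t).map g).prod).prod := by
  induction L with
  | nil => simp
  | cons a L ih => simp [ih]

theorem pairProd_flatMap {ι ι' : Type*} (c : ι → ι → ℂ) (f : ι' → List ι) (L : List ι') :
    pairProd c (L.flatMap f) = (L.map fun t => pairProd c (f t)).prod *
      pairProd (fun t t' => ((f t).map fun a => ((f t').map (c a)).prod).prod) L := by
  induction L with
  | nil => simp [pairProd]
  | cons a L ih =>
    simp only [List.flatMap_cons, pairProd_append, ih, List.map_cons, List.prod_cons, pairProd]
    have : ((f a).map fun b => ((L.flatMap f).map (c b)).prod).prod =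
        (L.map fun t' => ((f a).map fun b => ((f t').map (c b)).prod).prod).prod := by
      simp only [prod_map_flatMap]
      generalize f a = M
      induction M with
      | nil => simp
      | cons b M ihM => simp only [List.map_cons, List.prod_cons, ihM, List.prod_map_mul]
    rw [this]
    ring

theorem pairProd_map {ι ι' : Type*} (c : ι → ι → ℂ) (f : ι' → ι) (L : List ι') :
    pairProd c (L.map f) = pairProd (fun a b => c (f a) (f b)) L := by
  induction L with
  | nil => rfl
  | cons a L ih => simp [pairProd, ih, Function.comp_def]

theorem pairProd_mul {ι : Type*} (c d : ι → ι → ℂ) (L : List ι) :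
    pairProd (fun a b => c a b * d a b) L = pairProd c L * pairProd d L := by
  induction L with
  | nil => simp [pairProd]
  | cons a L ih =>
    simp only [pairProd, ih, List.prod_map_mul]
    ring

theorem prod_map_finRange {n : ℕ} (f : Fin n → ℂ) :
    ((List.finRange n).map f).prod = ∏ i, f i := by
  rw [← List.ofFn_eq_map, List.prod_ofFn]

theorem pairProd_finRange {n : ℕ} (c : Fin n → Fin n → ℂ) :
    pairProd c (List.finRange n) = ∏ i, ∏ j ∈ Finset.Ioi i, c i j := by
  induction n with
  | zero => simp [pairProd]
  | succ n ih =>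
    rw [List.finRange_succ, pairProd, pairProd_map, ih, List.map_map, prod_map_finRange,
      Fin.prod_univ_succ, Fin.prod_Ioi_zero]
    simp only [Fin.prod_Ioi_succ, Function.comp_apply]

theorem pairProd_currentList {N m : ℕ} (c : Fin N × ℂ → Fin N × ℂ → ℂ) (u : Fin N × Fin m → ℂ) :
    pairProd c (currentList u) =
      (∏ t, ∏ i, ∏ j ∈ Finset.Ioi i, c (t, u (t, i)) (t, u (t, j))) *
      ∏ t, ∏ t' ∈ Finset.Ioi t, ∏ i, ∏ j, c (t, u (t, i)) (t', u (t', j)) := by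
  simp only [currentList, pairProd_flatMap, prod_map_finRange, pairProd_finRange, pairProd_map,
    List.map_map, Function.comp_def]

theorem prod_map_currentList {N m : ℕ} (f : Fin N × ℂ → ℂ) (u : Fin N × Fin m → ℂ) :
    ((currentList u).map f).prod = ∏ t, ∏ i, f (t, u (t, i)) := by
  simp only [currentList, prod_map_flatMap, prod_map_finRange, List.map_map, Function.comp_def]

theorem listContraction_eq {N : ℕ} [NeZero N] (x : ℝ) (r s : ℂ) (L : List (Fin N × ℂ)) :
    listContraction x r s L =
      pairProd (fun a b => contraction x r s a.1 b.1 ((x : ℂ) ^ (2 * (b.2 - a.2)))) L := by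
  induction L with
  | nil => rfl
  | cons a L ih => rw [listContraction, pairProd, ih]

/-! ### Zero modes -/

/-- The exponent of `x` in the zero mode factor of `F_j(x^{2u})`, without its constant part. -/
def modeExp {N : ℕ} [NeZero N] (s κ : ℂ) (j : Fin N) (u : ℂ) (p : Fin N → ℂ) : ℂ :=
  2 * u * (κ * pairing (alpha j : Fin N → ℝ) p) + (2 * s / N - 1) * κ *
    (((j : ℂ) + 1) * pairing (epsBar j) p - ((j + 1 : Fin N) : ℕ) * pairing (epsBar (j + 1)) p)

/-- The constant part of the exponent of `x` in the zero mode factor of `F_j`. -/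
def modeConst {N : ℕ} (r s : ℂ) (j : Fin N) : ℂ :=
  if (j : ℕ) + 1 < N then (2 * s / N - 1) * ((j : ℂ) + 1) * ((r - 1) / r)
  else (2 * s - N) * ((r - 1) / (2 * r))

theorem pairing_alpha {N : ℕ} [NeZero N] (j : Fin N) (p : Fin N → ℂ) :
    pairing (alpha j : Fin N → ℝ) p = pairing (epsBar j) p - pairing (epsBar (j + 1)) p := by
  simp [pairing, alpha, sub_mul, Finset.sum_sub_distrib]

theorem pairing_add {N : ℕ} (a : Fin N → ℝ) (p q : Fin N → ℂ) :
    pairing a (p + q) = pairing a p + pairing a q := by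
  simp [pairing, mul_add, Finset.sum_add_distrib]

theorem pairing_smul {N : ℕ} (a : Fin N → ℝ) (c : ℂ) (p : Fin N → ℂ) :
    pairing a (c • p) = c * pairing a p := by
  simp only [pairing, Pi.smul_apply, smul_eq_mul, Finset.mul_sum]
  exact Finset.sum_congr rfl fun i _ => by ring

theorem modeExp_add {N : ℕ} [NeZero N] (s κ : ℂ) (j : Fin N) (u : ℂ) (p q : Fin N → ℂ) :
    modeExp s κ j u (p + q) = modeExp s κ j u p + modeExp s κ j u q := by
  simp only [modeExp, pairing_add]
  ring

theorem modeExp_smul {N : ℕ} [NeZero N] (s κ : ℂ) (j : Fin N) (u c : ℂ) (p : Fin N → ℂ) :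
    modeExp s κ j u (c • p) = c * modeExp s κ j u p := by
  simp only [modeExp, pairing_smul]
  ring

theorem zeroMode_eq {N : ℕ} [NeZero N] {x : ℝ} (hx0 : 0 < x) {r : ℂ} (hr : r ≠ 0) (s κ : ℂ)
    (j : Fin N) (u : ℂ) (p : Fin N → ℂ) :
    zeroMode x r s κ j u p =
      (x : ℂ) ^ (2 * u * ((r - 1) / r) + modeConst r s j + modeExp s κ j u p) := by
  have h0 : (x : ℂ) ≠ 0 := Complex.ofReal_ne_zero.mpr hx0.ne'
  have hN : (N : ℂ) ≠ 0 := by exact_mod_cast NeZero.ne N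
  have hv := val_add_one j
  unfold zeroMode modeConst modeExp
  rw [pairing_alpha]
  by_cases h : (j : ℕ) + 1 < N
  · rw [if_pos h] at hv ⊢
    rw [if_pos h, hv]
    congr 1
    push_cast
    ring
  · rw [if_neg h] at hv ⊢
    rw [if_neg h, hv, ← Complex.cpow_add _ _ h0]
    have : ((j : ℂ) + 1) = N := by
      have hj := j.isLt
      have : (j : ℕ) + 1 = N := by omega
      exact_mod_cast this
    rw [this]
    congr 1
    push_cast
    field_simp
    ring

/-- A weight as a complex vector. -/
def toVec {N : ℕ} (q : weightLattice N) : Fin N → ℂ := fun i => ((q : Fin N → ℝ) i : ℂ)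

theorem toVec_add {N : ℕ} (q q' : weightLattice N) : toVec (q + q') = toVec q + toVec q' := by
  funext i
  simp [toVec]

theorem momentum_sub {N : ℕ} (κ : ℂ) (σ : Sector N) (q : weightLattice N) :
    momentum κ (σ.1, σ.2 - q) = momentum κ σ + κ • toVec q := by
  funext i
  simp [momentum, toVec]
  ring

theorem modeExp_listAlpha {N : ℕ} [NeZero N] {x : ℝ} (hx0 : 0 < x) (s κ : ℂ) (j : Fin N) (u : ℂ)
    (L : List (Fin N × ℂ)) :
    (x : ℂ) ^ (modeExp s κ j u (κ • toVec (listAlpha L))) =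
      (L.map fun b => (x : ℂ) ^ (κ * modeExp s κ j u (toVec (alpha b.1)))).prod := by
  have h0 : (x : ℂ) ≠ 0 := Complex.ofReal_ne_zero.mpr hx0.ne'
  induction L with
  | nil =>
    have : toVec (listAlpha ([] : List (Fin N × ℂ))) = 0 := by
      funext i
      simp [toVec, listAlpha]
    simp [this, modeExp, pairing]
  | cons b L ih =>
    have : listAlpha (b :: L) = alpha b.1 + listAlpha L := by simp [listAlpha]
    rw [this, toVec_add, smul_add, modeExp_add, Complex.cpow_add _ _ h0, ih, modeExp_smul,
      List.map_cons, List.prod_cons]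

theorem listZeroMode_eq {N : ℕ} [NeZero N] {x : ℝ} (hx0 : 0 < x) {r : ℂ} (hr : r ≠ 0) (s κ : ℂ)
    (L : List (Fin N × ℂ)) (σ : Sector N) :
    listZeroMode x r s κ L σ =
      (L.map fun a => zeroMode x r s κ a.1 a.2 (momentum κ σ)).prod *
      pairProd (fun a b => (x : ℂ) ^ (κ * modeExp s κ a.1 a.2 (toVec (alpha b.1)))) L := by
  have h0 : (x : ℂ) ≠ 0 := Complex.ofReal_ne_zero.mpr hx0.ne'
  induction L with
  | nil => simp [listZeroMode, pairProd]
  | cons a L ih =>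
    rw [listZeroMode, ih, List.map_cons, List.prod_cons, pairProd, momentum_sub, zeroMode_eq hx0 hr,
      modeExp_add, ← add_assoc, Complex.cpow_add _ _ h0, modeExp_listAlpha hx0, zeroMode_eq hx0 hr]
    ring

theorem sum_comp_add_one {N : ℕ} [NeZero N] {M : Type*} [AddCommMonoid M] (f : Fin N → M) :
    ∑ t, f (t + 1) = ∑ t, f t :=
  Equiv.sum_comp (Equiv.addRight (1 : Fin N)) f

theorem sum_epsBar (N : ℕ) [NeZero N] : ∑ j : Fin N, epsBar j = 0 := by
  have hN : (N : ℝ) ≠ 0 := by exact_mod_cast NeZero.ne N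
  funext i
  simp [epsBar, Finset.sum_apply, Pi.single_apply, hN]

theorem sum_pairing_epsBar {N : ℕ} [NeZero N] (p : Fin N → ℂ) :
    ∑ j, pairing (epsBar j) p = 0 := by
  have h : ∀ i : Fin N, ∑ j : Fin N, epsBar j i = 0 := fun i => by
    have := congrFun (sum_epsBar N) i
    rwa [Finset.sum_apply] at this
  simp only [pairing]
  rw [Finset.sum_comm]
  refine Finset.sum_eq_zero fun i _ => ?_
  rw [← Finset.sum_mul, ← Complex.ofReal_sum, h]
  simp

theorem sum_modeExp {N : ℕ} [NeZero N] (s κ : ℂ) {m : ℕ} (u : Fin N × Fin m → ℂ)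
    (p : Fin N → ℂ) :
    ∑ t, ∑ i, modeExp s κ t (u (t, i)) p =
      ∑ t, ∑ i, 2 * u (t, i) * (κ * pairing (alpha t : Fin N → ℝ) p) := by
  have h : ∑ t : Fin N, (((t : ℂ) + 1) * pairing (epsBar t) p -
      ((t + 1 : Fin N) : ℕ) * pairing (epsBar (t + 1)) p) = 0 := by
    rw [Finset.sum_sub_distrib, sum_comp_add_one fun t : Fin N => ((t : ℕ) : ℂ) * pairing (epsBar t) p, ← Finset.sum_sub_distrib]
    simp only [add_mul, one_mul, add_sub_cancel_left]
    exact sum_pairing_epsBar p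
  simp only [modeExp, Finset.sum_add_distrib, Finset.sum_const, Finset.card_univ,
    Fintype.card_fin, nsmul_eq_mul, ← Finset.mul_sum]
  simp [h]

theorem pairing_epsBar_alpha {N : ℕ} [NeZero N] (t t' : Fin N) :
    pairing (epsBar t) (toVec (alpha t')) =
      (if t = t' then 1 else 0) - (if t = t' + 1 then 1 else 0) := by
  have hN : (N : ℂ) ≠ 0 := by exact_mod_cast NeZero.ne N
  have h : ∀ i j : Fin N, ∑ k, ((epsBar i k : ℝ) : ℂ) * ((epsBar j k : ℝ) : ℂ) =
      (if i = j then 1 else 0) - 1 / (N : ℂ) := by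
    intro i j
    simp only [epsBar, Pi.sub_apply, Complex.ofReal_sub, sub_mul, mul_sub, Finset.sum_sub_distrib,
      Pi.single_apply]
    have e : ∀ k l : Fin N, (((if k = l then 1 else 0 : ℝ) : ℝ) : ℂ) = if k = l then 1 else 0 :=
      fun k l => by split_ifs <;> simp
    simp only [e]
    simp [hN, eq_comm]
  simp only [pairing, toVec, alpha, Pi.sub_apply, Complex.ofReal_sub, mul_sub,
    Finset.sum_sub_distrib, h]
  ring

theorem sum_alpha (N : ℕ) [NeZero N] : ∑ t : Fin N, alpha t = 0 := by
  apply Subtype.ext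
  rw [AddSubgroup.val_finsetSum]
  simp only [alpha, Finset.sum_sub_distrib]
  rw [sum_comp_add_one fun t : Fin N => epsBar t]
  simp

theorem listAlpha_currentList {N m : ℕ} [NeZero N] (u : Fin N × Fin m → ℂ) :
    listAlpha (currentList u) = 0 := by
  have h : ∀ L : List (Fin N), (((L.flatMap fun t => (List.finRange m).map fun j =>
      (t, u (t, j))).map fun a : Fin N × ℂ => alpha a.1).sum) = m • (L.map alpha).sum := by
    intro L
    induction L with
    | nil => simp
    | cons a L ih => simp [ih, Function.comp_def]
  rw [listAlpha, currentList, h, ← List.ofFn_eq_map, List.sum_ofFn, sum_alpha, smul_zero]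

/-! ### The scalar factor of the integrand -/

theorem lt_add_one_iff_val {N : ℕ} [NeZero N] (t : Fin N) : t < t + 1 ↔ (t : ℕ) + 1 < N := by
  rw [Fin.lt_def, val_add_one]
  split_ifs with h <;> simp [h]

theorem add_one_lt_iff_val {N : ℕ} [NeZero N] (hN : 2 ≤ N) (t : Fin N) :
    t + 1 < t ↔ ¬ (t : ℕ) + 1 < N := by
  rw [Fin.lt_def, val_add_one]
  have := t.isLt
  split_ifs with h
  · simp [h]
  · simp only [h, not_false_iff, iff_true]
    omega

theorem add_one_ne {N : ℕ} [NeZero N] (hN : 2 ≤ N) (t : Fin N) : t + 1 ≠ t := by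
  intro e
  have h1 := lt_add_one_iff_val t
  have h2 := add_one_lt_iff_val hN t
  rw [e] at h1 h2
  simp only [lt_irrefl, false_iff] at h1 h2
  exact h2 h1

theorem prod_neighbours {N : ℕ} [NeZero N] (hN : 2 ≤ N) (f g : Fin N → Fin N → ℂ) :
    ∏ t, ∏ t' ∈ Finset.Ioi t, (if t' = t + 1 then f t t' else 1) *
      (if t = t' + 1 then g t t' else 1) =
    ∏ t : Fin N, if (t : ℕ) + 1 < N then f t (t + 1) else g (t + 1) t := by
  simp only [Finset.prod_mul_distrib]
  have h1 : ∏ t : Fin N, ∏ t' ∈ Finset.Ioi t, (if t' = t + 1 then f t t' else 1) =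
      ∏ t : Fin N, if (t : ℕ) + 1 < N then f t (t + 1) else 1 := by
    refine Finset.prod_congr rfl fun t _ => ?_
    rw [Finset.prod_ite_eq']
    simp only [Finset.mem_Ioi, lt_add_one_iff_val]
  have h2 : ∏ t : Fin N, ∏ t' ∈ Finset.Ioi t, (if t = t' + 1 then g t t' else 1) =
      ∏ t : Fin N, if (t : ℕ) + 1 < N then 1 else g (t + 1) t := by
    rw [Finset.prod_comm' (t' := Finset.univ) (s' := fun t' => Finset.Iio t') (by simp)]
    refine Finset.prod_congr rfl fun t _ => ?_
    rw [Finset.prod_ite_eq']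
    simp only [Finset.mem_Iio, add_one_lt_iff_val hN, ite_not]
  rw [h1, h2, ← Finset.prod_mul_distrib]
  refine Finset.prod_congr rfl fun t _ => ?_
  split_ifs <;> simp

/-- The contraction of two currents together with the factor of the zero modes that depends on
`u`. -/
def pairFactor {N : ℕ} [NeZero N] (x : ℝ) (r s : ℂ) (a b : Fin N × ℂ) : ℂ :=
  (if b.1 = a.1 + 1 then (x : ℂ) ^ (-2 * a.2 * ((r - 1) / r)) *
    pairFun x r ((x : ℂ) ^ (2 * s / N - 1) * (x : ℂ) ^ (2 * (b.2 - a.2))) else 1) *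
  (if a.1 = b.1 + 1 then (x : ℂ) ^ (-2 * a.2 * ((r - 1) / r)) *
    pairFun x r ((x : ℂ) ^ (1 - 2 * s / N) * (x : ℂ) ^ (2 * (b.2 - a.2))) else 1) *
  (if a.1 = b.1 then (x : ℂ) ^ (4 * a.2 * ((r - 1) / r)) *
    (pairFun x r ((x : ℂ) * (x : ℂ) ^ (2 * (b.2 - a.2))) *
      pairFun x r ((x : ℂ)⁻¹ * (x : ℂ) ^ (2 * (b.2 - a.2))))⁻¹ else 1)

theorem contraction_mul_cpow {N : ℕ} [NeZero N] {x : ℝ} (hx0 : 0 < x) {r κ : ℂ}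
    (hκ : κ ^ 2 = (r - 1) / r) (s : ℂ) : ∃ k : Fin N → Fin N → ℂ, ∀ a b : Fin N × ℂ,
      (x : ℂ) ^ (κ * modeExp s κ a.1 a.2 (toVec (alpha b.1))) *
        contraction x r s a.1 b.1 ((x : ℂ) ^ (2 * (b.2 - a.2))) =
      k a.1 b.1 * pairFactor x r s a b := by
  have h0 : (x : ℂ) ≠ 0 := Complex.ofReal_ne_zero.mpr hx0.ne'
  refine ⟨fun i j => (x : ℂ) ^ (κ * modeExp s κ i 0 (toVec (alpha j))), fun a b => ?_⟩
  have h1 : κ * modeExp s κ a.1 a.2 (toVec (alpha b.1)) =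
      κ * modeExp s κ a.1 0 (toVec (alpha b.1)) +
      ((if b.1 = a.1 + 1 then -2 * a.2 * ((r - 1) / r) else 0) +
      (if a.1 = b.1 + 1 then -2 * a.2 * ((r - 1) / r) else 0) +
      (if a.1 = b.1 then 4 * a.2 * ((r - 1) / r) else 0)) := by
    rw [← hκ]
    have he : (a.1 + 1 = b.1) = (b.1 = a.1 + 1) := propext eq_comm
    simp only [modeExp, pairing_alpha, pairing_epsBar_alpha, add_left_inj, he]
    split_ifs <;> ring
  rw [h1, Complex.cpow_add _ _ h0, Complex.cpow_add _ _ h0, Complex.cpow_add _ _ h0, contraction,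
    pairFactor]
  have h2 : ∀ (P : Prop) [Decidable P] (e : ℂ), (x : ℂ) ^ (if P then e else 0) =
      if P then (x : ℂ) ^ e else 1 := fun P _ e => by split_ifs <;> simp
  have h3 : ∀ (P : Prop) [Decidable P] (e f : ℂ), (if P then e * f else 1) =
      (if P then e else 1) * if P then f else 1 := fun P _ e f => by split_ifs <;> simp
  simp only [h2, h3]
  ring

/-- The numerical factor of the integrand before multiplication by `ϑ`. -/
def scalarFactor {N m : ℕ} [NeZero N] (x : ℝ) (r s κ : ℂ) (u : Fin N × Fin m → ℂ)
    (σ : Sector N) : ℂ :=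
  kernel x r s u * (listContraction x r s (currentList u) *
    listZeroMode x r s κ (currentList u) σ)

/-- The part of the zero mode factors that depends on the momentum and on `u`. -/
def planeWave {N m : ℕ} [NeZero N] (x : ℝ) (r κ : ℂ) (u : Fin N × Fin m → ℂ)
    (p : Fin N → ℂ) : ℂ :=
  (x : ℂ) ^ ∑ t, ∑ i, (2 * u (t, i) * ((r - 1) / r) +
    2 * u (t, i) * (κ * pairing (alpha t : Fin N → ℝ) p))

/-- Away from coincidences the numerical factor of the integrand is manifestly cyclic. -/
theorem exists_scalarFactor_eq {N : ℕ} [NeZero N] (hN : 2 ≤ N) {x : ℝ} (hx0 : 0 < x) (hx1 : x < 1)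
    {r κ : ℂ} (hr : r.re ≠ 0) (hκ : κ ^ 2 = (r - 1) / r) (s : ℂ) (m : ℕ) :
    ∃ (C : ℂ) (g : ℂ → ℂ → ℂ) (Z : Set ℂ),
      ContinuousOn (fun v : ℂ × ℂ => g v.1 v.2) imagPairs ∧ Z.Countable ∧
      ∀ (u : Fin N × Fin m → ℂ) (σ : Sector N),
        (∀ a b, a ≠ b → (x : ℂ) ^ (2 * (u b - u a)) ∉ Z) →
        scalarFactor x r s κ u σ = C * planeWave x r κ u (momentum κ σ) *
          (∏ t, ∏ i, ∏ j ∈ Finset.Ioi i, g (u (t, i)) (u (t, j))) *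
          ∏ t, ∏ i, ∏ j, crossFactor x r (s / N) (u (t, i)) (u (t + 1, j)) := by
  have h0 : (x : ℂ) ≠ 0 := Complex.ofReal_ne_zero.mpr hx0.ne'
  have hr0 : r ≠ 0 := fun h => hr (by simp [h])
  obtain ⟨g, hg, Z, hZ, hgZ⟩ := exists_sameFactor hx0 hx1 hr
  obtain ⟨c, Z1, hZ1, hc⟩ := pairFun_div_theta hx0 hx1 hr (s / N)
  obtain ⟨c', Z2, hZ2, hc'⟩ := pairFun_div_theta hx0 hx1 hr (1 - s / N)
  obtain ⟨k, hk⟩ := contraction_mul_cpow (N := N) hx0 hκ s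
  refine ⟨(∏ t : Fin N, ∏ _i : Fin m, (x : ℂ) ^ modeConst r s t) *
    pairProd (fun a b : Fin N × ℂ => k a.1 b.1) (currentList fun _ : Fin N × Fin m => 0) *
    ∏ t : Fin N, ∏ _i : Fin m, ∏ _j : Fin m, if (t : ℕ) + 1 < N then c else c',
    g, Z ∪ (Z1 ∪ Z2), hg, hZ.union (hZ1.union hZ2), fun u σ hu => ?_⟩
  simp only [Set.mem_union, not_or] at hu
  beta_reduce at hc hc'
  have w1 : ((currentList u).map fun a => zeroMode x r s κ a.1 a.2 (momentum κ σ)).prod =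
      (∏ t : Fin N, ∏ _i : Fin m, (x : ℂ) ^ modeConst r s t) *
        planeWave x r κ u (momentum κ σ) := by
    rw [prod_map_currentList, planeWave]
    simp only [zeroMode_eq hx0 hr0]
    simp only [Finset.sum_add_distrib, ← sum_modeExp s κ u]
    simp only [← Finset.sum_add_distrib]
    have hs : ∀ (n : ℕ) (f : Fin n → ℂ), (x : ℂ) ^ (∑ i, f i) = ∏ i, (x : ℂ) ^ f i := by
      intro n f
      induction n with
      | zero => simp
      | succ n ih => rw [Fin.sum_univ_succ, Fin.prod_univ_succ, Complex.cpow_add _ _ h0, ih]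
    simp only [hs, ← Finset.prod_mul_distrib]
    refine Finset.prod_congr rfl fun t _ => Finset.prod_congr rfl fun i _ => ?_
    rw [← Complex.cpow_add _ _ h0]
    congr 1
    ring
  have w2 : pairProd (fun a b : Fin N × ℂ => k a.1 b.1) (currentList u) =
      pairProd (fun a b : Fin N × ℂ => k a.1 b.1)
        (currentList fun _ : Fin N × Fin m => 0) := by
    rw [pairProd_currentList, pairProd_currentList]
  have w3 : listContraction x r s (currentList u) * listZeroMode x r s κ (currentList u) σ =
      (∏ t : Fin N, ∏ _i : Fin m, (x : ℂ) ^ modeConst r s t) *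
        planeWave x r κ u (momentum κ σ) *
      (pairProd (fun a b : Fin N × ℂ => k a.1 b.1) (currentList fun _ : Fin N × Fin m => 0) *
        pairProd (pairFactor x r s) (currentList u)) := by
    rw [← w2, ← w1, ← pairProd_mul]
    simp only [← hk]
    rw [pairProd_mul, listContraction_eq, listZeroMode_eq hx0 hr0]
    ring
  have hne1 := add_one_ne hN
  have w4 : pairProd (pairFactor x r s) (currentList u) =
      (∏ t, ∏ i, ∏ j ∈ Finset.Ioi i, (x : ℂ) ^ (4 * u (t, i) * ((r - 1) / r)) *
        (pairFun x r ((x : ℂ) * (x : ℂ) ^ (2 * (u (t, j) - u (t, i)))) *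
        pairFun x r ((x : ℂ)⁻¹ * (x : ℂ) ^ (2 * (u (t, j) - u (t, i)))))⁻¹) *
      ∏ t : Fin N, if (t : ℕ) + 1 < N then
        ∏ i, ∏ j, (x : ℂ) ^ (-2 * u (t, i) * ((r - 1) / r)) *
          pairFun x r ((x : ℂ) ^ (2 * s / N - 1) * (x : ℂ) ^ (2 * (u (t + 1, j) - u (t, i))))
      else ∏ i, ∏ j, (x : ℂ) ^ (-2 * u (t + 1, i) * ((r - 1) / r)) *
          pairFun x r ((x : ℂ) ^ (1 - 2 * s / N) * (x : ℂ) ^ (2 * (u (t, j) - u (t + 1, i)))) := by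
    rw [pairProd_currentList]
    congr 1
    · simp [pairFactor, (hne1 _).symm]
    · rw [← prod_neighbours hN (fun t t' => ∏ i, ∏ j, (x : ℂ) ^ (-2 * u (t, i) * ((r - 1) / r)) *
          pairFun x r ((x : ℂ) ^ (2 * s / N - 1) * (x : ℂ) ^ (2 * (u (t', j) - u (t, i)))))
          (fun t t' => ∏ i, ∏ j, (x : ℂ) ^ (-2 * u (t, i) * ((r - 1) / r)) *
          pairFun x r ((x : ℂ) ^ (1 - 2 * s / N) * (x : ℂ) ^ (2 * (u (t', j) - u (t, i)))))]
      refine Finset.prod_congr rfl fun t _ => Finset.prod_congr rfl fun t' ht' => ?_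
      have htt : t ≠ t' := (Finset.mem_Ioi.mp ht').ne
      simp only [pairFactor, if_neg htt, mul_one, Finset.prod_mul_distrib]
      congr 1 <;> split_ifs <;> simp [Finset.prod_mul_distrib]
  rw [scalarFactor, w3, w4, kernel]
  have w5 : (∏ t, ∏ i, ∏ j ∈ Finset.Ioi i, (x : ℂ) ^ (4 * u (t, i) * ((r - 1) / r)) *
        (pairFun x r ((x : ℂ) * (x : ℂ) ^ (2 * (u (t, j) - u (t, i)))) *
        pairFun x r ((x : ℂ)⁻¹ * (x : ℂ) ^ (2 * (u (t, j) - u (t, i)))))⁻¹) *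
      (∏ t : Fin N, ∏ i : Fin m, ∏ j ∈ Finset.Ioi i,
        theta x r (u (t, i) - u (t, j)) * theta x r (u (t, j) - u (t, i) - 1)) =
      ∏ t, ∏ i, ∏ j ∈ Finset.Ioi i, g (u (t, i)) (u (t, j)) := by
    simp only [← Finset.prod_mul_distrib]
    refine Finset.prod_congr rfl fun t _ => Finset.prod_congr rfl fun i _ =>
      Finset.prod_congr rfl fun j hj => ?_
    exact hgZ _ _ (hu (t, i) (t, j) (by simp [(Finset.mem_Ioi.mp hj).ne])).1
  have w6 : (∏ t : Fin N, if (t : ℕ) + 1 < N then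
        ∏ i, ∏ j, (x : ℂ) ^ (-2 * u (t, i) * ((r - 1) / r)) *
          pairFun x r ((x : ℂ) ^ (2 * s / N - 1) * (x : ℂ) ^ (2 * (u (t + 1, j) - u (t, i))))
      else ∏ i, ∏ j, (x : ℂ) ^ (-2 * u (t + 1, i) * ((r - 1) / r)) *
          pairFun x r ((x : ℂ) ^ (1 - 2 * s / N) * (x : ℂ) ^ (2 * (u (t, j) - u (t + 1, i))))) /
      (∏ t : Fin N, ∏ i : Fin m, ∏ j : Fin m,
        if (t : ℕ) + 1 < N then theta x r (u (t, i) - u (t + 1, j) + 1 - s / N)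
        else theta x r (u (t + 1, i) - u (t, j) + s / N)) =
      (∏ t : Fin N, ∏ _i : Fin m, ∏ _j : Fin m, if (t : ℕ) + 1 < N then c else c') *
      ∏ t, ∏ i, ∏ j, crossFactor x r (s / N) (u (t, i)) (u (t + 1, j)) := by
    rw [← Finset.prod_div_distrib, ← Finset.prod_mul_distrib]
    refine Finset.prod_congr rfl fun t _ => ?_
    have hpair : ∀ i j : Fin m, ((t, i) : Fin N × Fin m) ≠ (t + 1, j) := fun i j e =>
      hne1 t (Prod.ext_iff.mp e).1.symm
    split_ifs with ht
    · simp only [← Finset.prod_div_distrib, ← Finset.prod_mul_distrib]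
      refine Finset.prod_congr rfl fun i _ => Finset.prod_congr rfl fun j _ => ?_
      rw [← hc _ _ (hu _ _ (hpair i j)).2.1, mul_div_assoc 2 s]
    · rw [Finset.prod_comm (f := fun i j => crossFactor x r (s / N) (u (t, i)) (u (t + 1, j)))]
      simp only [← Finset.prod_div_distrib, ← Finset.prod_mul_distrib]
      refine Finset.prod_congr rfl fun i _ => Finset.prod_congr rfl fun j _ => ?_
      rw [← crossFactor_swap x hr0, ← hc' _ _ (hu _ _ (hpair j i).symm).2.2]
      congr 4 <;> ring_nf
  rw [← w5, mul_assoc _ _ (∏ t, ∏ i, ∏ j, crossFactor x r (s / N) (u (t, i)) (u (t + 1, j)))]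
  rw [div_eq_mul_inv] at w6 ⊢
  linear_combination ((∏ t : Fin N, ∏ _i : Fin m, (x : ℂ) ^ modeConst r s t) *
    planeWave x r κ u (momentum κ σ)) *
    pairProd (fun a b : Fin N × ℂ => k a.1 b.1) (currentList fun _ : Fin N × Fin m => 0) *
    ((∏ t, ∏ i, ∏ j ∈ Finset.Ioi i, (x : ℂ) ^ (4 * u (t, i) * ((r - 1) / r)) *
        (pairFun x r ((x : ℂ) * (x : ℂ) ^ (2 * (u (t, j) - u (t, i)))) *
        pairFun x r ((x : ℂ)⁻¹ * (x : ℂ) ^ (2 * (u (t, j) - u (t, i)))))⁻¹) *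
      (∏ t : Fin N, ∏ i : Fin m, ∏ j ∈ Finset.Ioi i,
        theta x r (u (t, i) - u (t, j)) * theta x r (u (t, j) - u (t, i) - 1))) * w6

/-! ### Covariance under the diagram automorphism -/

theorem coeff_etaSeries {N : ℕ} [NeZero N] (x : ℝ) (s : ℂ) (φ : OscSeries N) (b : Osc N →₀ ℕ) :
    MvPowerSeries.coeff b (etaSeries x s φ) =
      ((b.equivMapDomain (oscRot N).symm).prod fun v n => etaScalar x s v ^ n) *
        MvPowerSeries.coeff (b.equivMapDomain (oscRot N).symm) φ := rfl

theorem etaSeries_mul {N : ℕ} [NeZero N] (x : ℝ) (s : ℂ) (φ χ : OscSeries N) :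
    etaSeries x s (φ * χ) = etaSeries x s φ * etaSeries x s χ := by
  classical
  have hadd : ∀ (e : Osc N ≃ Osc N) (p q : Osc N →₀ ℕ),
      (p + q).equivMapDomain e = p.equivMapDomain e + q.equivMapDomain e := fun e p q => by
    ext v
    simp
  ext b
  rw [coeff_etaSeries, MvPowerSeries.coeff_mul, MvPowerSeries.coeff_mul, Finset.mul_sum]
  refine Finset.sum_nbij' (fun p => (p.1.equivMapDomain (oscRot N), p.2.equivMapDomain (oscRot N)))
    (fun p => (p.1.equivMapDomain (oscRot N).symm, p.2.equivMapDomain (oscRot N).symm))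
    ?_ ?_ ?_ ?_ ?_
  · intro p hp
    rw [Finset.HasAntidiagonal.mem_antidiagonal] at hp ⊢
    rw [← hadd, hp]
    ext v
    simp
  · intro p hp
    rw [Finset.HasAntidiagonal.mem_antidiagonal] at hp ⊢
    rw [← hadd, hp]
  · intro p _
    ext v <;> simp
  · intro p _
    ext v <;> simp
  · intro p hp
    rw [Finset.HasAntidiagonal.mem_antidiagonal] at hp
    have h : ∀ q : Osc N →₀ ℕ,
        (q.equivMapDomain (oscRot N)).equivMapDomain (oscRot N).symm = q := fun q => by
      ext v
      simp
    rw [coeff_etaSeries, coeff_etaSeries, h, h, ← hp,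
      Finsupp.prod_add_index' (fun _ => pow_zero _) fun _ _ _ => pow_add _ _ _]
    ring

theorem etaSeries_expSeries {N : ℕ} [NeZero N] (x : ℝ) (s : ℂ) (A A' : Osc N → ℂ)
    (h : ∀ v, A' (oscRot N v) = etaScalar x s v * A v) :
    etaSeries x s (expSeries A) = expSeries A' := by
  ext b
  rw [coeff_etaSeries, expSeries_coeff, expSeries_coeff, Finsupp.equivMapDomain_eq_mapDomain,
    Finsupp.prod_mapDomain_index_inj (oscRot N).symm.injective,
    Finsupp.prod_mapDomain_index_inj (oscRot N).symm.injective, ← Finsupp.prod_mul]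
  refine Finsupp.prod_congr fun v _ => ?_
  have := h ((oscRot N).symm v)
  rw [Equiv.apply_symm_apply] at this
  rw [this, mul_pow, mul_div_assoc]

theorem etaPoly_translate {N : ℕ} [NeZero N] {x : ℝ} (s : ℂ) (hx0 : 0 < x) (D D' : Osc N → ℂ)
    (h : ∀ v, etaScalar x s v * D' (oscRot N v) = D v) (f : OscPoly N) :
    etaPoly x s hx0 (translate D f) = translate D' (etaPoly x s hx0 f) := by
  have : (etaPoly x s hx0).toAlgHom.comp (translate D) =
      (translate D').comp (etaPoly x s hx0).toAlgHom := by
    ext1 v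
    have hX : ∀ (D : Osc N → ℂ) w, translate D (MvPolynomial.X w) =
        MvPolynomial.X w + MvPolynomial.C (D w) := fun D w => by simp [translate]
    have hC : ∀ a, translate D' (MvPolynomial.C a) = MvPolynomial.C a := fun a => by
      simp [translate]
    simp only [AlgHom.comp_apply, AlgEquiv.coe_toAlgHom, hX, map_add, etaPoly_X, etaPoly_C,
      map_mul, hC, mul_add, ← MvPolynomial.C_mul, h]
  exact DFunLike.congr_fun this f

theorem etaSeries_normalExp {N : ℕ} [NeZero N] {x : ℝ} (s : ℂ) (hx0 : 0 < x)
    (A A' D D' : Osc N → ℂ) (hA : ∀ v, A' (oscRot N v) = etaScalar x s v * A v)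
    (hD : ∀ v, etaScalar x s v * D' (oscRot N v) = D v) (f : OscPoly N) :
    etaSeries x s (normalExp A D f) = normalExp A' D' (etaPoly x s hx0 f) := by
  rw [normalExp_apply, normalExp_apply, etaSeries_mul, etaSeries_expSeries x s A A' hA,
    etaSeries_coe x s hx0, etaPoly_translate s hx0 D D' hD]

/-- The number whose `m`-th power is the `c` in `η(β_{-m}^j) = c β_{-m}^{j+1}`. -/
def etaBase {N : ℕ} (x : ℝ) (s : ℂ) (j : Fin N) : ℂ :=
  if (j : ℕ) + 1 < N then (x : ℂ) ^ (2 * s / N) else (x : ℂ) ^ (-(2 * s / N) * ((N : ℂ) - 1))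

theorem etaScalar_eq {N : ℕ} (x : ℝ) (s : ℂ) (v : Osc N) :
    etaScalar x s v = etaBase x s v.1 ^ (v.2 : ℕ) := by
  unfold etaScalar etaBase
  split_ifs <;> rw [← Complex.cpow_mul_nat]

theorem etaBase_ne_zero {N : ℕ} {x : ℝ} (hx0 : 0 < x) (s : ℂ) (j : Fin N) :
    etaBase x s j ≠ 0 := by
  have h0 : (x : ℂ) ≠ 0 := Complex.ofReal_ne_zero.mpr hx0.ne'
  unfold etaBase
  split_ifs <;> simp [Complex.cpow_eq_zero_iff, h0]

theorem etaBase_mul_bBase {N : ℕ} [NeZero N] {x : ℝ} (hx0 : 0 < x) (s : ℂ) (j : Fin N) :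
    etaBase x s j * bBase x s (j + 1) = bBase x s j := by
  have h0 : (x : ℂ) ≠ 0 := Complex.ofReal_ne_zero.mpr hx0.ne'
  have hN : (N : ℂ) ≠ 0 := by exact_mod_cast NeZero.ne N
  rw [bBase_succ hx0, bBase', etaBase]
  by_cases h : (j : ℕ) + 1 < N
  · rw [if_pos h, if_pos h, ← Complex.cpow_add _ _ h0, ← Complex.cpow_add _ _ h0, bBase]
    congr 1
    ring
  · rw [if_neg h, if_neg h, one_mul, ← Complex.cpow_add _ _ h0, bBase_last x s j h]
    congr 1
    field_simp
    ring

theorem etaBase_mul_bBase' {N : ℕ} [NeZero N] (hN : 2 ≤ N) {x : ℝ} (hx0 : 0 < x) (s : ℂ)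
    (j : Fin N) : etaBase x s (j + 1) * bBase' x s (j + 1) = bBase' x s j := by
  have h0 : (x : ℂ) ≠ 0 := Complex.ofReal_ne_zero.mpr hx0.ne'
  have hj := j.isLt
  have hv := val_add_one j
  have hb := bBase_succ hx0 s j
  by_cases h : ((j + 1 : Fin N) : ℕ) + 1 < N
  · rw [etaBase, if_pos h, bBase', if_pos h]
    rw [bBase] at hb
    rw [hb, mul_left_comm, ← Complex.cpow_add _ _ h0]
    simp
  · rw [etaBase, if_neg h, bBase', if_neg h, mul_one, bBase']
    split_ifs at hv with h1
    · rw [if_pos h1]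
      have : ((j : ℂ) + 1) = (N : ℂ) - 1 := by
        rw [eq_sub_iff_add_eq]
        have : (j : ℕ) + 1 + 1 = N := by omega
        exact_mod_cast this
      rw [this]
    · omega

theorem creation_add_one {N : ℕ} [NeZero N] (hN : 2 ≤ N) {x : ℝ} (hx0 : 0 < x) (s : ℂ) (j : Fin N)
    (u : ℂ) (v : Osc N) :
    creation x s (j + 1) u (oscRot N v) = etaScalar x s v * creation x s j u v := by
  obtain ⟨i, m⟩ := v
  have hr : oscRot N (i, m) = (i + 1, m) := rfl
  simp only [hr, creation, etaScalar_eq, bCoeff_eq, zpow_neg, zpow_natCast, add_left_inj]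
  have h : (if i = j then (bBase x s (j + 1) ^ (m : ℕ))⁻¹ else 0) -
      (if i = j + 1 then (bBase' x s (j + 1) ^ (m : ℕ))⁻¹ else 0) =
      etaBase x s i ^ (m : ℕ) * ((if i = j then (bBase x s j ^ (m : ℕ))⁻¹ else 0) -
      (if i = j + 1 then (bBase' x s j ^ (m : ℕ))⁻¹ else 0)) := by
    rw [mul_sub]
    have he := etaBase_ne_zero hx0 s i
    congr 1
    · split_ifs with h
      · subst h
        rw [← etaBase_mul_bBase hx0 s i, mul_pow, mul_inv, mul_inv_cancel_left₀ (pow_ne_zero _ he)]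
      · simp
    · split_ifs with h
      · subst h
        rw [← etaBase_mul_bBase' hN hx0 s j, mul_pow, mul_inv,
          mul_inv_cancel_left₀ (pow_ne_zero _ he)]
      · simp
  rw [h]
  ring

theorem annihilation_add_one {N : ℕ} [NeZero N] (hN : 2 ≤ N) {x : ℝ} (hx0 : 0 < x) (hx1 : x < 1)
    (r : ℂ) {s : ℂ} (hs : 0 < s.re) (j : Fin N) (u : ℂ) (v : Osc N) :
    etaScalar x s v * annihilation x r s (j + 1) u (oscRot N v) = annihilation x r s j u v := by
  obtain ⟨i, m⟩ := v
  have hr : oscRot N (i, m) = (i + 1, m) := rfl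
  have hq : qnum x (s * (((m : ℕ) : ℤ) : ℂ)) ≠ 0 := by exact_mod_cast qnum_ne_zero hx0 hx1 hs m
  simp only [hr, annihilation]
  rw [sum_bCoeff_betaComm hN hx0 hx1 r s _ hq, sum_bCoeff_betaComm hN hx0 hx1 r s _ hq]
  simp only [etaScalar_eq, zpow_natCast, add_left_inj]
  have h : etaBase x s i ^ (m : ℕ) *
      ((if i = j then (x : ℂ) ^ (m : ℕ) * bBase x s (j + 1) ^ (m : ℕ) else 0) -
      (if i = j + 1 then ((x : ℂ) ^ (m : ℕ))⁻¹ * bBase' x s (j + 1) ^ (m : ℕ) else 0)) =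
      (if i = j then (x : ℂ) ^ (m : ℕ) * bBase x s j ^ (m : ℕ) else 0) -
      (if i = j + 1 then ((x : ℂ) ^ (m : ℕ))⁻¹ * bBase' x s j ^ (m : ℕ) else 0) := by
    rw [mul_sub]
    congr 1
    · split_ifs with h
      · subst h
        rw [← etaBase_mul_bBase hx0 s i, mul_pow]
        ring
      · simp
    · split_ifs with h
      · subst h
        rw [← etaBase_mul_bBase' hN hx0 s j, mul_pow]
        ring
      · simp
  rw [← h]
  ring

theorem pairing_epsBar_etaVec {N : ℕ} [NeZero N] (t : Fin N) (p : Fin N → ℂ) :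
    pairing (epsBar (t + 1)) (etaVec N ℂ p) = pairing (epsBar t) p := by
  simp only [pairing]
  rw [← sum_comp_add_one]
  refine Finset.sum_congr rfl fun i _ => ?_
  rw [← etaVec_epsBar]
  simp [etaVec]

theorem pairing_alpha_etaVec {N : ℕ} [NeZero N] (t : Fin N) (p : Fin N → ℂ) :
    pairing (alpha (t + 1) : Fin N → ℝ) (etaVec N ℂ p) = pairing (alpha t : Fin N → ℝ) p := by
  rw [pairing_alpha, pairing_alpha, pairing_epsBar_etaVec, pairing_epsBar_etaVec]

/-! ### The integrand -/

theorem thetaOp_apply {N : ℕ} (κ : ℂ) (ϑ : (Fin N → ℂ) → (Fin N → ℂ) → ℂ) (u : Fin N → ℂ)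
    (ψ : Fock N) (σ : Sector N) : thetaOp κ ϑ u ψ σ = ϑ u (momentum κ σ) • ψ σ := by
  classical
  induction ψ using Finsupp.induction_linear with
  | zero => simp
  | add f g hf hg => rw [map_add, Finsupp.add_apply, hf, hg, Finsupp.add_apply, smul_add]
  | single a b =>
    by_cases h : a = σ
    · subst h
      simp [thetaOp]
    · simp [thetaOp, h]

theorem sum_map_currentList {N m : ℕ} {M : Type*} [AddCommMonoid M] (f : Fin N × ℂ → M)
    (u : Fin N × Fin m → ℂ) : ((currentList u).map f).sum = ∑ t, ∑ i, f (t, u (t, i)) := by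
  have h : ∀ L : List (Fin N), ((L.flatMap fun t => (List.finRange m).map fun j =>
      (t, u (t, j))).map f).sum = (L.map fun t => ∑ i, f (t, u (t, i))).sum := by
    intro L
    induction L with
    | nil => simp
    | cons a L ih =>
      rw [List.flatMap_cons, List.map_append, List.sum_append, ih, List.map_cons, List.sum_cons,
        List.map_map, ← List.ofFn_eq_map, List.sum_ofFn]
      rfl
  rw [currentList, h, ← List.ofFn_eq_map, List.sum_ofFn]

theorem integrand_apply {N m : ℕ} [NeZero N] (x : ℝ) (r s κ : ℂ)
    (ϑ : (Fin N → ℂ) → (Fin N → ℂ) → ℂ) (u : Fin N × Fin m → ℂ) (ψ : Fock N) (σ : Sector N) :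
    integrand x r s κ ϑ u ψ σ =
      (scalarFactor x r s κ u σ * ϑ (fun t => ∑ j, u (t, j)) (momentum κ σ)) •
        normalExp (∑ t, ∑ i, creation x s t (u (t, i)))
          (∑ t, ∑ i, annihilation x r s t (u (t, i))) (ψ σ) := by
  simp only [integrand, LinearMap.smul_apply, LinearMap.comp_apply, Pi.smul_apply, currentProd,
    LinearMap.coe_mk, AddHom.coe_mk, listAlpha_currentList, add_zero, thetaOp_apply, map_smul,
    smul_smul, sum_map_currentList, scalarFactor, Prod.mk.eta]
  congr 1
  ring

/-- The relabelling `u^{(t)} ↦ u^{(t-1)}`. -/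
def rotate {N m : ℕ} [NeZero N] {R : Type*} (u : Fin N × Fin m → R) : Fin N × Fin m → R :=
  fun a => u (a.1 - 1, a.2)

theorem etaHat_integrand {N : ℕ} [NeZero N] (hN : 2 ≤ N) {x : ℝ} (hx0 : 0 < x) (hx1 : x < 1)
    {r κ : ℂ} (hr : r.re ≠ 0) (hκ : κ ^ 2 = (r - 1) / r) {s : ℂ} (hs : 0 < s.re)
    {ϑ : (Fin N → ℂ) → (Fin N → ℂ) → ℂ} (hϑ : IsTheta x r κ ϑ) (m : ℕ) :
    ∃ Z : Set ℂ, Z.Countable ∧ ∀ u : Fin N × Fin m → ℂ,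
      (∀ a b, a ≠ b → (x : ℂ) ^ (2 * (u b - u a)) ∉ Z) → ∀ (ψ : Fock N) (σ : Sector N),
        etaHat x s (integrand x r s κ ϑ u ((eta x s hx0).symm ψ)) σ =
          integrand x r s κ ϑ (rotate u) ψ σ := by
  obtain ⟨C, g, Z, -, hZ, h⟩ := exists_scalarFactor_eq hN hx0 hx1 hr hκ s m
  refine ⟨Z, hZ, fun u hu ψ σ => ?_⟩
  obtain ⟨σ, rfl⟩ := (etaSector N).surjective σ
  have hrot : ∀ a b, a ≠ b → (x : ℂ) ^ (2 * (rotate u b - rotate u a)) ∉ Z := by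
    intro a b hab
    refine hu _ _ fun e => hab ?_
    obtain ⟨e1, e2⟩ := Prod.ext_iff.mp e
    exact Prod.ext (sub_left_injective e1) e2
  have h1 : ∀ (t : Fin N) (i : Fin m), rotate u (t + 1, i) = u (t, i) := fun t i => by
    simp [rotate]
  have prod_comp_add_one : ∀ f : Fin N → ℂ, ∏ t, f (t + 1) = ∏ t, f t := fun f =>
    Equiv.prod_comp (Equiv.addRight (1 : Fin N)) f
  have hS : scalarFactor x r s κ (rotate u) (etaSector N σ) = scalarFactor x r s κ u σ := by
    rw [h _ _ hu, h _ _ hrot, momentum_etaSector]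
    congr 1
    · congr 1
      · congr 1
        simp only [planeWave]
        rw [← sum_comp_add_one]
        simp only [h1, pairing_alpha_etaVec]
      · rw [← prod_comp_add_one]
        simp only [h1]
    · rw [← prod_comp_add_one]
      simp only [h1]
  have hT : ϑ (fun t => ∑ j, rotate u (t, j)) (momentum κ (etaSector N σ)) =
      ϑ (fun t => ∑ j, u (t, j)) (momentum κ σ) := by
    rw [momentum_etaSector, hϑ.eta_eq (fun t => ∑ j, u (t, j))]
    rfl
  have he : (eta x s hx0).symm ψ σ = (etaPoly x s hx0).symm (ψ (etaSector N σ)) := rfl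
  change etaSeries x s (integrand x r s κ ϑ u ((eta x s hx0).symm ψ)
    ((etaSector N).symm (etaSector N σ))) = _
  rw [Equiv.symm_apply_apply, integrand_apply, integrand_apply, hS, hT, map_smul, he]
  congr 1
  rw [etaSeries_normalExp s hx0 _ (∑ t, ∑ i, creation x s t (rotate u (t, i))) _
    (∑ t, ∑ i, annihilation x r s t (rotate u (t, i)))]
  · rw [AlgEquiv.apply_symm_apply]
  · intro v
    rw [← sum_comp_add_one]
    simp only [h1, Finset.sum_apply, creation_add_one hN hx0, Finset.mul_sum]
  · intro v
    rw [← sum_comp_add_one]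
    simp only [h1, Finset.sum_apply, ← annihilation_add_one hN hx0 hx1 r hs _ _ v, Finset.mul_sum]

/-! ### The contour -/

theorem volume_diff_eq {ι : Type*} [Fintype ι] {a b : ι} (hab : a ≠ b) (t : ℝ) :
    MeasureTheory.volume {θ : ι → ℝ | θ b - θ a = t} = 0 := by
  classical
  have h0 : MeasureTheory.volume {θ : ι → ℝ | θ b - θ a = 0} = 0 := by
    refine MeasureTheory.Measure.addHaar_submodule MeasureTheory.volume
      (LinearMap.ker (LinearMap.proj (R := ℝ) (φ := fun _ : ι => ℝ) b - LinearMap.proj a))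
      fun h => ?_
    have h1 : Pi.single b (1 : ℝ) ∈ LinearMap.ker
        (LinearMap.proj (R := ℝ) (φ := fun _ : ι => ℝ) b - LinearMap.proj a) := by
      rw [h]
      trivial
    simp [hab] at h1
  rw [← h0, ← MeasureTheory.measure_preimage_add_right MeasureTheory.volume (Pi.single b t)]
  congr 1
  ext θ
  simp [hab, add_sub_right_comm, sub_eq_zero]

theorem countable_exp_preimage {Z : Set ℂ} (hZ : Z.Countable) :
    {t : ℝ | Complex.exp (2 * Real.pi * Complex.I * t) ∈ Z}.Countable := by
  have h : ∀ z : ℂ, {t : ℝ | Complex.exp (2 * Real.pi * Complex.I * t) = z}.Countable := by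
    intro z
    rcases Set.eq_empty_or_nonempty {t : ℝ | Complex.exp (2 * Real.pi * Complex.I * t) = z} with
      h | ⟨t0, ht0⟩
    · rw [h]
      exact Set.countable_empty
    · refine (Set.countable_range fun n : ℤ => t0 + n).mono fun t ht => ?_
      have ht' : Complex.exp (2 * Real.pi * Complex.I * t) =
        Complex.exp (2 * Real.pi * Complex.I * t0) := Eq.trans ht (Eq.symm ht0)
      obtain ⟨n, hn⟩ := Complex.exp_eq_exp_iff_exists_int.mp ht'
      refine ⟨n, ?_⟩
      have h2 : (2 * Real.pi * Complex.I : ℂ) ≠ 0 := Complex.two_pi_I_ne_zero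
      have h3 : (t : ℂ) = ((t0 + n : ℝ) : ℂ) := by
        apply mul_left_cancel₀ h2
        rw [hn]
        push_cast
        ring
      exact (Complex.ofReal_injective h3).symm
  refine (hZ.biUnion fun z _ => h z).mono fun t ht => ?_
  exact Set.mem_biUnion ht rfl

theorem cpow_tau {x : ℝ} (hx0 : 0 < x) (hx1 : x < 1) (t : ℂ) :
    (x : ℂ) ^ (2 * (t * tau x)) = Complex.exp (2 * Real.pi * Complex.I * t) := by
  have h0 : (x : ℂ) ≠ 0 := Complex.ofReal_ne_zero.mpr hx0.ne'
  have hl : (Real.log x : ℂ) ≠ 0 := by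
    exact_mod_cast (Real.log_neg hx0 hx1).ne
  rw [Complex.cpow_def_of_ne_zero h0, tau, ← Complex.ofReal_log hx0.le]
  congr 1
  field_simp

theorem ae_contourPoint_generic {N m : ℕ} {x : ℝ} (hx0 : 0 < x) (hx1 : x < 1) {Z : Set ℂ}
    (hZ : Z.Countable) : ∀ᵐ θ : Fin N × Fin m → ℝ, ∀ a b, a ≠ b →
      (x : ℂ) ^ (2 * (contourPoint x θ b - contourPoint x θ a)) ∉ Z := by
  rw [MeasureTheory.ae_all_iff]
  intro a
  rw [MeasureTheory.ae_all_iff]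
  intro b
  by_cases hab : a = b
  · simp [hab]
  · have h : ∀ᵐ θ : Fin N × Fin m → ℝ, ∀ t ∈ {t : ℝ | Complex.exp (2 * Real.pi * Complex.I * t) ∈ Z},
        θ b - θ a ≠ t := by
      rw [MeasureTheory.ae_ball_iff (countable_exp_preimage hZ)]
      intro t _
      rw [MeasureTheory.ae_iff]
      simpa using volume_diff_eq hab t
    filter_upwards [h] with θ hθ _ hmem
    refine hθ (θ b - θ a) ?_ rfl
    simp only [contourPoint, ← sub_mul] at hmem
    rw [cpow_tau hx0 hx1] at hmem
    simpa using hmem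

theorem contourPoint_re {N m : ℕ} (x : ℝ) (θ : Fin N × Fin m → ℝ) (a : Fin N × Fin m) :
    (contourPoint x θ a).re = 0 := by
  have : contourPoint x θ a = ((θ a * Real.pi / Real.log x : ℝ) : ℂ) * Complex.I := by
    simp only [contourPoint, tau]
    push_cast
    ring
  rw [this, Complex.re_ofReal_mul, Complex.I_re, mul_zero]

theorem continuous_contourPoint {N m : ℕ} (x : ℝ) (a : Fin N × Fin m) :
    Continuous fun θ : Fin N × Fin m → ℝ => contourPoint x θ a := by
  unfold contourPoint
  fun_prop

theorem continuous_coeff_translate {N : ℕ} {Y : Type*} [TopologicalSpace Y] {D : Y → Osc N → ℂ}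
    (hD : ∀ v, Continuous fun y => D y v) (f : OscPoly N) (b : Osc N →₀ ℕ) :
    Continuous fun y => MvPolynomial.coeff b (translate (D y) f) := by
  classical
  induction f using MvPolynomial.induction_on generalizing b with
  | C a =>
    have hC : ∀ D : Osc N → ℂ, translate D (MvPolynomial.C a) = MvPolynomial.C a := fun D => by
      simp [translate]
    simp only [hC]
    exact continuous_const
  | add p q hp hq =>
    simp only [map_add, MvPolynomial.coeff_add]
    exact (hp b).add (hq b)
  | mul_X p v hp =>
    have hX : ∀ D : Osc N → ℂ, translate D (MvPolynomial.X v) =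
        MvPolynomial.X v + MvPolynomial.C (D v) := fun D => by simp [translate]
    simp only [map_mul, hX, mul_add, MvPolynomial.coeff_add,
      mul_comm _ (MvPolynomial.C _), MvPolynomial.coeff_C_mul, MvPolynomial.coeff_mul_X']
    refine Continuous.add ?_ ((hD v).mul (hp b))
    split_ifs
    · exact hp _
    · exact continuous_const

theorem continuous_coeff_normalExp {N : ℕ} {Y : Type*} [TopologicalSpace Y] {A D : Y → Osc N → ℂ}
    (hA : ∀ v, Continuous fun y => A y v) (hD : ∀ v, Continuous fun y => D y v)
    (f : OscPoly N) (b : Osc N →₀ ℕ) :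
    Continuous fun y => MvPowerSeries.coeff b (normalExp (A y) (D y) f) := by
  classical
  simp only [normalExp_apply, MvPowerSeries.coeff_mul, expSeries_coeff, Finsupp.prod,
    MvPolynomial.coeff_coe]
  refine continuous_finsetSum _ fun p _ => Continuous.mul ?_ (continuous_coeff_translate hD _ _)
  exact continuous_finsetProd _ fun v _ => ((hA v).pow _).div_const _

theorem exists_continuous_integrand {N : ℕ} [NeZero N] (hN : 2 ≤ N) {x : ℝ} (hx0 : 0 < x)
    (hx1 : x < 1) {r κ : ℂ} (hr : r.re ≠ 0) (hκ : κ ^ 2 = (r - 1) / r)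
    {ϑ : (Fin N → ℂ) → (Fin N → ℂ) → ℂ} (hϑ : IsTheta x r κ ϑ) {s : ℂ} (hs0 : 0 < s.re)
    (hs2 : s.re < 2) (m : ℕ) (ψ : Fock N) (σ : Sector N) (b : Osc N →₀ ℕ) :
    ∃ f : (Fin N × Fin m → ℝ) → ℂ, Continuous f ∧ ∀ᵐ θ : Fin N × Fin m → ℝ,
      MvPowerSeries.coeff b (integrand x r s κ ϑ (contourPoint x θ) ψ σ) = f θ := by
  have h0 : (x : ℂ) ≠ 0 := Complex.ofReal_ne_zero.mpr hx0.ne'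
  obtain ⟨C, g, Z, hg, hZ, h⟩ := exists_scalarFactor_eq hN hx0 hx1 hr hκ s m
  have hc := continuous_contourPoint (N := N) (m := m) x
  have hN2 : (2 : ℝ) ≤ N := by exact_mod_cast hN
  have hre : (s / N).re = s.re / N := by
    rw [← Complex.ofReal_natCast, Complex.div_ofReal_re]
  have hpair : ∀ {F : ℂ × ℂ → ℂ}, ContinuousOn F imagPairs → ∀ a b : Fin N × Fin m,
      Continuous fun θ => F (contourPoint x θ a, contourPoint x θ b) := fun hF a b =>
    hF.comp_continuous ((hc a).prodMk (hc b)) fun θ =>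
      ⟨contourPoint_re x θ a, contourPoint_re x θ b⟩
  have hcross := continuousOn_crossFactor hx0 hx1 hr (a := s / N)
    (by rw [hre]; positivity) (by rw [hre, div_lt_one (by linarith)]; linarith)
  refine ⟨fun θ => (C * planeWave x r κ (contourPoint x θ) (momentum κ σ) *
    (∏ t, ∏ i, ∏ j ∈ Finset.Ioi i, g (contourPoint x θ (t, i)) (contourPoint x θ (t, j))) *
    ∏ t, ∏ i, ∏ j, crossFactor x r (s / N) (contourPoint x θ (t, i))
      (contourPoint x θ (t + 1, j))) *
    ϑ (fun t => ∑ j, contourPoint x θ (t, j)) (momentum κ σ) *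
    MvPowerSeries.coeff b (normalExp (∑ t, ∑ i, creation x s t (contourPoint x θ (t, i)))
      (∑ t, ∑ i, annihilation x r s t (contourPoint x θ (t, i))) (ψ σ)), ?_, ?_⟩
  · refine ((((continuous_const.mul ?_).mul ?_).mul ?_).mul ?_).mul ?_
    · exact Continuous.const_cpow (by fun_prop) (Or.inl h0)
    · exact continuous_finsetProd _ fun t _ => continuous_finsetProd _ fun i _ =>
        continuous_finsetProd _ fun j _ => hpair hg _ _
    · exact continuous_finsetProd _ fun t _ => continuous_finsetProd _ fun i _ =>
        continuous_finsetProd _ fun j _ => hpair hcross _ _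
    · rw [continuous_iff_continuousAt]
      intro θ
      have h1 := (hϑ.analyticAt σ (fun t => ∑ j, contourPoint x θ (t, j)) fun t => by
        simp [contourPoint_re]).continuousAt
      have h2 : Continuous fun θ : Fin N × Fin m → ℝ => fun t => ∑ j, contourPoint x θ (t, j) := by
        fun_prop
      exact ContinuousAt.comp (f := fun θ : Fin N × Fin m → ℝ => fun t =>
        ∑ j, contourPoint x θ (t, j)) h1 h2.continuousAt
    · refine continuous_coeff_normalExp (fun v => ?_) (fun v => ?_) _ _
      · simp only [Finset.sum_apply, creation]
        refine continuous_finsetSum _ fun t _ => continuous_finsetSum _ fun i _ =>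
          continuous_const.mul (Continuous.const_cpow (by fun_prop) (Or.inl h0))
      · simp only [Finset.sum_apply, annihilation]
        refine continuous_finsetSum _ fun t _ => continuous_finsetSum _ fun i _ =>
          continuous_const.mul (Continuous.const_cpow (by fun_prop) (Or.inl h0))
  · filter_upwards [ae_contourPoint_generic hx0 hx1 hZ] with θ hθ
    rw [integrand_apply, h _ _ hθ, MvPowerSeries.coeff_smul]

theorem etaOp_nonlocalIM {N : ℕ} [NeZero N] (hN : 2 ≤ N) {x : ℝ} (hx0 : 0 < x) (hx1 : x < 1)
    {r κ : ℂ} (hr : r.re ≠ 0) (hκ : κ ^ 2 = (r - 1) / r) {s : ℂ} (hs : 0 < s.re)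
    {ϑ : (Fin N → ℂ) → (Fin N → ℂ) → ℂ} (hϑ : IsTheta x r κ ϑ) (m : ℕ) :
    etaOp x s hx0 (nonlocalIM x r s κ ϑ m) = nonlocalIM x r s κ ϑ m := by
  obtain ⟨Z, hZ, h⟩ := etaHat_integrand hN hx0 hx1 hr hκ hs hϑ m
  funext ψ σ b
  let e : Fin N × Fin m ≃ Fin N × Fin m := (Equiv.addRight (1 : Fin N)).prodCongr (Equiv.refl _)
  let F := MeasurableEquiv.piCongrLeft (fun _ : Fin N × Fin m => ℝ) e
  have hF : ∀ θ, F θ = rotate θ := fun θ => by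
    funext a
    obtain ⟨a, rfl⟩ := e.surjective a
    simp only [F, MeasurableEquiv.coe_piCongrLeft, Equiv.piCongrLeft_apply_apply]
    simp [e, rotate]
  have hmp : MeasureTheory.MeasurePreserving F :=
    MeasureTheory.volume_measurePreserving_piCongrLeft (fun _ : Fin N × Fin m => ℝ) e
  have hpre : F ⁻¹' Set.Icc 0 1 = Set.Icc 0 1 := by
    ext θ
    simp only [Set.mem_preimage, hF, Set.mem_Icc, Pi.le_def]
    constructor
    · rintro ⟨h1, h2⟩
      refine ⟨fun a => ?_, fun a => ?_⟩
      · simpa [rotate] using h1 (a.1 + 1, a.2)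
      · simpa [rotate] using h2 (a.1 + 1, a.2)
    · rintro ⟨h1, h2⟩
      exact ⟨fun a => h1 (a.1 - 1, a.2), fun a => h2 (a.1 - 1, a.2)⟩
  calc ((b.equivMapDomain (oscRot N).symm).prod fun v n => etaScalar x s v ^ n) *
        ∫ θ in Set.Icc (0 : Fin N × Fin m → ℝ) 1,
          MvPowerSeries.coeff (b.equivMapDomain (oscRot N).symm) (integrand x r s κ ϑ
            (contourPoint x θ) ((eta x s hx0).symm ψ) ((etaSector N).symm σ))
      = ∫ θ in Set.Icc (0 : Fin N × Fin m → ℝ) 1, MvPowerSeries.coeff b (etaHat x s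
          (integrand x r s κ ϑ (contourPoint x θ) ((eta x s hx0).symm ψ)) σ) := by
        rw [← MeasureTheory.integral_const_mul]
        rfl
    _ = ∫ θ in Set.Icc (0 : Fin N × Fin m → ℝ) 1, MvPowerSeries.coeff b
          (integrand x r s κ ϑ (contourPoint x (F θ)) ψ σ) := by
        refine MeasureTheory.integral_congr_ae (MeasureTheory.ae_restrict_of_ae ?_)
        filter_upwards [ae_contourPoint_generic hx0 hx1 hZ] with θ hθ
        rw [h _ hθ, hF]
        rfl
    _ = ∫ θ in Set.Icc (0 : Fin N × Fin m → ℝ) 1, MvPowerSeries.coeff b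
          (integrand x r s κ ϑ (contourPoint x θ) ψ σ) := by
        have := hmp.setIntegral_preimage_emb F.measurableEmbedding (fun θ => MvPowerSeries.coeff b
          (integrand x r s κ ϑ (contourPoint x θ) ψ σ)) (Set.Icc 0 1)
        rwa [hpre] at this

/-! ### Analytic continuation in `s` -/

theorem analyticAt_etaScalar {N : ℕ} {x : ℝ} (hx0 : 0 < x) (v : Osc N) (s : ℂ) :
    AnalyticAt ℂ (fun s => etaScalar x s v) s := by
  have h0 : (x : ℂ) ≠ 0 := Complex.ofReal_ne_zero.mpr hx0.ne'
  refine Differentiable.analyticAt (fun s => ?_) s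
  unfold etaScalar
  split_ifs <;> exact DifferentiableAt.const_cpow (by fun_prop) (Or.inl h0)

theorem etaPoly_symm_monomial {N : ℕ} [NeZero N] {x : ℝ} (hx0 : 0 < x) (s : ℂ)
    (c : Osc N →₀ ℕ) (a : ℂ) :
    (etaPoly x s hx0).symm (MvPolynomial.monomial c a) =
      (c.prod fun v n => (etaScalar x s ((oscRot N).symm v))⁻¹ ^ n) •
        (MvPolynomial.C a * c.prod fun v n => MvPolynomial.X ((oscRot N).symm v) ^ n) := by
  have h : (etaPoly x s hx0).symm (MvPolynomial.monomial c a) = MvPolynomial.C a *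
      c.prod fun v n => (MvPolynomial.C (etaScalar x s ((oscRot N).symm v))⁻¹ *
        MvPolynomial.X ((oscRot N).symm v) : OscPoly N) ^ n :=
    MvPolynomial.aeval_monomial _ _ _
  rw [h, MvPolynomial.smul_eq_C_mul, mul_left_comm]
  congr 1
  simp only [Finsupp.prod, mul_pow, Finset.prod_mul_distrib, map_prod, map_pow]

theorem analyticOnNhd_comp_eta_symm {N : ℕ} [NeZero N] {x : ℝ} (hx0 : 0 < x) {D : Set ℂ}
    {G : ℂ → Fock N →ₗ[ℂ] FockHat N}
    (hG : ∀ (ψ : Fock N) (σ : Sector N) (b : Osc N →₀ ℕ),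
      AnalyticOnNhd ℂ (fun s => MvPowerSeries.coeff b (G s ψ σ)) D)
    (ψ : Fock N) (σ : Sector N) (b : Osc N →₀ ℕ) :
    AnalyticOnNhd ℂ (fun s => MvPowerSeries.coeff b (G s ((eta x s hx0).symm ψ) σ)) D := by
  induction ψ using Finsupp.induction_linear with
  | zero =>
    simp only [map_zero, Pi.zero_apply]
    exact analyticOnNhd_const
  | add f g hf hg =>
    simp only [map_add, Pi.add_apply]
    exact hf.add hg
  | single τ p =>
    induction p using MvPolynomial.induction_on' with
    | add p q hp hq =>
      simp only [Finsupp.single_add, map_add, Pi.add_apply]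
      exact hp.add hq
    | monomial c a =>
      have h : ∀ s, (eta x s hx0).symm (Finsupp.single τ (MvPolynomial.monomial c a)) =
          (c.prod fun v n => (etaScalar x s ((oscRot N).symm v))⁻¹ ^ n) •
          Finsupp.single ((etaSector N).symm τ)
            (MvPolynomial.C a * c.prod fun v n => MvPolynomial.X ((oscRot N).symm v) ^ n) := by
        intro s
        rw [Finsupp.smul_single, ← etaPoly_symm_monomial hx0, LinearEquiv.symm_apply_eq]
        simp [eta]
      simp only [h, map_smul, Pi.smul_apply]
      refine AnalyticOnNhd.mul ?_ (hG _ σ b)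
      refine Finset.analyticOnNhd_fun_prod _ fun v _ s _ => ?_
      exact ((analyticAt_etaScalar hx0 _ s).inv (etaScalar_ne_zero hx0 s _)).pow _

theorem etaOp_eq_of_analyticOnNhd {N : ℕ} [NeZero N] {x : ℝ} (hx0 : 0 < x) {D : Set ℂ}
    (hD : IsPreconnected D) {G : ℂ → Fock N →ₗ[ℂ] FockHat N}
    (hG : ∀ (ψ : Fock N) (σ : Sector N) (b : Osc N →₀ ℕ),
      AnalyticOnNhd ℂ (fun s => MvPowerSeries.coeff b (G s ψ σ)) D)
    {s₀ : ℂ} (hs₀ : s₀ ∈ D) (h : ∀ᶠ s in nhds s₀, etaOp x s hx0 (G s) = G s) {s : ℂ}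
    (hs : s ∈ D) : etaOp x s hx0 (G s) = G s := by
  funext ψ σ b
  have h1 : AnalyticOnNhd ℂ (fun s => MvPowerSeries.coeff b (etaOp x s hx0 (G s) ψ σ)) D := by
    refine AnalyticOnNhd.mul ?_
      (analyticOnNhd_comp_eta_symm hx0 hG ψ ((etaSector N).symm σ)
        (b.equivMapDomain (oscRot N).symm))
    exact Finset.analyticOnNhd_fun_prod _ fun v _ s _ => (analyticAt_etaScalar hx0 v s).pow _
  exact h1.eqOn_of_preconnected_of_eventuallyEq (hG ψ σ b) hD hs₀
    (h.mono fun s hs => by dsimp only; rw [hs]) hs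

end DeformedW

end

theorem mainTheorem3 (N : ℕ) [NeZero N] (hN : 2 ≤ N)
    (x : ℝ) (hx0 : 0 < x) (hx1 : x < 1)
    (r κ : ℂ) (hr : r.re ≠ 0) (hr1 : r ≠ 1) (hκ : κ ^ 2 = (r - 1) / r)
    (ϑ : (Fin N → ℂ) → (Fin N → ℂ) → ℂ) (hϑ : DeformedW.IsTheta x r κ ϑ)
    (m : ℕ) (hm : 1 ≤ m) :
    (∀ s : ℂ, 0 < s.re → s.re < 2 →
      (∀ (ψ : DeformedW.Fock N) (σ : DeformedW.Sector N) (b : DeformedW.Osc N →₀ ℕ),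
        MeasureTheory.IntegrableOn (fun θ : Fin N × Fin m → ℝ =>
          MvPowerSeries.coeff b
            (DeformedW.integrand x r s κ ϑ (DeformedW.contourPoint x θ) ψ σ))
          (Set.Icc 0 1)) ∧
      DeformedW.etaOp x s hx0 (DeformedW.nonlocalIM x r s κ ϑ m) =
        DeformedW.nonlocalIM x r s κ ϑ m) ∧
    (∀ D : Set ℂ, IsOpen D → IsPreconnected D →
      (∃ s ∈ D, 0 < s.re ∧ s.re < 2) →
      ∀ G : ℂ → DeformedW.Fock N →ₗ[ℂ] DeformedW.FockHat N,
        (∀ (ψ : DeformedW.Fock N) (σ : DeformedW.Sector N) (b : DeformedW.Osc N →₀ ℕ),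
          AnalyticOnNhd ℂ (fun s => MvPowerSeries.coeff b (G s ψ σ)) D) →
        (∀ s ∈ D, 0 < s.re → s.re < 2 →
          ∀ ψ, G s ψ = DeformedW.nonlocalIM x r s κ ϑ m ψ) →
        ∀ s ∈ D, DeformedW.etaOp x s hx0 (G s) = G s) := by
  refine ⟨fun s hs0 hs2 => ⟨fun ψ σ b => ?_,
    DeformedW.etaOp_nonlocalIM hN hx0 hx1 hr hκ hs0 hϑ m⟩, ?_⟩
  · obtain ⟨f, hf, h⟩ := DeformedW.exists_continuous_integrand hN hx0 hx1 hr hκ hϑ hs0 hs2 m ψ σ b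
    exact (hf.continuousOn.integrableOn_compact isCompact_Icc).congr_fun_ae
      (MeasureTheory.ae_restrict_of_ae (h.mono fun _ e => e.symm))
  · rintro D hDo hDc ⟨s₀, hs₀, h1, h2⟩ G hG hGs s hs
    refine DeformedW.etaOp_eq_of_analyticOnNhd hx0 hDc hG hs₀ ?_ hs
    filter_upwards [hDo.mem_nhds hs₀, (isOpen_lt continuous_const Complex.continuous_re).mem_nhds h1,
      (isOpen_lt Complex.continuous_re continuous_const).mem_nhds h2] with s hsD hs0 hs2
    have e : (G s : DeformedW.Fock N → DeformedW.FockHat N) =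
        DeformedW.nonlocalIM x r s κ ϑ m := funext (hGs s hsD hs0 hs2)
    rw [e]
    exact DeformedW.etaOp_nonlocalIM hN hx0 hx1 hr hκ hs0 hϑ m
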